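/- **Setting.** Let $A$ be a complex $\ell\times\ell$ matrix and $p:\{1,\dots,\ell\}\to\mathbb Z/2$ such that $(A,p)$ is a Cartan supermatrix: every pair obtained from $(A,p)$ by a chain of odd reflections (at indices $i$ with $p(i)=1$, $a_{ii}=0$) satisfies: $a_{ij}=0\Rightarrow a_{ji}=0$; if $p(i)=0$ then $a_{ii}=2$ and $a_{ij}\in\mathbb Z_{\le 0}$ for $j\ne i$; if $p(i)=1$ then either $a_{ii}=2$ and $a_{ij}\in2\mathbb Z_{\le0}$ for $j\neq i$, or $a_{ii}=0$. Let $(\mathfrak h,\Sigma=\{\alpha_i\},\Sigma^\vee=\{\alpha_i^\vee\})$ be a realization of $A$ ($\alpha_j(\alpha_i^\vee)=a_{ij}$, $\dim\mathfrak h=2\ell-\operatorname{rank}A$, both sets linearly independent), and let $\mathfrak g=\mathfrak g(A)$ be the Kac–Moody superalgebra: the quotient of the Lie superalgebra $\tilde{\mathfrak g}(A)$ with generators $\mathfrak h,e_i,f_i$ (of parities $0,p(i),p(i)$) and relations $[\mathfrak h,\mathfrak h]=0$, $[e_i,f_j]=\delta_{ij}\alpha_i^\vee$, $[h,e_i]=\alpha_i(h)e_i$,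 $[h,f_i]=-\alpha_i(h)f_i$, and $[e_i,e_i]=[f_i,f_i]=0$ if $p(i)=1,a_{ii}=0$, by the maximal ideal intersecting $\mathfrak h$ trivially. Let $\mathfrak g_\gamma$ denote the root spaces, $\Delta^+_{\bar0},\Delta^+_{\bar 1}$ the even and odd positive roots, $Q^+=\mathbb Z_{\ge0}\Sigma$ and $\mathfrak n^+=\bigoplus_{\gamma\in\Delta^+}\mathfrak g_\gamma$. Modules are $\mathbb Z/2$-graded with parity preserving homomorphisms. Let $\rho\in\mathfrak h^*$ satisfy $\rho(\alpha_i^\vee)=\tfrac12\alpha_i(\alpha_i^\vee)$ for all $i$. Let $\alpha$ be an even root with $\alpha\in\Sigma$ or $\alpha/2\in\Sigma$; equivalently, for some $i$ with $a_{ii}=2$, either $p(i)=0$, $\alpha=\alpha_i$, $\alpha^\vee=\alpha_i^\vee$, or $p(i)=1$, $\alpha=2\alpha_i$, $\alpha^\vee=\alpha_i^\vee/2$. Let $e\in\mathfrak g_\alpha$, $f\in\mathfrak g_{-\alpha}$, $h=\alpha^\vee$ be the standard basis of $\mathfrak{sl}_2(\alpha)$, $r_\alpha(\mu)=\mu-\mu(\alpha^\vee)\alpha$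 and $r_\alpha.\mu=r_\alpha(\mu+\rho)-\rho$. Let $\mathcal O$ be the category of $\mathfrak g$-modules on which $\mathfrak h$ acts diagonally with finite-dimensional weight spaces and whose weights lie in a finite union of sets $\lambda_j-Q^+$. For $a\in\mathbb C$ let $\mathcal M(a)$ be the category of $\mathfrak g$-modules on which $h$ acts diagonally with eigenvalues in $a+\mathbb Z$, and let $\mathcal O^{fin}(a)$ be the full subcategory of finitely generated modules in $\mathcal O\cap\mathcal M(a)$. Let $L(\lambda)$ be the unique simple quotient of the Verma module of highest weight $\lambda$. For a $\mathfrak g$-module $N$ the twisted localization $\mathcal D_a(N)=f^a\otimes N[f^{-1}]$ is the localization $N[f^{-1}]$ of $N$ at the powers of $f$, on which $u\in U(\mathfrak g)$ acts by $u(f^a\otimes v)=f^a\otimes f^{-a}uf^{a}\,v$, where $f^{b}uf^{-b}:=\sum_{i\ge0}\binom{b}{i}(\operatorname{ad}f)^i(u)f^{-i}$. The Enright functor is $\mathcal C_a(N)=\{v\in\mathcal D_a(N)\mid\dim\mathbb C[e]v<\infty\}$. Put $\operatorname{ch}N=\sum_\nu\dim N_\nu\,e^\nu$, $R=\prod_{\gamma\in\Delta^+_{\bar0}}(1-e^{-\gamma})^{\dim\mathfrak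 g_\gamma}\prod_{\gamma\in\Delta^+_{\bar1}}(1+e^{-\gamma})^{-\dim\mathfrak g_\gamma}$ (expanded as a series in the $e^{-\nu}$, $\nu\in Q^+$), and $r_\alpha\bigl(\sum_\nu c_\nu e^\nu\bigr)=\sum_\nu c_\nu e^{r_\alpha\nu}$. **Theorem.** Let $a\notin\mathbb Z$. (i) The Enright functor $\mathcal C_a$ maps $\mathcal O^{fin}(a)$ to $\mathcal O^{fin}(-a)$ and induces an equivalence of categories $\mathcal O^{fin}(a)\to\mathcal O^{fin}(-a)$. (ii) If $\lambda\in\mathfrak h^*$ satisfies $\lambda(h)\in a+\mathbb Z$, then $\mathcal C_a(L(\lambda))\cong L(r_\alpha.\lambda)$, up to a change of parity. (iii) If $N\in\mathcal O\cap\mathcal M(a)$ is such that $\mathcal C_a(N)\in\mathcal O$, then $Re^\rho\operatorname{ch}\mathcal C_a(N)=r_\alpha\bigl(Re^\rho\operatorname{ch}N\bigr)$. In particular, this formula holds for every $N\in\mathcal O^{fin}(a)$. -/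

import Mathlib

open CategoryTheory

universe u

noncomputable section

namespace KMSuper

/-- Iterating a derivation of a bilinear product. -/
lemma leibniz_pow {V : Type*} [AddCommGroup V] [Module ℂ V] (B : V →ₗ[ℂ] V →ₗ[ℂ] V)
    (d : Module.End ℂ V) (hd : ∀ x y, d (B x y) = B (d x) y + B x (d y)) :
    ∀ (k n m : ℕ) (u w : V), n + m ≤ k + 1 → (d ^ n) u = 0 → (d ^ m) w = 0 →
      (d ^ k) (B u w) = 0 := by
  intro k
  induction k with
  | zero =>
    intro n m u w hk hn hm
    rcases Nat.eq_zero_or_pos n with rfl | hn0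
    · simp only [pow_zero, Module.End.one_apply] at hn ⊢; simp [hn]
    · obtain rfl : m = 0 := by omega
      simp only [pow_zero, Module.End.one_apply] at hm ⊢; simp [hm]
  | succ k ih =>
    intro n m u w hk hn hm
    rw [pow_succ, Module.End.mul_apply, hd, map_add]
    have h1 : (d ^ k) (B (d u) w) = 0 := by
      rcases n with _ | n
      · simp only [pow_zero, Module.End.one_apply] at hn; simp [hn]
      · exact ih n m _ _ (by omega) (by rwa [pow_succ, Module.End.mul_apply] at hn) hm
    have h2 : (d ^ k) (B u (d w)) = 0 := by
      rcases m with _ | m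
      · simp only [pow_zero, Module.End.one_apply] at hm; simp [hm]
      · exact ih n m _ _ (by omega) hn (by rwa [pow_succ, Module.End.mul_apply] at hm)
    rw [h1, h2, add_zero]

section Associative

variable {U : Type u} [Ring U] [Algebra ℂ U]

/-- The operator `ad f : u ↦ f u - u f` on an associative algebra. -/
def adOp (f : U) : Module.End ℂ U := LinearMap.mulLeft ℂ f - LinearMap.mulRight ℂ f

lemma adOp_apply (f u : U) : adOp f u = f * u - u * f := rfl

/-- `ad f` is locally nilpotent on the associative algebra `U`. -/
class AdLocNilp (f : U) : Prop where
  out : ∀ u : U, ∃ n : ℕ, (adOp f ^ n) u = 0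

lemma adOp_pow_zero_of_le {f u : U} {n m : ℕ} (h : (adOp f ^ n) u = 0) (hnm : n ≤ m) :
    (adOp f ^ m) u = 0 := by
  obtain ⟨k, rfl⟩ := Nat.exists_eq_add_of_le hnm
  rw [add_comm, pow_add, Module.End.mul_apply, h, map_zero]

lemma adOp_mul (f u w : U) : adOp f (u * w) = adOp f u * w + u * adOp f w := by
  simp only [adOp_apply]; noncomm_ring

lemma adOp_pow_mul (f : U) (k n m : ℕ) (u w : U) (h : n + m ≤ k + 1)
    (hu : (adOp f ^ n) u = 0) (hw : (adOp f ^ m) w = 0) : (adOp f ^ k) (u * w) = 0 :=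
  leibniz_pow (LinearMap.mul ℂ U) (adOp f) (adOp_mul f) k n m u w h hu hw

lemma pow_mul_eq_sum (f u : U) (n : ℕ) :
    f ^ n * u = ∑ i ∈ Finset.range (n + 1), n.choose i • ((adOp f ^ i) u * f ^ (n - i)) := by
  have hc : Commute (adOp f) (LinearMap.mulRight ℂ f) := by
    ext w
    simp [Module.End.mul_apply, adOp_apply]
    noncomm_ring
  have hL : LinearMap.mulLeft ℂ f = adOp f + LinearMap.mulRight ℂ f := by
    simp [adOp]
  have h : (LinearMap.mulLeft ℂ f ^ n) u = f ^ n * u := by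
    rw [LinearMap.pow_mulLeft]; simp
  rw [← h, hL, hc.add_pow, LinearMap.sum_apply]
  refine Finset.sum_congr rfl fun i _ => ?_
  rw [Commute.eq (hc.pow_pow i (n - i)), ← nsmul_eq_mul', LinearMap.smul_apply,
    Module.End.mul_apply, LinearMap.pow_mulRight, LinearMap.mulRight_apply]

lemma adOp_pow_mul_pow (f u : U) (k n : ℕ) :
    (adOp f ^ k) (u * f ^ n) = (adOp f ^ k) u * f ^ n := by
  induction k generalizing u with
  | zero => simp
  | succ k ih =>
    rw [pow_succ, Module.End.mul_apply, Module.End.mul_apply, adOp_mul]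
    have : adOp f (f ^ n) = 0 := by rw [adOp_apply, ← pow_succ, ← pow_succ', sub_self]
    rw [this, mul_zero, add_zero, ih]

lemma exists_ore (f u : U) [AdLocNilp f] (s : ℕ) :
    ∃ (m : ℕ) (w : U), f ^ m * u = w * f ^ s := by
  obtain ⟨k, hk⟩ := AdLocNilp.out (f := f) u
  refine ⟨k + s, ∑ i ∈ Finset.range (k + s + 1),
    (k + s).choose i • ((adOp f ^ i) u * f ^ (k - i)), ?_⟩
  rw [pow_mul_eq_sum, Finset.sum_mul]
  refine Finset.sum_congr rfl fun i _ => ?_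
  by_cases hi : i < k
  · rw [smul_mul_assoc, mul_assoc, ← pow_add]
    congr 4
    omega
  · rw [adOp_pow_zero_of_le hk (by omega)]; simp

lemma exists_cancel (f u : U) [AdLocNilp f] (s : ℕ) (h : u * f ^ s = 0) :
    ∃ m : ℕ, f ^ m * u = 0 := by
  obtain ⟨k, hk⟩ := AdLocNilp.out (f := f) u
  refine ⟨k + s, ?_⟩
  rw [pow_mul_eq_sum]
  refine Finset.sum_eq_zero fun i _ => ?_
  by_cases hi : i < k
  · have h1 : (adOp f ^ i) u * f ^ s = 0 := by rw [← adOp_pow_mul_pow, h, map_zero]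
    have h2 : k + s - i = s + (k - i) := by omega
    rw [h2, pow_add, ← mul_assoc, h1]; simp
  · rw [adOp_pow_zero_of_le hk (by omega)]; simp

/-- The powers of an `ad`-locally nilpotent element form a (left) Ore set. -/
instance oreSetPowers (f : U) [AdLocNilp f] : OreLocalization.OreSet (Submonoid.powers f) :=
  Classical.choice <| OreLocalization.nonempty_oreSet_iff.mpr <| by
    constructor
    · rintro r₁ r₂ ⟨_, n, rfl⟩ h
      obtain ⟨m, hm⟩ := exists_cancel f (r₁ - r₂) n (by rw [sub_mul]; exact sub_eq_zero.mpr h)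
      refine ⟨⟨f ^ m, m, rfl⟩, ?_⟩
      rw [mul_sub] at hm
      exact sub_eq_zero.mp hm
    · rintro r ⟨_, n, rfl⟩
      obtain ⟨m, w, h⟩ := exists_ore f r n
      exact ⟨w, ⟨f ^ m, m, rfl⟩, h⟩

/-- The localization `U[f⁻¹]`. -/
abbrev Loc (f : U) [AdLocNilp f] : Type u := OreLocalization (Submonoid.powers f) U

/-- The canonical map `U → U[f⁻¹]`. -/
def Loc.of (f : U) [AdLocNilp f] : U →+* Loc f := OreLocalization.numeratorRingHom

/-- The image of `f` in `U[f⁻¹]`. -/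
def Loc.num (f : U) [AdLocNilp f] : Loc f := Loc.of f f

/-- The element `f⁻¹` of `U[f⁻¹]`. -/
def Loc.inv (f : U) [AdLocNilp f] : Loc f :=
  OreLocalization.oreDiv (1 : U) (⟨f, 1, pow_one f⟩ : Submonoid.powers f)

lemma Loc.num_mul_inv (f : U) [AdLocNilp f] : Loc.num f * Loc.inv f = 1 :=
  OreLocalization.mul_inv (⟨f, 1, pow_one f⟩ : Submonoid.powers f) 1

lemma Loc.inv_mul_num (f : U) [AdLocNilp f] : Loc.inv f * Loc.num f = 1 :=
  OreLocalization.mul_inv (1 : Submonoid.powers f) ⟨f, 1, pow_one f⟩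

lemma Loc.adOp_of (f u : U) [AdLocNilp f] (n : ℕ) :
    (adOp (Loc.num f) ^ n) (Loc.of f u) = Loc.of f ((adOp f ^ n) u) := by
  induction n generalizing u with
  | zero => simp
  | succ n ih =>
    rw [pow_succ, Module.End.mul_apply, pow_succ, Module.End.mul_apply, ← ih]
    simp [adOp_apply, Loc.num]

instance Loc.adLocNilp (f : U) [AdLocNilp f] : AdLocNilp (Loc.num f) where
  out x := by
    induction x using OreLocalization.ind with
    | _ r s =>
      obtain ⟨_, k, rfl⟩ := s
      have h : OreLocalization.oreDiv r (⟨f ^ k, k, rfl⟩ : Submonoid.powers f)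
          = Loc.inv f ^ k * Loc.of f r := by
        have h1 : Loc.num f ^ k * OreLocalization.oreDiv r (⟨f ^ k, k, rfl⟩ : Submonoid.powers f)
            = Loc.of f r := by
          rw [Loc.num, ← map_pow]
          exact OreLocalization.mul_cancel (s := (⟨f ^ k, k, rfl⟩ : Submonoid.powers f)) (t := 1)
        have h2 : Loc.inv f ^ k * Loc.num f ^ k = 1 := by
          rw [← (show Commute (Loc.inv f) (Loc.num f) by
            rw [Commute, SemiconjBy, Loc.inv_mul_num, Loc.num_mul_inv]).mul_pow,
            Loc.inv_mul_num, one_pow]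
        rw [← h1, ← mul_assoc, h2, one_mul]
      obtain ⟨n, hn⟩ := AdLocNilp.out (f := f) r
      refine ⟨n, ?_⟩
      rw [h]
      refine adOp_pow_mul _ n 1 n _ _ (by omega) ?_ ?_
      · have hc : Commute (Loc.num f) (Loc.inv f ^ k) := Commute.pow_right (by
          rw [Commute, SemiconjBy, Loc.inv_mul_num, Loc.num_mul_inv]) k
        rw [pow_one, adOp_apply, hc.eq, sub_self]
      · rw [Loc.adOp_of, hn, map_zero]

/-- For an invertible `ad`-locally nilpotent element `f` with inverse `g`, the map
`φ_a(u) = ∑_{i ≥ 0} binom(a, i) (ad f)^i(u) f⁻ⁱ` (a finite sum). -/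
def phiFun (f g : U) (a : ℂ) (u : U) : U :=
  ∑ᶠ i : ℕ, Ring.choose a i • ((adOp f ^ i) u * g ^ i)

lemma phiFun_eq_sum (f g : U) (a : ℂ) (u : U) (K : ℕ) (h : (adOp f ^ K) u = 0) :
    phiFun f g a u = ∑ i ∈ Finset.range K, Ring.choose a i • ((adOp f ^ i) u * g ^ i) := by
  refine finsum_eq_sum_of_support_subset _ fun i hi => ?_
  simp only [Finset.coe_range, Set.mem_Iio]
  by_contra hK
  exact hi (by simp [adOp_pow_zero_of_le h (not_lt.mp hK)])

lemma phiFun_natCast (f g : U) (hfg : f * g = 1) (hgf : g * f = 1) (s : ℕ) (u : U) (K : ℕ)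
    (h : (adOp f ^ K) u = 0) : phiFun f g (s : ℂ) u = f ^ s * u * g ^ s := by
  have hcomm : Commute f g := by rw [Commute, SemiconjBy, hfg, hgf]
  rw [phiFun_eq_sum f g _ u (K + s + 1) (adOp_pow_zero_of_le h (by omega)), pow_mul_eq_sum,
    Finset.sum_mul]
  symm
  refine Finset.sum_subset_zero_on_sdiff
    (Finset.range_subset_range.mpr (by omega)) (fun i hi => ?_) (fun i hi => ?_)
  · rw [Finset.mem_sdiff, Finset.mem_range, Finset.mem_range] at hi
    rw [Ring.choose_natCast, Nat.choose_eq_zero_of_lt (by omega)]; simp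
  · rw [Finset.mem_range] at hi
    rw [Ring.choose_natCast, smul_mul_assoc, mul_assoc, Nat.cast_smul_eq_nsmul]
    congr 2
    obtain ⟨t, rfl⟩ : ∃ t, s = i + t := ⟨s - i, by omega⟩
    rw [Nat.add_sub_cancel_left, add_comm, pow_add, ← mul_assoc, ← hcomm.mul_pow, hfg,
      one_pow, one_mul]

/-- A vector-valued polynomial vanishing at all natural numbers vanishes. -/
lemma eq_of_polynomial {V : Type*} [AddCommGroup V] [Module ℂ V] {ι : Type*} (s : Finset ι)
    (P : ι → Polynomial ℂ) (y : ι → V) (h : ∀ n : ℕ, ∑ i ∈ s, (P i).eval (n : ℂ) • y i = 0)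
    (a : ℂ) : ∑ i ∈ s, (P i).eval a • y i = 0 := by
  rw [← Module.forall_dual_apply_eq_zero_iff ℂ]
  intro l
  have key : (∑ i ∈ s, P i * Polynomial.C (l (y i))) = 0 := by
    refine Polynomial.eq_zero_of_infinite_isRoot _ (Set.Infinite.mono ?_
      (Set.infinite_range_of_injective (Nat.cast_injective (R := ℂ))))
    rintro _ ⟨n, rfl⟩
    have := congrArg l (h n)
    simpa [Polynomial.IsRoot, Polynomial.eval_finsetSum] using this
  have := congrArg (Polynomial.eval a) key
  simpa [Polynomial.eval_finsetSum] using this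

/-- `binom(X, i)` as a polynomial. -/
def choosePoly (i : ℕ) : Polynomial ℂ :=
  Polynomial.C ((i.factorial : ℂ)⁻¹) * (descPochhammer ℂ i)

lemma choosePoly_eval (i : ℕ) (a : ℂ) : (choosePoly i).eval a = Ring.choose a i := by
  rw [Ring.choose_eq_smul, choosePoly, Polynomial.eval_mul, Polynomial.eval_C, smul_eq_mul,
    ← descPochhammer_map (Int.castRingHom ℂ) i, Polynomial.eval_map,
    ← Polynomial.aeval_eq_smeval]
  rfl

lemma phiFun_mul (f g : U) [AdLocNilp f] (hfg : f * g = 1) (hgf : g * f = 1) (a : ℂ) (u w : U) :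
    phiFun f g a (u * w) = phiFun f g a u * phiFun f g a w := by
  obtain ⟨n, hn⟩ := AdLocNilp.out (f := f) u
  obtain ⟨m, hm⟩ := AdLocNilp.out (f := f) w
  have hnm : (adOp f ^ (n + m)) (u * w) = 0 := adOp_pow_mul f _ n m u w (by omega) hn hm
  have key := eq_of_polynomial
    ((Finset.range (n + m)).disjSum (Finset.range n ×ˢ Finset.range m))
    (Sum.elim (fun i => choosePoly i) (fun q => choosePoly q.1 * choosePoly q.2))
    (Sum.elim (fun i => (adOp f ^ i) (u * w) * g ^ i)
      (fun q => - (((adOp f ^ q.1) u * g ^ q.1) * ((adOp f ^ q.2) w * g ^ q.2))))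
  have expand : ∀ b : ℂ, ∑ i ∈ (Finset.range (n + m)).disjSum (Finset.range n ×ˢ Finset.range m),
      Polynomial.eval b ((Sum.elim (fun i => choosePoly i)
        (fun q => choosePoly q.1 * choosePoly q.2) : ℕ ⊕ ℕ × ℕ → Polynomial ℂ) i) •
      ((Sum.elim (fun i => (adOp f ^ i) (u * w) * g ^ i)
      (fun q => - (((adOp f ^ q.1) u * g ^ q.1) * ((adOp f ^ q.2) w * g ^ q.2))) :
        ℕ ⊕ ℕ × ℕ → U) i) = phiFun f g b (u * w) - phiFun f g b u * phiFun f g b w := by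
    intro b
    rw [phiFun_eq_sum f g b _ _ hnm, phiFun_eq_sum f g b _ _ hn, phiFun_eq_sum f g b _ _ hm,
      Finset.sum_disjSum, sub_eq_add_neg, Finset.sum_mul_sum, ← Finset.sum_product',
      ← Finset.sum_neg_distrib]
    simp only [Sum.elim_inl, Sum.elim_inr, choosePoly_eval, Polynomial.eval_mul, smul_neg,
      smul_mul_smul_comm]
  simp only [expand] at key
  refine sub_eq_zero.mp (key (fun s => ?_) a)
  rw [phiFun_natCast f g hfg hgf s _ _ hnm, phiFun_natCast f g hfg hgf s _ _ hn,
    phiFun_natCast f g hfg hgf s _ _ hm, sub_eq_zero]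
  have hs : g ^ s * f ^ s = 1 := by
    rw [← (show Commute g f by rw [Commute, SemiconjBy, hfg, hgf]).mul_pow, hgf, one_pow]
  calc f ^ s * (u * w) * g ^ s = f ^ s * u * 1 * w * g ^ s := by noncomm_ring
    _ = _ := by rw [← hs]; noncomm_ring

/-- The automorphism `φ_a` of an algebra in which `f` is invertible (with inverse `g`). -/
def phi (f g : U) [AdLocNilp f] (hfg : f * g = 1) (hgf : g * f = 1) (a : ℂ) : U →+* U where
  toFun := phiFun f g a
  map_one' := by
    rw [phiFun_eq_sum f g a 1 1 (by simp [adOp_apply])]; simp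
  map_mul' := phiFun_mul f g hfg hgf a
  map_zero' := by rw [phiFun_eq_sum f g a 0 0 (by simp)]; simp
  map_add' u w := by
    obtain ⟨n, hn⟩ := AdLocNilp.out (f := f) u
    obtain ⟨m, hm⟩ := AdLocNilp.out (f := f) w
    have hn' := adOp_pow_zero_of_le hn (Nat.le_max_left n m)
    have hm' := adOp_pow_zero_of_le hm (Nat.le_max_right n m)
    rw [phiFun_eq_sum f g a _ _ hn', phiFun_eq_sum f g a _ _ hm',
      phiFun_eq_sum f g a (u + w) (max n m) (by rw [map_add, hn', hm', add_zero]),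
      ← Finset.sum_add_distrib]
    refine Finset.sum_congr rfl fun i _ => ?_
    rw [map_add, add_mul, smul_add]

/-- The localization functor `N ↦ N[f⁻¹]`. -/
def locFunctor (f : U) [AdLocNilp f] : ModuleCat.{u} U ⥤ ModuleCat.{u} (Loc f) where
  obj N := ModuleCat.of (Loc f) (OreLocalization (Submonoid.powers f) N)
  map {N N'} g := ModuleCat.ofHom
    { toFun := OreLocalization.liftExpand
        (fun n s => OreLocalization.oreDiv (g.hom n) s) (by
          intro r t s hst
          have := OreLocalization.expand (g.hom r) s t hst
          simpa using this)
      map_add' := by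
        intro x y
        induction x using OreLocalization.ind with
        | _ r s =>
        induction y using OreLocalization.ind with
        | _ r' s' =>
        obtain ⟨w, t, h⟩ : ∃ (w : U) (t : Submonoid.powers f), (t : U) * s = w * s' :=
          ⟨_, _, OreLocalization.ore_eq (s : U) s'⟩
        simp only [OreLocalization.oreDiv_add_char s s' w t h, OreLocalization.liftExpand_of,
          map_add, map_smul, Submonoid.smul_def]
      map_smul' := by
        intro c x
        induction x using OreLocalization.ind with
        | _ r s =>
        induction c using OreLocalization.ind with
        | _ u t =>
        obtain ⟨w, t', h⟩ : ∃ (w : U) (t' : Submonoid.powers f), (t' : U) * u = w * s :=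
          ⟨_, _, OreLocalization.ore_eq u s⟩
        simp only [OreLocalization.oreDiv_smul_char u _ t s w t' h,
          OreLocalization.liftExpand_of, map_smul, RingHom.id_apply] }
  map_id N := by
    ext x
    induction x using OreLocalization.ind with
    | _ r s => simp [OreLocalization.liftExpand_of]
  map_comp g g' := by
    ext x
    induction x using OreLocalization.ind with
    | _ r s => simp [OreLocalization.liftExpand_of]

/-- The twisted localization functor `D_a(N) = f^a ⊗ N[f⁻¹]`. On the bimodule generated by `f^a`
one has `f^a u = φ_a(u) f^a`, so that `u (f^a ⊗ v) = f^a ⊗ φ_{-a}(u) v`; hence, after identifying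
`f^a ⊗ v` with `v`, the module `D_a(N)` is `N[f⁻¹]` with `u ∈ U` acting as `φ_{-a}(u)`. -/
def twistedLoc (f : U) [AdLocNilp f] (a : ℂ) : ModuleCat.{u} U ⥤ ModuleCat.{u} U :=
  locFunctor f ⋙ ModuleCat.restrictScalars
    ((phi (Loc.num f) (Loc.inv f) (Loc.num_mul_inv f) (Loc.inv_mul_num f) (-a)).comp (Loc.of f))

open scoped ModuleCat

/-- The subspace `ℂ[e] v`. -/
def polySpan (e : U) {N : ModuleCat.{u} U} (v : N) : Submodule ℂ N :=
  Submodule.span ℂ (Set.range fun k : ℕ => e ^ k • v)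

/-- `v` is `e`-finite: `dim ℂ[e] v < ∞`. -/
def IsEFinite (e : U) {N : ModuleCat.{u} U} (v : N) : Prop :=
  FiniteDimensional ℂ (polySpan e v)

lemma isEFinite_smul (e : U) [AdLocNilp e] {N : ModuleCat.{u} U} (u : U) (v : N)
    (hv : IsEFinite e v) : IsEFinite e (u • v) := by
  obtain ⟨K, hK⟩ := AdLocNilp.out (f := e) u
  have : FiniteDimensional ℂ (polySpan e v) := hv
  let S : Submodule ℂ N := ⨆ i : Fin K,
    (polySpan e v).map (Algebra.lsmul ℂ ℂ N ((adOp e ^ (i : ℕ)) u))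
  have hle : polySpan e (u • v) ≤ S := by
    refine Submodule.span_le.mpr ?_
    rintro _ ⟨k, rfl⟩
    simp only [smul_smul, pow_mul_eq_sum, Finset.sum_smul]
    refine Submodule.sum_mem _ fun i _ => ?_
    by_cases hi : i < K
    · refine Submodule.mem_iSup_of_mem (⟨i, hi⟩ : Fin K)
        (Submodule.mem_map.mpr ⟨k.choose i • (e ^ (k - i) • v), ?_, ?_⟩)
      · exact nsmul_mem (show e ^ (k - i) • v ∈ polySpan e v from
          Submodule.subset_span ⟨k - i, rfl⟩) _
      · simp [mul_smul, Nat.cast_smul_eq_nsmul]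
    · rw [adOp_pow_zero_of_le hK (by omega)]; simp
  exact Submodule.finiteDimensional_of_le hle

/-- The `e`-finite part `Γ_e(N) = {v ∈ N | dim ℂ[e] v < ∞}` of a `U`-module `N`. -/
def eFinite (e : U) [AdLocNilp e] (N : ModuleCat.{u} U) : Submodule U N where
  carrier := {v | IsEFinite e v}
  zero_mem' := by
    have : polySpan e (0 : N) = ⊥ := by simp [polySpan]
    change FiniteDimensional ℂ (polySpan e (0 : N))
    rw [this]
    infer_instance
  add_mem' {v w} hv hw := by
    have : FiniteDimensional ℂ (polySpan e v) := hv
    have : FiniteDimensional ℂ (polySpan e w) := hw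
    refine Submodule.finiteDimensional_of_le (S₂ := polySpan e v ⊔ polySpan e w)
      (Submodule.span_le.mpr ?_)
    rintro _ ⟨k, rfl⟩
    simp only [smul_add]
    exact Submodule.add_mem_sup (Submodule.subset_span ⟨k, rfl⟩) (Submodule.subset_span ⟨k, rfl⟩)
  smul_mem' u v hv := isEFinite_smul e u v hv

lemma isEFinite_map (e : U) {N N' : ModuleCat.{u} U} (g : N ⟶ N') (v : N) (hv : IsEFinite e v) :
    IsEFinite e (g.hom v) := by
  have : FiniteDimensional ℂ (polySpan e v) := hv
  refine Submodule.finiteDimensional_of_le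
    (S₂ := (polySpan e v).map (g.hom.restrictScalars ℂ)) (Submodule.span_le.mpr ?_)
  rintro _ ⟨k, rfl⟩
  exact ⟨e ^ k • v, Submodule.subset_span ⟨k, rfl⟩, by simp⟩

/-- The Zuckerman functor `Γ_e`. -/
def zuckerman (e : U) [AdLocNilp e] : ModuleCat.{u} U ⥤ ModuleCat.{u} U where
  obj N := ModuleCat.of U (eFinite e N)
  map {N N'} g := ModuleCat.ofHom (g.hom.restrict fun v hv => isEFinite_map e g v hv)

/-- The Enright functor `C_a = Γ_e ∘ D_a`. -/
def enright (e f : U) [AdLocNilp e] [AdLocNilp f] (a : ℂ) : ModuleCat.{u} U ⥤ ModuleCat.{u} U :=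
  twistedLoc f a ⋙ zuckerman e

end Associative

section LieSuper

/-- The sign `(-1)^i` for `i ∈ ℤ/2`. -/
def sgn (i : ZMod 2) : ℂ := if i = 0 then 1 else -1

lemma sgn_sq (i : ZMod 2) : sgn i * sgn i = 1 := by
  unfold sgn; split_ifs <;> norm_num

lemma sgn_zero : sgn 0 = 1 := by simp [sgn]

lemma sgn_one : sgn 1 = -1 := by simp [sgn]

lemma sgn_add : ∀ i j : ZMod 2, sgn (i + j) = sgn i * sgn j := by
  intro i j
  have h : ∀ k : ZMod 2, k = 0 ∨ k = 1 := by decide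
  have h2 : (1 + 1 : ZMod 2) = 0 := by decide
  rcases h i with rfl | rfl <;> rcases h j with rfl | rfl <;> simp [sgn_zero, sgn_one, h2]

/-- A complex Lie superalgebra `L`. The `ℤ/2`-grading `L = L₀ ⊕ L₁` is encoded by its parity
involution `θ`, which is `(-1)^i` on `L_i`; thus `x ∈ L_i` means `θ x = (-1)^i x`. -/
class LieSuperalgebra (L : Type u) [AddCommGroup L] [Module ℂ L] where
  /-- the superbracket -/
  br : L →ₗ[ℂ] L →ₗ[ℂ] L
  /-- the parity involution -/
  θ : L →ₗ[ℂ] L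
  θ_θ : ∀ x, θ (θ x) = x
  θ_br : ∀ x y, θ (br x y) = br (θ x) (θ y)
  skew : ∀ (i j : ZMod 2) (x y : L), θ x = sgn i • x → θ y = sgn j • y →
    br x y = -(sgn (i * j) • br y x)
  jacobi : ∀ (i j : ZMod 2) (x y z : L), θ x = sgn i • x → θ y = sgn j • y →
    br x (br y z) = br (br x y) z + sgn (i * j) • br y (br x z)

open LieSuperalgebra

/-- A (two-sided, graded) ideal of a Lie superalgebra. -/
structure IsSuperIdeal {L : Type u} [AddCommGroup L] [Module ℂ L] [LieSuperalgebra L]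
    (J : Submodule ℂ L) : Prop where
  left : ∀ x y, y ∈ J → br x y ∈ J
  right : ∀ x y, x ∈ J → br x y ∈ J
  graded : ∀ x, x ∈ J → (θ x : L) ∈ J

section Quotient

variable {M : Type u} [AddCommGroup M] [Module ℂ M]

/-- The bilinear operation induced on a quotient. -/
def quotBr (B : M →ₗ[ℂ] M →ₗ[ℂ] M) (J : Submodule ℂ M) (hl : ∀ x y, y ∈ J → B x y ∈ J)
    (hr : ∀ x y, x ∈ J → B x y ∈ J) : (M ⧸ J) →ₗ[ℂ] (M ⧸ J) →ₗ[ℂ] (M ⧸ J) :=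
  J.liftQ
    { toFun := fun x => J.mapQ J (B x) (fun y hy => hl x y hy)
      map_add' := fun x y => by
        refine LinearMap.ext fun z => ?_
        induction z using Submodule.Quotient.induction_on with
        | _ z => simp
      map_smul' := fun c x => by
        refine LinearMap.ext fun z => ?_
        induction z using Submodule.Quotient.induction_on with
        | _ z => simp }
    (fun x hx => by
      rw [LinearMap.mem_ker]
      refine LinearMap.ext fun z => ?_
      induction z using Submodule.Quotient.induction_on with
      | _ z => simpa using hr x z hx)

lemma quotBr_mk (B : M →ₗ[ℂ] M →ₗ[ℂ] M) (J : Submodule ℂ M) (hl : ∀ x y, y ∈ J → B x y ∈ J)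
    (hr : ∀ x y, x ∈ J → B x y ∈ J) (x y : M) :
    quotBr B J hl hr (J.mkQ x) (J.mkQ y) = J.mkQ (B x y) := rfl

lemma exists_homogeneous_lift (t : M →ₗ[ℂ] M) (ht : ∀ x, t (t x) = x) (J : Submodule ℂ M)
    (hJ : ∀ x ∈ J, t x ∈ J) (i : ZMod 2) (X : M ⧸ J) (hX : J.mapQ J t hJ X = sgn i • X) :
    ∃ x, t x = sgn i • x ∧ J.mkQ x = X := by
  obtain ⟨x, rfl⟩ := J.mkQ_surjective X
  have hX' : J.mkQ (t x) = sgn i • J.mkQ x := hX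
  refine ⟨(2 : ℂ)⁻¹ • (x + sgn i • t x), ?_, ?_⟩
  · rw [map_smul, map_add, map_smul, ht, smul_comm (sgn i), smul_add (sgn i), smul_smul (sgn i),
      sgn_sq, one_smul, add_comm]
  · rw [map_smul, map_add, map_smul, hX', smul_smul, sgn_sq, one_smul, ← two_smul ℂ, smul_smul]
    norm_num

/-- The Lie superalgebra structure on a quotient by a graded two-sided ideal `J`, once the super
identities hold modulo `J`. -/
@[reducible] def quotLieSuperalgebra (B : M →ₗ[ℂ] M →ₗ[ℂ] M) (t : M →ₗ[ℂ] M)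
    (J : Submodule ℂ M)
    (ht : ∀ x, t (t x) = x) (htB : ∀ x y, t (B x y) = B (t x) (t y))
    (hl : ∀ x y, y ∈ J → B x y ∈ J) (hr : ∀ x y, x ∈ J → B x y ∈ J) (hJ : ∀ x ∈ J, t x ∈ J)
    (hskew : ∀ (i j : ZMod 2) (x y : M), t x = sgn i • x → t y = sgn j • y →
      B x y + sgn (i * j) • B y x ∈ J)
    (hjac : ∀ (i j : ZMod 2) (x y z : M), t x = sgn i • x → t y = sgn j • y →
      B x (B y z) - (B (B x y) z + sgn (i * j) • B y (B x z)) ∈ J) :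
    LieSuperalgebra (M ⧸ J) where
  br := quotBr B J hl hr
  θ := J.mapQ J t hJ
  θ_θ X := by
    obtain ⟨x, rfl⟩ := J.mkQ_surjective X
    simp [ht]
  θ_br X Y := by
    obtain ⟨x, rfl⟩ := J.mkQ_surjective X
    obtain ⟨y, rfl⟩ := J.mkQ_surjective Y
    exact congrArg J.mkQ (htB x y)
  skew i j X Y hX hY := by
    obtain ⟨x, hx, rfl⟩ := exists_homogeneous_lift t ht J hJ i X hX
    obtain ⟨y, hy, rfl⟩ := exists_homogeneous_lift t ht J hJ j Y hY
    rw [quotBr_mk, quotBr_mk, ← map_smul, eq_neg_iff_add_eq_zero, ← map_add]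
    exact (Submodule.Quotient.mk_eq_zero J).mpr (hskew i j x y hx hy)
  jacobi i j X Y Z hX hY := by
    obtain ⟨x, hx, rfl⟩ := exists_homogeneous_lift t ht J hJ i X hX
    obtain ⟨y, hy, rfl⟩ := exists_homogeneous_lift t ht J hJ j Y hY
    obtain ⟨z, rfl⟩ := J.mkQ_surjective Z
    simp only [quotBr_mk]
    rw [← map_smul J.mkQ, ← map_add]
    exact (Submodule.Quotient.eq J).mpr (hjac i j x y z hx hy)

/-- The quotient of a Lie superalgebra by an ideal. -/
@[reducible] def IsSuperIdeal.quotient [LieSuperalgebra M] {J : Submodule ℂ M}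
    (hJ : IsSuperIdeal J) : LieSuperalgebra (M ⧸ J) :=
  quotLieSuperalgebra br θ J θ_θ θ_br hJ.left hJ.right hJ.graded
    (fun i j x y hx hy => by rw [skew i j x y hx hy, neg_add_cancel]; exact J.zero_mem)
    (fun i j x y z hx hy => by rw [jacobi i j x y z hx hy, sub_self]; exact J.zero_mem)

end Quotient

section General

variable {L : Type u} [AddCommGroup L] [Module ℂ L] [LieSuperalgebra L]

lemma exists_decomp (N : Submodule ℂ L) (hN : ∀ x ∈ N, (θ x : L) ∈ N) (x : L) (hx : x ∈ N) :
    ∃ x0 ∈ N, ∃ x1 ∈ N, θ x0 = sgn 0 • x0 ∧ θ x1 = sgn 1 • x1 ∧ x = x0 + x1 := by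
  refine ⟨(2 : ℂ)⁻¹ • (x + θ x), N.smul_mem _ (N.add_mem hx (hN x hx)),
    (2 : ℂ)⁻¹ • (x - θ x), N.smul_mem _ (N.sub_mem hx (hN x hx)), ?_, ?_, ?_⟩
  · rw [map_smul, map_add, θ_θ, sgn_zero, one_smul, add_comm]
  · rw [map_smul, map_sub, θ_θ, sgn_one, neg_one_smul, ← smul_neg, neg_sub]
  · rw [← smul_add, add_add_sub_cancel, ← two_smul ℂ, smul_smul]; norm_num

lemma br_mem_of_hom (N K P : Submodule ℂ L) (hN : ∀ x ∈ N, (θ x : L) ∈ N)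
    (hK : ∀ x ∈ K, (θ x : L) ∈ K)
    (h : ∀ (i j : ZMod 2) (x y : L), x ∈ N → y ∈ K → θ x = sgn i • x → θ y = sgn j • y →
      br x y ∈ P) (x y : L) (hx : x ∈ N) (hy : y ∈ K) : br x y ∈ P := by
  obtain ⟨x0, hx0, x1, hx1, h0, h1, rfl⟩ := exists_decomp N hN x hx
  obtain ⟨y0, hy0, y1, hy1, k0, k1, rfl⟩ := exists_decomp K hK y hy
  simp only [map_add, LinearMap.add_apply]
  exact P.add_mem (P.add_mem (h _ _ _ _ hx0 hy0 h0 k0) (h _ _ _ _ hx1 hy0 h1 k0))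
    (P.add_mem (h _ _ _ _ hx0 hy1 h0 k1) (h _ _ _ _ hx1 hy1 h1 k1))

lemma isSuperIdeal_of_left (S : Submodule ℂ L) (hθ : ∀ x ∈ S, (θ x : L) ∈ S)
    (hl : ∀ x y, y ∈ S → br x y ∈ S) : IsSuperIdeal S where
  left := hl
  right x y hx := br_mem_of_hom S ⊤ S hθ (fun _ _ => trivial)
    (fun i j x y hx _ h1 h2 => by
      rw [skew i j x y h1 h2]
      exact S.neg_mem (S.smul_mem _ (hl y x hx))) x y hx trivial
  graded := hθ

/-- The stabilizer of a graded subspace. -/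
lemma stabilizer_br (S : Submodule ℂ L) (hθ : ∀ x ∈ S, (θ x : L) ∈ S) (x y : L)
    (hx : ∀ s ∈ S, br x s ∈ S) (hy : ∀ s ∈ S, br y s ∈ S) : ∀ s ∈ S, br (br x y) s ∈ S := by
  intro s hs
  let N : Submodule ℂ L :=
    { carrier := {z | ∀ s ∈ S, br z s ∈ S}
      zero_mem' := fun s _ => by simp
      add_mem' := fun ha hb s hs => by
        rw [map_add, LinearMap.add_apply]; exact S.add_mem (ha s hs) (hb s hs)
      smul_mem' := fun c z hz s hs => by
        rw [map_smul, LinearMap.smul_apply]; exact S.smul_mem c (hz s hs) }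
  have hN : ∀ z ∈ N, (θ z : L) ∈ N := fun z hz s hs => by
    have := hθ _ (hz _ (hθ s hs))
    rwa [θ_br, θ_θ] at this
  exact br_mem_of_hom N N N hN hN (fun i j a b ha hb h1 h2 s hs => by
    have := jacobi i j a b s h1 h2
    rw [eq_sub_of_add_eq this.symm]
    exact S.sub_mem (ha _ (hb s hs)) (S.smul_mem _ (hb _ (ha s hs)))) x y hx hy s hs

end General

end LieSuper

section KacMoody

open LieSuperalgebra

/-- The conditions (on the entries of a matrix with parity map) required of a Cartan matrix. -/
structure CartanAxioms {ℓ : ℕ} (A : Matrix (Fin ℓ) (Fin ℓ) ℂ) (p : Fin ℓ → ZMod 2) : Prop where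
  zero_symm : ∀ i j, A i j = 0 → A j i = 0
  even : ∀ i, p i = 0 → A i i = 2 ∧ ∀ j, j ≠ i → ∃ n : ℕ, A i j = -(n : ℂ)
  odd : ∀ i, p i = 1 → (A i i = 2 ∧ ∀ j, j ≠ i → ∃ n : ℕ, A i j = -(2 * n : ℂ)) ∨ A i i = 0

/-- Row `j` expresses the simple root `α'_j` of the base obtained by the odd reflection in `α_i`
through the old simple roots. -/
def oddReflRoot {ℓ : ℕ} (A : Matrix (Fin ℓ) (Fin ℓ) ℂ) (i : Fin ℓ) : Matrix (Fin ℓ) (Fin ℓ) ℂ :=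
  fun j => if j = i then -Pi.single i 1
    else if A i j = 0 then Pi.single j 1
    else Pi.single i 1 + Pi.single j 1

/-- Row `j` expresses the simple coroot `(α'_j)^∨` of the base obtained by the odd reflection in
`α_i` through the old simple coroots. -/
def oddReflCoroot {ℓ : ℕ} (A : Matrix (Fin ℓ) (Fin ℓ) ℂ) (i : Fin ℓ) :
    Matrix (Fin ℓ) (Fin ℓ) ℂ :=
  fun j => if A i j = 0 then Pi.single j 1
    else if A j j = 0 then
      (A i j * A j i)⁻¹ • (A i j • Pi.single j 1 + A j i • Pi.single i 1)
    else if A j i = -1 then A i j • Pi.single j 1 + A j i • Pi.single i 1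
    else (A i j * (A j i + 1))⁻¹ • (A i j • Pi.single j 1 + A j i • Pi.single i 1)

/-- The matrix `a'_{jk} = α'_k((α'_j)^∨)` after the odd reflection in `α_i`. -/
def oddReflMatrix {ℓ : ℕ} (A : Matrix (Fin ℓ) (Fin ℓ) ℂ) (i : Fin ℓ) :
    Matrix (Fin ℓ) (Fin ℓ) ℂ :=
  oddReflCoroot A i * A * (oddReflRoot A i).transpose

/-- The parity map after the odd reflection in `α_i`. -/
def oddReflParity {ℓ : ℕ} (A : Matrix (Fin ℓ) (Fin ℓ) ℂ) (p : Fin ℓ → ZMod 2) (i : Fin ℓ) :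
    Fin ℓ → ZMod 2 :=
  fun j => if A i j = 0 then p j else p j + 1

/-- `OddReachable A p A' p'`: the pair `(A', p')` is obtained from `(A, p)` by a chain of odd
reflections. -/
inductive OddReachable {ℓ : ℕ} (A : Matrix (Fin ℓ) (Fin ℓ) ℂ) (p : Fin ℓ → ZMod 2) :
    Matrix (Fin ℓ) (Fin ℓ) ℂ → (Fin ℓ → ZMod 2) → Prop
  | refl : OddReachable A p A p
  | step (A' : Matrix (Fin ℓ) (Fin ℓ) ℂ) (p' : Fin ℓ → ZMod 2) (i : Fin ℓ) :
      OddReachable A p A' p' → p' i = 1 → A' i i = 0 →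
      OddReachable A p (oddReflMatrix A' i) (oddReflParity A' p' i)

/-- `(A, p)` is a Cartan supermatrix. -/
def IsCartanSupermatrix {ℓ : ℕ} (A : Matrix (Fin ℓ) (Fin ℓ) ℂ) (p : Fin ℓ → ZMod 2) : Prop :=
  ∀ A' p', OddReachable A p A' p' → CartanAxioms A' p'

/-- A Cartan supermatrix `(A, p)` together with a realization `(𝔥, Σ, Σ^∨)` of `A`. -/
structure CartanDatum (ℓ : ℕ) (H : Type u) [AddCommGroup H] [Module ℂ H] where
  /-- the matrix -/
  A : Matrix (Fin ℓ) (Fin ℓ) ℂ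
  /-- the parity map -/
  p : Fin ℓ → ZMod 2
  isCartan : IsCartanSupermatrix A p
  finiteDimensional : FiniteDimensional ℂ H
  finrank_add_rank : Module.finrank ℂ H + A.rank = 2 * ℓ
  /-- the simple roots -/
  root : Fin ℓ → Module.Dual ℂ H
  /-- the simple coroots -/
  coroot : Fin ℓ → H
  root_linearIndependent : LinearIndependent ℂ root
  coroot_linearIndependent : LinearIndependent ℂ coroot
  root_coroot : ∀ i j, root j (coroot i) = A i j

/-- The generators of the Lie superalgebra `𝔤̃(A)`. -/
inductive Gen (ℓ : ℕ) (H : Type u) : Type u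
  | h : H → Gen ℓ H
  | e : Fin ℓ → Gen ℓ H
  | f : Fin ℓ → Gen ℓ H

/-- The free nonassociative algebra on the generators. -/
abbrev FreeGen (ℓ : ℕ) (H : Type u) : Type u := FreeNonUnitalNonAssocAlgebra ℂ (Gen ℓ H)

/-- The generators in the free nonassociative algebra. -/
def gen {ℓ : ℕ} {H : Type u} (x : Gen ℓ H) : FreeGen ℓ H := FreeNonUnitalNonAssocAlgebra.of ℂ x

variable {ℓ : ℕ} {H : Type u} [AddCommGroup H] [Module ℂ H]

namespace CartanDatum

variable (D : CartanDatum ℓ H)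

/-- The parity involution of the free nonassociative algebra; `h ∈ 𝔥` is even and `e_i`, `f_i`
have parity `p(i)`. -/
def freeθ : FreeGen ℓ H →ₙₐ[ℂ] FreeGen ℓ H :=
  FreeNonUnitalNonAssocAlgebra.lift ℂ fun
    | Gen.h x => gen (Gen.h x)
    | Gen.e i => sgn (D.p i) • gen (Gen.e i)
    | Gen.f i => sgn (D.p i) • gen (Gen.f i)

/-- The relations of `𝔤̃(A)`: linearity of `𝔥`, the Chevalley relations, and the super
skew-symmetry and super Jacobi identities. -/
inductive Rel : FreeGen ℓ H → Prop
  | add (x y : H) : Rel (gen (.h (x + y)) - (gen (.h x) + gen (.h y)))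
  | smul (c : ℂ) (x : H) : Rel (gen (.h (c • x)) - c • gen (.h x))
  | hh (x y : H) : Rel (gen (.h x) * gen (.h y))
  | ef (i : Fin ℓ) : Rel (gen (.e i) * gen (.f i) - gen (.h (D.coroot i)))
  | ef_ne (i j : Fin ℓ) : i ≠ j → Rel (gen (.e i) * gen (.f j))
  | he (x : H) (i : Fin ℓ) : Rel (gen (.h x) * gen (.e i) - D.root i x • gen (.e i))
  | hf (x : H) (i : Fin ℓ) : Rel (gen (.h x) * gen (.f i) + D.root i x • gen (.f i))
  | ee (i : Fin ℓ) : D.p i = 1 → D.A i i = 0 → Rel (gen (.e i) * gen (.e i))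
  | ff (i : Fin ℓ) : D.p i = 1 → D.A i i = 0 → Rel (gen (.f i) * gen (.f i))
  | skew (i j : ZMod 2) (x y : FreeGen ℓ H) : D.freeθ x = sgn i • x → D.freeθ y = sgn j • y →
      Rel (x * y + sgn (i * j) • (y * x))
  | jacobi (i j : ZMod 2) (x y z : FreeGen ℓ H) : D.freeθ x = sgn i • x →
      D.freeθ y = sgn j • y →
      Rel (x * (y * z) - (x * y * z + sgn (i * j) • (y * (x * z))))

/-- The two-sided ideal of the free nonassociative algebra generated by the relations. -/
def relIdeal : Submodule ℂ (FreeGen ℓ H) :=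
  sInf {J | (∀ x y, y ∈ J → x * y ∈ J) ∧ (∀ x y, x ∈ J → x * y ∈ J) ∧ ∀ r, D.Rel r → r ∈ J}

lemma relIdeal_left (x y : FreeGen ℓ H) (hy : y ∈ D.relIdeal) : x * y ∈ D.relIdeal := by
  rw [relIdeal, Submodule.mem_sInf] at *
  exact fun J hJ => hJ.1 x y (hy J hJ)

lemma relIdeal_right (x y : FreeGen ℓ H) (hx : x ∈ D.relIdeal) : x * y ∈ D.relIdeal := by
  rw [relIdeal, Submodule.mem_sInf] at *
  exact fun J hJ => hJ.2.1 x y (hx J hJ)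

lemma rel_mem (r : FreeGen ℓ H) (hr : D.Rel r) : r ∈ D.relIdeal := by
  rw [relIdeal, Submodule.mem_sInf]
  exact fun J hJ => hJ.2.2 r hr

@[simp] lemma freeθ_h (x : H) : D.freeθ (gen (.h x)) = gen (.h x) :=
  FreeNonUnitalNonAssocAlgebra.lift_of_apply ..

@[simp] lemma freeθ_e (i : Fin ℓ) : D.freeθ (gen (.e i)) = sgn (D.p i) • gen (.e i) :=
  FreeNonUnitalNonAssocAlgebra.lift_of_apply ..

@[simp] lemma freeθ_f (i : Fin ℓ) : D.freeθ (gen (.f i)) = sgn (D.p i) • gen (.f i) :=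
  FreeNonUnitalNonAssocAlgebra.lift_of_apply ..

lemma freeθ_freeθ (x : FreeGen ℓ H) : D.freeθ (D.freeθ x) = x := by
  have : D.freeθ.comp D.freeθ = NonUnitalAlgHom.id ℂ _ := by
    refine FreeNonUnitalNonAssocAlgebra.hom_ext ℂ fun g => ?_
    change D.freeθ (D.freeθ (gen g)) = gen g
    cases g <;> simp [smul_smul, sgn_sq]
  exact DFunLike.congr_fun this x

lemma freeθ_rel (r : FreeGen ℓ H) (hr : D.Rel r) : D.freeθ r ∈ D.relIdeal := by
  have hm := D.rel_mem
  cases hr with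
  | add x y => simpa using hm _ (.add x y)
  | smul c x => simpa using hm _ (.smul c x)
  | hh x y => simpa using hm _ (.hh x y)
  | ef i => simpa [smul_mul_smul_comm, sgn_sq] using hm _ (.ef i)
  | ef_ne i j h => simpa [smul_mul_smul_comm, sgn_sq] using D.relIdeal.smul_mem _ (hm _ (.ef_ne i j h))
  | he x i =>
    have := D.relIdeal.smul_mem (sgn (D.p i)) (hm _ (.he x i))
    simpa [smul_sub, smul_comm (sgn (D.p i)) (D.root i x), mul_smul_comm] using this
  | hf x i =>
    have := D.relIdeal.smul_mem (sgn (D.p i)) (hm _ (.hf x i))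
    simpa [smul_add, smul_comm (sgn (D.p i)) (D.root i x), mul_smul_comm] using this
  | ee i h1 h2 => simpa [smul_mul_smul_comm, sgn_sq] using hm _ (.ee i h1 h2)
  | ff i h1 h2 => simpa [smul_mul_smul_comm, sgn_sq] using hm _ (.ff i h1 h2)
  | skew i j x y hx hy =>
    have := D.relIdeal.smul_mem (sgn i * sgn j) (hm _ (.skew i j x y hx hy))
    rw [map_add, map_smul, map_mul, map_mul, hx, hy, smul_mul_smul_comm, smul_mul_smul_comm,
      mul_comm (sgn j), smul_comm, ← smul_add]
    exact this
  | jacobi i j x y z hx hy =>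
    have := D.relIdeal.smul_mem (sgn i * sgn j)
      (hm _ (.jacobi i j x y (D.freeθ z) hx hy))
    simp only [map_sub, map_add, map_smul, map_mul, hx, hy]
    convert this using 1
    simp only [smul_mul_assoc, mul_smul_comm]
    module

lemma relIdeal_freeθ (x : FreeGen ℓ H) (hx : x ∈ D.relIdeal) : D.freeθ x ∈ D.relIdeal := by
  have : D.relIdeal ≤ D.relIdeal.comap (D.freeθ : FreeGen ℓ H →ₗ[ℂ] FreeGen ℓ H) := by
    refine sInf_le ⟨fun x y hy => ?_, fun x y hx => ?_, fun r hr => D.freeθ_rel r hr⟩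
    · simpa using D.relIdeal_left _ _ hy
    · simpa using D.relIdeal_right _ _ hx
  exact this hx

/-- The Lie superalgebra `𝔤̃(A)`. -/
def Tilde : Type u := FreeGen ℓ H ⧸ D.relIdeal

instance : AddCommGroup D.Tilde := inferInstanceAs (AddCommGroup (FreeGen ℓ H ⧸ D.relIdeal))

instance : Module ℂ D.Tilde := inferInstanceAs (Module ℂ (FreeGen ℓ H ⧸ D.relIdeal))

instance : LieSuperalgebra D.Tilde :=
  quotLieSuperalgebra (LinearMap.mul ℂ (FreeGen ℓ H))
    (D.freeθ : FreeGen ℓ H →ₗ[ℂ] FreeGen ℓ H) D.relIdeal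
    D.freeθ_freeθ (fun x y => map_mul D.freeθ x y) D.relIdeal_left D.relIdeal_right
    D.relIdeal_freeθ (fun i j x y hx hy => D.rel_mem _ (.skew i j x y hx hy))
    (fun i j x y z hx hy => D.rel_mem _ (.jacobi i j x y z hx hy))

/-- The projection onto `𝔤̃(A)`. -/
def toTilde : FreeGen ℓ H →ₗ[ℂ] D.Tilde := D.relIdeal.mkQ

lemma toTilde_surjective : Function.Surjective D.toTilde := D.relIdeal.mkQ_surjective

lemma toTilde_rel (r : FreeGen ℓ H) (hr : D.Rel r) : D.toTilde r = 0 :=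
  (Submodule.Quotient.mk_eq_zero _).mpr (D.rel_mem r hr)

lemma br_toTilde (x y : FreeGen ℓ H) : br (D.toTilde x) (D.toTilde y) = D.toTilde (x * y) := rfl

lemma θ_toTilde (x : FreeGen ℓ H) : θ (D.toTilde x) = D.toTilde (D.freeθ x) := rfl

/-- The map `𝔥 → 𝔤̃(A)`. -/
def tildeH : H →ₗ[ℂ] D.Tilde where
  toFun x := D.toTilde (gen (.h x))
  map_add' x y := by
    rw [← map_add, ← sub_eq_zero, ← map_sub]; exact D.toTilde_rel _ (.add x y)
  map_smul' c x := by
    rw [RingHom.id_apply, ← map_smul, ← sub_eq_zero, ← map_sub]; exact D.toTilde_rel _ (.smul c x)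

/-- The maximal ideal of `𝔤̃(A)` which intersects `𝔥` trivially (the sum of all such ideals). -/
def maxIdeal : Submodule ℂ D.Tilde :=
  sSup {J | IsSuperIdeal J ∧ J ⊓ LinearMap.range D.tildeH = ⊥}

lemma isSuperIdeal_sSup {L : Type u} [AddCommGroup L] [Module ℂ L] [LieSuperalgebra L]
    (𝒥 : Set (Submodule ℂ L)) (h : ∀ J ∈ 𝒥, IsSuperIdeal J) : IsSuperIdeal (sSup 𝒥) := by
  refine ⟨fun x y hy => ?_, fun x y hx => ?_, fun x hx => ?_⟩
  · have : sSup 𝒥 ≤ (sSup 𝒥).comap (br x) :=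
      sSup_le fun J hJ z hz => le_sSup hJ ((h J hJ).left x z hz)
    exact this hy
  · have : sSup 𝒥 ≤ (sSup 𝒥).comap (br.flip y) :=
      sSup_le fun J hJ z hz => le_sSup hJ ((h J hJ).right z y hz)
    exact this hx
  · have : sSup 𝒥 ≤ (sSup 𝒥).comap θ :=
      sSup_le fun J hJ z hz => le_sSup hJ ((h J hJ).graded z hz)
    exact this hx

lemma isSuperIdeal_maxIdeal : IsSuperIdeal D.maxIdeal := isSuperIdeal_sSup _ fun _ hJ => hJ.1

/-- The Kac–Moody superalgebra `𝔤(A)`. -/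
def Alg : Type u := D.Tilde ⧸ D.maxIdeal

instance : AddCommGroup D.Alg := inferInstanceAs (AddCommGroup (D.Tilde ⧸ D.maxIdeal))

instance : Module ℂ D.Alg := inferInstanceAs (Module ℂ (D.Tilde ⧸ D.maxIdeal))

instance : LieSuperalgebra D.Alg := D.isSuperIdeal_maxIdeal.quotient

/-- The projection `𝔤̃(A) → 𝔤(A)`. -/
def toAlg : D.Tilde →ₗ[ℂ] D.Alg := D.maxIdeal.mkQ

lemma br_toAlg (x y : D.Tilde) : br (D.toAlg x) (D.toAlg y) = D.toAlg (br x y) := rfl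

lemma θ_toAlg (x : D.Tilde) : θ (D.toAlg x) = D.toAlg (θ x) := rfl

/-- The map `𝔥 → 𝔤(A)`. -/
def algH : H →ₗ[ℂ] D.Alg := D.toAlg ∘ₗ D.tildeH

/-- The generator `e_i ∈ 𝔤(A)`. -/
def algE (i : Fin ℓ) : D.Alg := D.toAlg (D.toTilde (gen (.e i)))

/-- The generator `f_i ∈ 𝔤(A)`. -/
def algF (i : Fin ℓ) : D.Alg := D.toAlg (D.toTilde (gen (.f i)))

end CartanDatum

end KacMoody

section Serre

open LieSuperalgebra

/-- Elements `t h`, `e_i`, `f_i` of a Lie superalgebra `L` which generate `L` and satisfy the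
Chevalley relations. -/
structure ChevalleyGens {ℓ : ℕ} {H : Type u} [AddCommGroup H] [Module ℂ H]
    (A : Matrix (Fin ℓ) (Fin ℓ) ℂ) (p : Fin ℓ → ZMod 2) (α : Fin ℓ → Module.Dual ℂ H)
    (αv : Fin ℓ → H) (L : Type u) [AddCommGroup L] [Module ℂ L] [LieSuperalgebra L] where
  /-- the map from the Cartan subalgebra -/
  t : H →ₗ[ℂ] L
  /-- the positive generators -/
  e : Fin ℓ → L
  /-- the negative generators -/
  f : Fin ℓ → L
  pairing : ∀ i j, α j (αv i) = A i j
  t_par : ∀ x, θ (t x) = t x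
  e_par : ∀ i, θ (e i) = sgn (p i) • e i
  f_par : ∀ i, θ (f i) = sgn (p i) • f i
  tt : ∀ x y, br (t x) (t y) = 0
  ef : ∀ i, br (e i) (f i) = t (αv i)
  ef_ne : ∀ i j, i ≠ j → br (e i) (f j) = 0
  te : ∀ x i, br (t x) (e i) = α i x • e i
  tf : ∀ x i, br (t x) (f i) = -(α i x • f i)
  generate : ∀ S : Submodule ℂ L, (∀ x ∈ S, ∀ y ∈ S, br x y ∈ S) → (∀ x, t x ∈ S) →
    (∀ i, e i ∈ S) → (∀ i, f i ∈ S) → S = ⊤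

namespace ChevalleyGens

variable {ℓ : ℕ} {H : Type u} [AddCommGroup H] [Module ℂ H]
  {A : Matrix (Fin ℓ) (Fin ℓ) ℂ} {p : Fin ℓ → ZMod 2} {α : Fin ℓ → Module.Dual ℂ H}
  {αv : Fin ℓ → H} {L : Type u} [AddCommGroup L] [Module ℂ L] [LieSuperalgebra L]
  (C : ChevalleyGens A p α αv L)


lemma t_par' (x : H) : θ (C.t x) = sgn 0 • C.t x := by rw [sgn_zero, one_smul, C.t_par]

lemma even_jac (x : L) (hx : θ x = x) (y z : L) :
    br x (br y z) = br (br x y) z + br y (br x z) := by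
  obtain ⟨y0, -, y1, -, h0, h1, rfl⟩ := exists_decomp ⊤ (fun _ _ => trivial) y trivial
  have hx' : θ x = sgn 0 • x := by rw [sgn_zero, one_smul, hx]
  have e0 := jacobi 0 0 x y0 z hx' h0
  have e1 := jacobi 0 1 x y1 z hx' h1
  rw [zero_mul, sgn_zero, one_smul] at e0 e1
  simp only [map_add, LinearMap.add_apply, e0, e1]
  abel

lemma t_jac (x : H) (y z : L) : br (C.t x) (br y z) = br (br (C.t x) y) z + br y (br (C.t x) z) :=
  even_jac _ (C.t_par x) y z

lemma fe (i : Fin ℓ) : br (C.f i) (C.e i) = -(sgn (p i) • C.t (αv i)) := by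
  have hp : p i * p i = p i := by generalize p i = k; revert k; decide
  rw [skew _ _ _ _ (C.f_par i) (C.e_par i), C.ef, hp]

lemma fe_ne (i j : Fin ℓ) (h : i ≠ j) : br (C.f i) (C.e j) = 0 := by
  rw [skew _ _ _ _ (C.f_par i) (C.e_par j), C.ef_ne j i h.symm, smul_zero, neg_zero]

lemma ft (i : Fin ℓ) (x : H) : br (C.f i) (C.t x) = α i x • C.f i := by
  rw [skew _ _ _ _ (C.f_par i) (C.t_par' x), mul_zero, sgn_zero, one_smul, C.tf, neg_neg]

lemma br_self (y : L) (i : ZMod 2) (hy : θ y = sgn i • y) : br y (br y y) = 0 := by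
  have h : ∀ k : ZMod 2, k = 0 ∨ k = 1 := by decide
  have h2 : ∀ k : ZMod 2, k + k = 0 := by decide
  have hj := jacobi i i y y y hy hy
  have hs := skew i (i + i) y (br y y) hy (by
    rw [θ_br, hy, map_smul, LinearMap.map_smul₂, smul_smul, sgn_add])
  rw [h2, mul_zero, sgn_zero, one_smul] at hs
  rcases h i with rfl | rfl
  · have := skew 0 0 y y hy hy
    rw [mul_zero, sgn_zero, one_smul] at this
    have h3 : (2 : ℂ) • br y y = 0 := by linear_combination (norm := module) this
    rw [(smul_eq_zero.mp h3).resolve_left two_ne_zero, map_zero]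
  · rw [mul_one, sgn_one, neg_one_smul, ← sub_eq_add_neg] at hj
    have h3 : (3 : ℂ) • br y (br y y) = 0 := by linear_combination (norm := module) hj + hs
    exact (smul_eq_zero.mp h3).resolve_left three_ne_zero

lemma ff_even (i : Fin ℓ) (h : p i = 0) : br (C.f i) (C.f i) = 0 := by
  have := skew _ _ _ _ (C.f_par i) (C.f_par i)
  rw [h, mul_zero, sgn_zero, one_smul] at this
  have h3 : (2 : ℂ) • br (C.f i) (C.f i) = 0 := by linear_combination (norm := module) this
  exact (smul_eq_zero.mp h3).resolve_left two_ne_zero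

lemma t_pow (x : H) (i : Fin ℓ) (y : L) (c : ℂ) (hy : br (C.t x) y = c • y) (m : ℕ) :
    br (C.t x) ((br (C.f i) ^ m) y) = (c - m * α i x) • (br (C.f i) ^ m) y := by
  induction m with
  | zero => simpa using hy
  | succ m ih =>
    rw [pow_succ', Module.End.mul_apply, C.t_jac, C.tf, ih, map_neg, map_smul, map_smul,
      LinearMap.neg_apply, LinearMap.smul_apply]
    push_cast
    module

lemma e_step (k i : Fin ℓ) (y : L) : br (C.e k) (br (C.f i) y) =
    br (br (C.e k) (C.f i)) y + sgn (p k * p i) • br (C.f i) (br (C.e k) y) :=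
  jacobi _ _ _ _ _ (C.e_par k) (C.f_par i)

lemma e_pow_ne (k i : Fin ℓ) (h : k ≠ i) (y : L) (m : ℕ) : br (C.e k) ((br (C.f i) ^ m) y) =
    sgn (p k * p i) ^ m • (br (C.f i) ^ m) (br (C.e k) y) := by
  induction m with
  | zero => simp
  | succ m ih =>
    rw [pow_succ' (br (C.f i)), Module.End.mul_apply, C.e_step, C.ef_ne k i h, ih, map_zero,
      LinearMap.zero_apply, zero_add, map_smul, smul_smul, ← pow_succ', Module.End.mul_apply]

/-- The coefficients in `e f^m y = c_m f^(m-1) y`. -/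
def cSeq (s n : ℂ) : ℕ → ℂ
  | 0 => 0
  | m + 1 => (n - 2 * m) + s * cSeq s n m

lemma e_pow (i : Fin ℓ) (hi : A i i = 2) (y : L) (n : ℂ) (h1 : br (C.e i) y = 0)
    (h2 : br (C.t (αv i)) y = n • y) (m : ℕ) : br (C.e i) ((br (C.f i) ^ (m + 1)) y) =
    cSeq (sgn (p i)) n (m + 1) • (br (C.f i) ^ m) y := by
  have hp : p i * p i = p i := by generalize p i = k; revert k; decide
  have hα : α i (αv i) = 2 := by rw [C.pairing, hi]
  induction m with
  | zero =>
    rw [pow_one, C.e_step, C.ef, h2, h1]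
    simp [cSeq]
  | succ m ih =>
    rw [pow_succ', Module.End.mul_apply, C.e_step, C.ef, ih, C.t_pow _ _ _ _ h2, hα, hp, map_smul,
      ← Module.End.mul_apply, ← pow_succ', smul_smul, ← add_smul]
    congr 1
    rw [cSeq.eq_2 _ _ (m + 1)]
    push_cast
    ring

lemma cSeq_zero (k : ZMod 2) (n : ℕ) (h : k = 1 → Even n) : cSeq (sgn k) n (n + 1) = 0 := by
  have h01 : ∀ k : ZMod 2, k = 0 ∨ k = 1 := by decide
  rcases h01 k with rfl | rfl
  · have : ∀ m : ℕ, cSeq (sgn 0) n m = m * n - m * (m - 1) := by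
      intro m
      induction m with
      | zero => simp [cSeq]
      | succ m ih => rw [cSeq, ih, sgn_zero]; push_cast; ring
    rw [this]; push_cast; ring
  · obtain ⟨r, rfl⟩ := h rfl
    have : ∀ m : ℕ, cSeq (sgn 1) (r + r : ℕ) (2 * m) = -2 * m := by
      intro m
      induction m with
      | zero => simp [cSeq]
      | succ m ih =>
        rw [show 2 * (m + 1) = 2 * m + 1 + 1 by ring, cSeq, cSeq, ih, sgn_one]; push_cast; ring
    have h2 := this r
    rw [← two_mul] at h2 ⊢
    rw [cSeq, h2, sgn_one]; push_cast; ring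

lemma serre_kill (i j : Fin ℓ) (hij : i ≠ j) (hi : A i i = 2) (n : ℕ) (hn : A i j = -(n : ℂ))
    (hpar : p i = 1 → Even n) (h0 : n = 0 → A j i = 0) (k : Fin ℓ) :
    br (C.e k) ((br (C.f i) ^ (n + 1)) (C.f j)) = 0 := by
  by_cases hk : k = i
  · subst hk
    rw [C.e_pow k hi _ n (C.ef_ne k j hij) (by rw [C.tf, C.pairing, hn, neg_smul, neg_neg]),
      cSeq_zero _ _ hpar, zero_smul]
  · rw [C.e_pow_ne k i hk]
    by_cases hkj : k = j
    · subst hkj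
      rw [C.ef, pow_succ (br (C.f i)), Module.End.mul_apply, C.ft, C.pairing]
      rcases n with _ | n
      · rw [h0 rfl, zero_smul, map_zero, smul_zero]
      · rw [pow_succ (br (C.f i)), Module.End.mul_apply, map_smul]
        have h01 : ∀ k : ZMod 2, k = 0 ∨ k = 1 := by decide
        rcases h01 (p i) with hp | hp
        · rw [C.ff_even i hp, smul_zero, map_zero, smul_zero]
        · rcases n with _ | n
          · exact absurd (hpar hp) (by decide)
          · rw [pow_succ (br (C.f i)), Module.End.mul_apply, map_smul, br_self _ _ (C.f_par i), smul_zero,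
              map_zero, smul_zero]
    · rw [C.ef_ne k j hkj, map_zero, smul_zero]

lemma exists_grading_element [FiniteDimensional ℂ H] (hα : LinearIndependent ℂ α) :
    ∃ x : H, ∀ i, α i x = 1 := by
  obtain ⟨φ, hφ⟩ : ∃ φ : Module.Dual ℂ (Module.Dual ℂ H), ∀ i, φ (α i) = 1 := by
    obtain ⟨φ, hφ⟩ := LinearMap.exists_extend
      ((Finsupp.linearCombination ℂ (fun _ : Fin ℓ => (1 : ℂ))) ∘ₗ
        (hα.repr : Submodule.span ℂ (Set.range α) →ₗ[ℂ] Fin ℓ →₀ ℂ))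
    refine ⟨φ, fun i => ?_⟩
    have h := LinearMap.congr_fun hφ ⟨α i, Submodule.subset_span ⟨i, rfl⟩⟩
    have h2 := hα.repr_eq_single i ⟨α i, Submodule.subset_span ⟨i, rfl⟩⟩ rfl
    simpa [h2] using h
  refine ⟨(Module.evalEquiv ℂ H).symm φ, fun i => ?_⟩
  rw [← hφ i]
  simp

/-- A vector killed by all `e_k`, of negative degree, generates an ideal meeting the Cartan
subalgebra trivially. -/
lemma exists_ideal (x : L) (hx : ∀ k, br (C.e k) x = 0) (w : H → ℂ)
    (hw : ∀ h, br (C.t h) x = w h • x) (c : ℂ) (hc : θ x = c • x) (x0 : H)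
    (hx0 : ∀ i, α i x0 = 1) (r : ℕ) (hr : w x0 = -(r + 1 : ℂ)) :
    ∃ J : Submodule ℂ L, IsSuperIdeal J ∧ J ⊓ LinearMap.range C.t = ⊥ ∧ x ∈ J := by
  let g : List (Fin ℓ) → L := fun l => l.foldr (fun k y => br (C.f k) y) x
  have hg : ∀ k l, br (C.f k) (g l) = g (k :: l) := fun k l => rfl
  let S : Submodule ℂ L := Submodule.span ℂ (Set.range g)
  have hgS : ∀ l, g l ∈ S := fun l => Submodule.subset_span ⟨l, rfl⟩
  have hgw : ∀ l, ∃ w' : H → ℂ, ∀ h, br (C.t h) (g l) = w' h • g l := by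
    intro l
    induction l with
    | nil => exact ⟨w, hw⟩
    | cons k l ih =>
      obtain ⟨w', h'⟩ := ih
      refine ⟨fun h => w' h - α k h, fun h => ?_⟩
      rw [← hg, C.t_jac, C.tf, h', map_neg, map_smul, map_smul, LinearMap.neg_apply,
        LinearMap.smul_apply]
      module
  have hg0 : ∀ l, br (C.t x0) (g l) = (-(r + 1 + l.length : ℂ)) • g l := by
    intro l
    induction l with
    | nil => rw [show g [] = x from rfl, hw, hr]; simp
    | cons k l ih =>
      rw [← hg, C.t_jac, C.tf, ih, hx0, map_neg, map_smul, map_smul, LinearMap.neg_apply,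
        LinearMap.smul_apply, List.length_cons]
      push_cast
      module
  have hgθ : ∀ l, ∃ c' : ℂ, θ (g l) = c' • g l := by
    intro l
    induction l with
    | nil => exact ⟨c, hc⟩
    | cons k l ih =>
      obtain ⟨c', h'⟩ := ih
      refine ⟨sgn (p k) * c', ?_⟩
      rw [← hg, θ_br, h', C.f_par, map_smul, map_smul, LinearMap.smul_apply, smul_smul, mul_comm]
  have span_ind : ∀ d : L →ₗ[ℂ] L, (∀ l, d (g l) ∈ S) → ∀ s ∈ S, d s ∈ S := by
    intro d hd s hs
    have : S ≤ S.comap d := Submodule.span_le.mpr (by rintro _ ⟨l, rfl⟩; exact hd l)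
    exact this hs
  have hf : ∀ k, ∀ s ∈ S, br (C.f k) s ∈ S := fun k => span_ind _ fun l => hgS (k :: l)
  have ht : ∀ h, ∀ s ∈ S, br (C.t h) s ∈ S := fun h => span_ind _ fun l => by
    obtain ⟨w', h'⟩ := hgw l
    rw [h']; exact S.smul_mem _ (hgS l)
  have hθ : ∀ s ∈ S, (θ s : L) ∈ S := span_ind θ fun l => by
    obtain ⟨c', h'⟩ := hgθ l
    rw [h']; exact S.smul_mem _ (hgS l)
  have he : ∀ k, ∀ s ∈ S, br (C.e k) s ∈ S := fun k => span_ind _ fun l => by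
    induction l with
    | nil => rw [show g [] = x from rfl, hx]; exact S.zero_mem
    | cons m l ih =>
      rw [← hg, C.e_step]
      refine S.add_mem ?_ (S.smul_mem _ (hf m _ ih))
      by_cases hkm : k = m
      · subst hkm; rw [C.ef]; exact ht _ _ (hgS l)
      · rw [C.ef_ne k m hkm, map_zero]; exact S.zero_mem
  let N : Submodule ℂ L :=
    { carrier := {z | ∀ s ∈ S, br z s ∈ S}
      zero_mem' := fun s _ => by simp
      add_mem' := fun ha hb s hs => by
        rw [map_add, LinearMap.add_apply]; exact S.add_mem (ha s hs) (hb s hs)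
      smul_mem' := fun c z hz s hs => by
        rw [map_smul, LinearMap.smul_apply]; exact S.smul_mem c (hz s hs) }
  have hN : N = ⊤ := C.generate N (fun a ha b hb => stabilizer_br S hθ a b ha hb) ht he hf
  have hl : ∀ z y, y ∈ S → br z y ∈ S := fun z y hy => by
    have hz : z ∈ N := hN ▸ trivial
    exact hz y hy
  refine ⟨S, isSuperIdeal_of_left S hθ hl, ?_, hgS []⟩
  have h1 : S ≤ ⨆ (μ : ℂ) (_ : μ ≠ 0), Module.End.eigenspace (br (C.t x0)) μ := by
    refine Submodule.span_le.mpr ?_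
    rintro _ ⟨l, rfl⟩
    refine Submodule.mem_iSup_of_mem (-(r + 1 + l.length : ℂ))
      (Submodule.mem_iSup_of_mem ?_ (Module.End.mem_eigenspace_iff.mpr (hg0 l)))
    rw [neg_ne_zero]
    exact_mod_cast (by omega : r + 1 + l.length ≠ 0)
  have h2 : LinearMap.range C.t ≤ Module.End.eigenspace (br (C.t x0)) 0 := by
    rintro _ ⟨h, rfl⟩
    rw [Module.End.mem_eigenspace_iff, C.tt, zero_smul]
  have h3 := Module.End.eigenspaces_iSupIndep (br (C.t x0)) 0
  exact disjoint_iff.mp (h3.symm.mono h1 h2)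

lemma exists_ideal_serre [FiniteDimensional ℂ H] (hα : LinearIndependent ℂ α)
    (i j : Fin ℓ) (hij : i ≠ j) (hi : A i i = 2) (n : ℕ) (hn : A i j = -(n : ℂ))
    (hpar : p i = 1 → Even n) (h0 : n = 0 → A j i = 0) :
    ∃ J : Submodule ℂ L, IsSuperIdeal J ∧ J ⊓ LinearMap.range C.t = ⊥ ∧
      (br (C.f i) ^ (n + 1)) (C.f j) ∈ J := by
  obtain ⟨x0, hx0⟩ := exists_grading_element hα
  have hθ : ∀ m : ℕ, ∃ c : ℂ, θ ((br (C.f i) ^ m) (C.f j)) = c • (br (C.f i) ^ m) (C.f j) := by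
    intro m
    induction m with
    | zero => exact ⟨_, C.f_par j⟩
    | succ m ih =>
      obtain ⟨c, hc⟩ := ih
      refine ⟨c * sgn (p i), ?_⟩
      rw [pow_succ', Module.End.mul_apply, θ_br, hc, C.f_par, map_smul, map_smul,
        LinearMap.smul_apply, smul_smul]
  obtain ⟨c, hc⟩ := hθ (n + 1)
  refine C.exists_ideal _ (C.serre_kill i j hij hi n hn hpar h0) _
    (fun h => C.t_pow h i (C.f j) (-(α j h)) (by rw [C.tf, neg_smul]) (n + 1)) c hc x0 hx0
    (n + 1) ?_
  rw [hx0, hx0]; push_cast; ring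

/-- Exchanging the roles of the positive and the negative generators. -/
def swap : ChevalleyGens A p (-α) (-αv) L where
  t := C.t
  e := C.f
  f i := sgn (p i) • C.e i
  pairing i j := by simpa using C.pairing i j
  t_par := C.t_par
  e_par := C.f_par
  f_par i := by rw [map_smul, C.e_par]
  tt := C.tt
  ef i := by
    rw [map_smul, C.fe, smul_neg, smul_smul, sgn_sq, one_smul, Pi.neg_apply, map_neg]
  ef_ne i j h := by rw [map_smul, C.fe_ne i j h, smul_zero]
  te x i := by rw [C.tf, Pi.neg_apply, LinearMap.neg_apply, neg_smul]
  tf x i := by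
    rw [map_smul, C.te, Pi.neg_apply, LinearMap.neg_apply, neg_smul, neg_neg, smul_comm]
  generate S hS ht he hf := C.generate S hS ht (fun i => by
    have := S.smul_mem (sgn (p i)) (hf i)
    rwa [smul_smul, sgn_sq, one_smul] at this) he

/-- The even element `f_i` (for `p(i) = 0`) or `c [f_i, f_i]` (for `p(i) = 1`). -/
def evenElt (k : ZMod 2) (c : ℂ) (y : L) : L := if k = 0 then y else c • br y y

lemma evenElt_par (k : ZMod 2) (c : ℂ) (y : L) (hy : θ y = sgn k • y) :
    θ (evenElt k c y) = evenElt k c y := by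
  unfold evenElt
  split_ifs with h
  · rw [hy, h, sgn_zero, one_smul]
  · rw [map_smul, θ_br, hy, map_smul, LinearMap.map_smul₂, smul_smul (sgn k), sgn_sq, one_smul]

lemma evenElt_pow (k : ZMod 2) (c : ℂ) (y : L) (hy : θ y = sgn k • y) (z : L) (N : ℕ)
    (h : (br y ^ N) z = 0) : (br (evenElt k c y) ^ N) z = 0 := by
  have h01 : ∀ k : ZMod 2, k = 0 ∨ k = 1 := by decide
  rcases h01 k with rfl | rfl
  · simpa [evenElt] using h
  · have h1 : br (evenElt 1 c y) = (c * 2) • (br y ^ 2) := by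
      refine LinearMap.ext fun w => ?_
      have hj := jacobi 1 1 y y w hy hy
      rw [mul_one, sgn_one, neg_one_smul] at hj
      have h2 : br (br y y) w = (2 : ℂ) • br y (br y w) := by
        linear_combination (norm := module) -hj
      rw [evenElt, if_neg one_ne_zero, map_smul, LinearMap.smul_apply, h2, smul_smul,
        LinearMap.smul_apply, pow_two, Module.End.mul_apply]
    rw [h1, smul_pow, LinearMap.smul_apply, ← pow_mul, mul_comm 2 N, mul_two N, pow_add,
      Module.End.mul_apply, h, map_zero, smul_zero]

/-- `ad f_i` (or `ad [f_i, f_i]`) is locally nilpotent. -/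
lemma adLocNilp (i : Fin ℓ) (c : ℂ)
    (hs : ∀ j, j ≠ i → ∃ N, (br (C.f i) ^ N) (C.f j) = 0) (x : L) :
    ∃ N, (br (evenElt (p i) c (C.f i)) ^ N) x = 0 := by
  set P := br (evenElt (p i) c (C.f i)) with hP
  have key : ∀ y N, (br (C.f i) ^ N) y = 0 → ∃ N, (P ^ N) y = 0 := fun y N h =>
    ⟨N, evenElt_pow _ _ _ (C.f_par i) _ _ h⟩
  have hmono : ∀ y n m, (P ^ n) y = 0 → n ≤ m → (P ^ m) y = 0 := fun y n m h hnm => by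
    obtain ⟨k, rfl⟩ := Nat.exists_eq_add_of_le hnm
    rw [add_comm, pow_add, Module.End.mul_apply, h, map_zero]
  let S : Submodule ℂ L :=
    { carrier := {y | ∃ N, (P ^ N) y = 0}
      zero_mem' := ⟨0, map_zero _⟩
      add_mem' := fun {y z} hy hz => by
        obtain ⟨n, hn⟩ := hy
        obtain ⟨m, hm⟩ := hz
        exact ⟨max n m, by rw [map_add, hmono _ _ _ hn (le_max_left n m),
          hmono _ _ _ hm (le_max_right n m), add_zero]⟩
      smul_mem' := fun a y hy => by
        obtain ⟨n, hn⟩ := hy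
        exact ⟨n, by rw [map_smul, hn, smul_zero]⟩ }
  have hff : (br (C.f i) ^ 2) (C.f i) = 0 := by
    rw [pow_two, Module.End.mul_apply, br_self _ _ (C.f_par i)]
  have ht : ∀ y, (br (C.f i) ^ 3) (C.t y) = 0 := fun y => by
    rw [pow_succ, Module.End.mul_apply, C.ft, map_smul, hff, smul_zero]
  have hS : S = ⊤ := by
    refine C.generate S ?_ (fun y => key _ 3 (ht y)) (fun j => ?_) (fun j => ?_)
    · rintro y ⟨n, hn⟩ z ⟨m, hm⟩
      exact ⟨n + m, leibniz_pow br P (even_jac _ (evenElt_par _ _ _ (C.f_par i))) (n + m) n m y z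
        (by omega) hn hm⟩
    · by_cases hj : i = j
      · subst hj
        refine key _ 4 ?_
        rw [pow_succ, Module.End.mul_apply, C.fe, map_neg, map_smul, ht, smul_zero, neg_zero]
      · refine key _ 1 ?_
        rw [pow_one, C.fe_ne i j hj]
    · by_cases hj : j = i
      · subst hj; exact key _ 2 hff
      · obtain ⟨N, hN⟩ := hs j hj
        exact key _ N hN
  have hx : x ∈ S := hS ▸ trivial
  exact hx

end ChevalleyGens

namespace CartanDatum

variable {ℓ : ℕ} {H : Type u} [AddCommGroup H] [Module ℂ H] (D : CartanDatum ℓ H)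

lemma toTilde_e_par (i : Fin ℓ) :
    θ (D.toTilde (gen (.e i))) = sgn (D.p i) • D.toTilde (gen (.e i)) := by
  rw [θ_toTilde, freeθ_e, map_smul]

lemma toTilde_f_par (i : Fin ℓ) :
    θ (D.toTilde (gen (.f i))) = sgn (D.p i) • D.toTilde (gen (.f i)) := by
  rw [θ_toTilde, freeθ_f, map_smul]

/-- The Chevalley generators of `𝔤̃(A)`. -/
def tildeGens : ChevalleyGens D.A D.p D.root D.coroot D.Tilde where
  t := D.tildeH
  e i := D.toTilde (gen (.e i))
  f i := D.toTilde (gen (.f i))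
  pairing := D.root_coroot
  t_par x := by
    change θ (D.toTilde (gen (.h x))) = D.toTilde (gen (.h x))
    rw [θ_toTilde, freeθ_h]
  e_par := D.toTilde_e_par
  f_par := D.toTilde_f_par
  tt x y := D.toTilde_rel _ (.hh x y)
  ef i := by
    have := D.toTilde_rel _ (.ef i)
    rwa [map_sub, sub_eq_zero] at this
  ef_ne i j h := D.toTilde_rel _ (.ef_ne i j h)
  te x i := by
    have := D.toTilde_rel _ (.he x i)
    rwa [map_sub, sub_eq_zero, map_smul] at this
  tf x i := by
    have := D.toTilde_rel _ (.hf x i)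
    rwa [map_add, map_smul, ← eq_neg_iff_add_eq_zero] at this
  generate S hS ht he hf := by
    have key : ∀ w : FreeMagma (Gen ℓ H), D.toTilde (MonoidAlgebra.single w (1 : ℂ)) ∈ S := by
      intro w
      induction w using FreeMagma.recOnMul with
      | ih1 g =>
        cases g with
        | h x => exact ht x
        | e i => exact he i
        | f i => exact hf i
      | ih2 x y hx hy =>
        have := hS _ hx _ hy
        rwa [br_toTilde, MonoidAlgebra.single_mul_single, one_mul] at this
    rw [eq_top_iff]
    rintro x -
    obtain ⟨y, rfl⟩ := D.toTilde_surjective x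
    induction y using MonoidAlgebra.induction_linear with
    | zero => rw [map_zero]; exact S.zero_mem
    | add a b ha hb => rw [map_add]; exact S.add_mem ha hb
    | single w r =>
      have h : (MonoidAlgebra.single w r : FreeGen ℓ H) = r • MonoidAlgebra.single w (1 : ℂ) := by
        rw [MonoidAlgebra.smul_single, smul_eq_mul, mul_one]
      rw [h, map_smul]
      exact S.smul_mem r (key w)

/-- The Chevalley generators of `𝔤(A)`. -/
def algGens : ChevalleyGens D.A D.p D.root D.coroot D.Alg where
  t := D.algH
  e := D.algE
  f := D.algF
  pairing := D.root_coroot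
  t_par x := congrArg D.toAlg (D.tildeGens.t_par x)
  e_par i := (congrArg D.toAlg (D.tildeGens.e_par i)).trans (map_smul ..)
  f_par i := (congrArg D.toAlg (D.tildeGens.f_par i)).trans (map_smul ..)
  tt x y := (congrArg D.toAlg (D.tildeGens.tt x y)).trans (map_zero _)
  ef i := congrArg D.toAlg (D.tildeGens.ef i)
  ef_ne i j h := (congrArg D.toAlg (D.tildeGens.ef_ne i j h)).trans (map_zero _)
  te x i := (congrArg D.toAlg (D.tildeGens.te x i)).trans (map_smul ..)
  tf x i := (congrArg D.toAlg (D.tildeGens.tf x i)).trans (by rw [map_neg, map_smul]; rfl)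
  generate S hS ht he hf := by
    have h : S.comap D.toAlg = ⊤ := D.tildeGens.generate _ (fun x hx y hy => by
      rw [Submodule.mem_comap, ← br_toAlg]; exact hS _ hx _ hy) ht he hf
    rw [eq_top_iff]
    rintro x -
    obtain ⟨y, rfl⟩ := D.maxIdeal.mkQ_surjective x
    have hy : y ∈ S.comap D.toAlg := h ▸ trivial
    exact hy

lemma br_toAlg_pow (x y : D.Tilde) (N : ℕ) :
    (br (D.toAlg x) ^ N) (D.toAlg y) = D.toAlg ((br x ^ N) y) := by
  induction N with
  | zero => rfl
  | succ N ih => rw [pow_succ', Module.End.mul_apply, ih, br_toAlg, pow_succ', Module.End.mul_apply]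

lemma toAlg_eq_zero (x : D.Tilde) (J : Submodule ℂ D.Tilde) (h1 : IsSuperIdeal J)
    (h2 : J ⊓ LinearMap.range D.tildeH = ⊥) (hx : x ∈ J) : D.toAlg x = 0 :=
  (Submodule.Quotient.mk_eq_zero _).mpr
    ((le_sSup (a := J) ⟨h1, h2⟩ : J ≤ D.maxIdeal) hx)

lemma entry (i j : Fin ℓ) (hij : j ≠ i) (hi : D.A i i = 2) :
    ∃ n : ℕ, D.A i j = -(n : ℂ) ∧ (D.p i = 1 → Even n) ∧ (n = 0 → D.A j i = 0) := by
  have hC := D.isCartan _ _ .refl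
  have h01 : ∀ k : ZMod 2, k = 0 ∨ k = 1 := by decide
  have hz : D.A i j = 0 → D.A j i = 0 := hC.zero_symm i j
  rcases h01 (D.p i) with hp | hp
  · obtain ⟨n, hn⟩ := (hC.even i hp).2 j hij
    exact ⟨n, hn, fun h => by rw [hp] at h; exact absurd h (by decide),
      fun h => hz (by rw [hn, h]; simp)⟩
  · rcases hC.odd i hp with h | h
    · obtain ⟨n, hn⟩ := h.2 j hij
      exact ⟨2 * n, by rw [hn]; push_cast; ring, fun _ => even_two_mul n,
        fun h => hz (by rw [hn, (by omega : n = 0)]; simp)⟩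
    · rw [hi] at h; exact absurd h two_ne_zero

lemma neg_root_li : LinearIndependent ℂ (-D.root) := by
  have := D.root_linearIndependent.units_smul (fun _ => (-1 : ℂˣ))
  convert this using 1
  ext i
  simp

lemma adLocNilp_f (i : Fin ℓ) (hi : D.A i i = 2) (c : ℂ) (x : D.Alg) :
    ∃ N, (br (ChevalleyGens.evenElt (D.p i) c (D.algF i)) ^ N) x = 0 := by
  have := D.finiteDimensional
  refine D.algGens.adLocNilp i c (fun j hj => ?_) x
  obtain ⟨n, hn, hpar, h0⟩ := D.entry i j hj hi
  obtain ⟨J, h1, h2, h3⟩ := D.tildeGens.exists_ideal_serre D.root_linearIndependent i j hj.symm hi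
    n hn hpar h0
  exact ⟨n + 1, (D.br_toAlg_pow _ _ _).trans (D.toAlg_eq_zero _ J h1 h2 h3)⟩

lemma adLocNilp_e (i : Fin ℓ) (hi : D.A i i = 2) (c : ℂ) (x : D.Alg) :
    ∃ N, (br (ChevalleyGens.evenElt (D.p i) c (D.algE i)) ^ N) x = 0 := by
  have := D.finiteDimensional
  have key := D.algGens.swap.adLocNilp i c (fun j hj => ?_) x
  · have : ChevalleyGens.evenElt (D.p i) c (D.algGens.swap.f i) =
        ChevalleyGens.evenElt (D.p i) c (D.algE i) := by
      change ChevalleyGens.evenElt (D.p i) c (sgn (D.p i) • D.algE i) = _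
      unfold ChevalleyGens.evenElt
      split_ifs with h
      · rw [h, sgn_zero, one_smul]
      · rw [map_smul, LinearMap.map_smul₂, smul_smul (sgn (D.p i)), sgn_sq, one_smul]
    rwa [this] at key
  · obtain ⟨n, hn, hpar, h0⟩ := D.entry i j hj hi
    obtain ⟨J, h1, h2, h3⟩ := D.tildeGens.swap.exists_ideal_serre D.neg_root_li i j hj.symm hi
      n hn hpar h0
    refine ⟨n + 1, ?_⟩
    have e : ∀ k, D.algGens.swap.f k = D.toAlg (D.tildeGens.swap.f k) := fun k =>
      (map_smul D.toAlg _ _).symm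
    rw [e, e, D.br_toAlg_pow]
    exact D.toAlg_eq_zero _ J h1 h2 h3

end CartanDatum

end Serre

section Modules

open LieSuperalgebra
open scoped ModuleCat

section Enveloping

variable (L : Type u) [AddCommGroup L] [Module ℂ L] [LieSuperalgebra L]

/-- The relations of the algebra generated by `L` (via `some`) and a parity operator `σ`
(via `none`): the relations of the universal enveloping superalgebra of `L`, together with
`σ² = 1` and `σ x = (-1)^{p(x)} x σ`. -/
inductive EnvRel : FreeAlgebra ℂ (Option L) → FreeAlgebra ℂ (Option L) → Prop
  | add (x y : L) : EnvRel (FreeAlgebra.ι ℂ (some (x + y)))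
      (FreeAlgebra.ι ℂ (some x) + FreeAlgebra.ι ℂ (some y))
  | smul (c : ℂ) (x : L) : EnvRel (FreeAlgebra.ι ℂ (some (c • x))) (c • FreeAlgebra.ι ℂ (some x))
  | bracket (i j : ZMod 2) (x y : L) : θ x = sgn i • x → θ y = sgn j • y →
      EnvRel (FreeAlgebra.ι ℂ (some x) * FreeAlgebra.ι ℂ (some y))
        (sgn (i * j) • (FreeAlgebra.ι ℂ (some y) * FreeAlgebra.ι ℂ (some x)) +
          FreeAlgebra.ι ℂ (some (br x y)))
  | parity_sq : EnvRel (FreeAlgebra.ι ℂ none * FreeAlgebra.ι ℂ none) 1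
  | parity_mul (x : L) : EnvRel (FreeAlgebra.ι ℂ none * FreeAlgebra.ι ℂ (some x))
      (FreeAlgebra.ι ℂ (some (θ x)) * FreeAlgebra.ι ℂ none)

/-- The universal enveloping superalgebra `U(L)` with a parity operator `σ` adjoined, i.e. the
smash product `U(L) ⋊ ℤ/2`. A module `N` over it is the same thing as a `ℤ/2`-graded `L`-module:
`N_i` is the subspace where `σ` acts by `(-1)^i`; the module homomorphisms are the parity
preserving homomorphisms of `L`-modules, and the submodules are the graded submodules. -/
def Env : Type u := RingQuot (EnvRel L)

instance : Ring (Env L) := inferInstanceAs (Ring (RingQuot (EnvRel L)))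

instance : Algebra ℂ (Env L) := inferInstanceAs (Algebra ℂ (RingQuot (EnvRel L)))

/-- The projection from the free algebra. -/
def Env.mk : FreeAlgebra ℂ (Option L) →ₐ[ℂ] Env L := RingQuot.mkAlgHom ℂ (EnvRel L)

variable {L}

lemma Env.mk_rel {x y : FreeAlgebra ℂ (Option L)} (h : EnvRel L x y) :
    Env.mk L x = Env.mk L y := RingQuot.mkAlgHom_rel ℂ h

/-- The canonical map `L → U(L)`. -/
def Env.ι : L →ₗ[ℂ] Env L where
  toFun x := Env.mk L (FreeAlgebra.ι ℂ (some x))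
  map_add' x y := by rw [Env.mk_rel (.add x y), map_add]
  map_smul' c x := by rw [Env.mk_rel (.smul c x), map_smul, RingHom.id_apply]

/-- The parity operator `σ`. -/
def Env.σ : Env L := Env.mk L (FreeAlgebra.ι ℂ none)

lemma Env.adOp_ι (x y : L) (hx : θ x = x) : adOp (Env.ι x) (Env.ι y) = Env.ι (br x y) := by
  have h : ∀ (j : ZMod 2) (y : L), θ y = sgn j • y →
      adOp (Env.ι x) (Env.ι y) = Env.ι (br x y) := fun j y hy => by
    have := Env.mk_rel (.bracket 0 j x y (by rw [sgn_zero, one_smul, hx]) hy)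
    rw [zero_mul, sgn_zero, one_smul, map_add, map_mul, map_mul] at this
    exact sub_eq_iff_eq_add'.mpr this
  obtain ⟨y0, -, y1, -, h0, h1, rfl⟩ := exists_decomp ⊤ (fun _ _ => trivial) y trivial
  simp only [map_add, h _ _ h0, h _ _ h1]

lemma Env.adLocNilp (x : L) (hx : θ x = x) (h : ∀ y, ∃ N, (br x ^ N) y = 0) :
    AdLocNilp (Env.ι x) where
  out u := by
    obtain ⟨w, rfl⟩ := RingQuot.mkAlgHom_surjective ℂ (EnvRel L) u
    change ∃ n, (adOp (Env.ι x) ^ n) (Env.mk L w) = 0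
    induction w using FreeAlgebra.induction with
    | grade0 r =>
      refine ⟨1, ?_⟩
      rw [pow_one, adOp_apply, AlgHom.commutes, Algebra.commutes, sub_self]
    | grade1 z =>
      rcases z with _ | y
      · refine ⟨1, ?_⟩
        have := Env.mk_rel (.parity_mul x)
        rw [hx, map_mul, map_mul] at this
        rw [pow_one, adOp_apply]
        exact sub_eq_zero.mpr this.symm
      · obtain ⟨N, hN⟩ := h y
        refine ⟨N, ?_⟩
        have key : ∀ (n : ℕ) (y : L), (adOp (Env.ι x) ^ n) (Env.ι y) = Env.ι ((br x ^ n) y) := by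
          intro n
          induction n with
          | zero => intro y; rfl
          | succ n ih =>
            intro y
            rw [pow_succ, Module.End.mul_apply, Env.adOp_ι x y hx, ih, pow_succ,
              Module.End.mul_apply]
        exact (key N y).trans (by rw [hN, map_zero])
    | mul a b ha hb =>
      obtain ⟨n, hn⟩ := ha
      obtain ⟨m, hm⟩ := hb
      exact ⟨n + m, by rw [map_mul]; exact adOp_pow_mul _ _ n m _ _ (by omega) hn hm⟩
    | add a b ha hb =>
      obtain ⟨n, hn⟩ := ha
      obtain ⟨m, hm⟩ := hb
      exact ⟨max n m, by rw [map_add, map_add, adOp_pow_zero_of_le hn (le_max_left n m),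
        adOp_pow_zero_of_le hm (le_max_right n m), add_zero]⟩

end Enveloping

namespace CartanDatum

variable {ℓ : ℕ} {H : Type u} [AddCommGroup H] [Module ℂ H] (D : CartanDatum ℓ H)

/-- The category of `ℤ/2`-graded `𝔤(A)`-modules (with parity preserving homomorphisms). -/
abbrev Mod : Type (u + 1) := ModuleCat.{u} (Env D.Alg)

/-- For `a_ii = 2`, the even root `α ∈ {α_i, 2 α_i}` attached to `α_i`. -/
def evenRoot (i : Fin ℓ) : Module.Dual ℂ H := if D.p i = 0 then D.root i else (2 : ℂ) • D.root i

/-- The coroot `h = α^∨` of `evenRoot i`. -/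
def evenCoroot (i : Fin ℓ) : H :=
  if D.p i = 0 then D.coroot i else (2 : ℂ)⁻¹ • D.coroot i

/-- The element `e ∈ 𝔤_α` of the standard basis of `𝔰𝔩₂(α)`: `e = e_i` if `α = α_i`, and
`e = [e_i, e_i] / 4` if `α = 2 α_i`. -/
def sl2E (i : Fin ℓ) : D.Alg := ChevalleyGens.evenElt (D.p i) (4 : ℂ)⁻¹ (D.algE i)

/-- The element `f ∈ 𝔤_{-α}` of the standard basis of `𝔰𝔩₂(α)`: `f = f_i` if `α = α_i`, and
`f = - [f_i, f_i] / 4` if `α = 2 α_i`. -/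
def sl2F (i : Fin ℓ) : D.Alg := ChevalleyGens.evenElt (D.p i) (-(4 : ℂ)⁻¹) (D.algF i)

/-- The Enright functor `C_a : 𝔤-Mod → 𝔤-Mod` for `𝔰𝔩₂(α)`. -/
def enrightFunctor (i : Fin ℓ) (hi : D.A i i = 2) (a : ℂ) : D.Mod ⥤ D.Mod :=
  haveI : AdLocNilp (Env.ι (D.sl2E i)) :=
    Env.adLocNilp _ (ChevalleyGens.evenElt_par _ _ _ (D.algGens.e_par i)) (D.adLocNilp_e i hi _)
  haveI : AdLocNilp (Env.ι (D.sl2F i)) :=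
    Env.adLocNilp _ (ChevalleyGens.evenElt_par _ _ _ (D.algGens.f_par i)) (D.adLocNilp_f i hi _)
  enright (Env.ι (D.sl2E i)) (Env.ι (D.sl2F i)) a

/-- The reflection `r_α` of `𝔥^*`. -/
def refl (i : Fin ℓ) (μ : Module.Dual ℂ H) : Module.Dual ℂ H :=
  μ - μ (D.evenCoroot i) • D.evenRoot i

/-- `ρ` is a Weyl vector. -/
def IsWeylVector (ρ : Module.Dual ℂ H) : Prop :=
  ∀ i, ρ (D.coroot i) = D.root i (D.coroot i) / 2

/-- The twisted action `r_α.μ = r_α(μ + ρ) - ρ`. -/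
def dotRefl (ρ : Module.Dual ℂ H) (i : Fin ℓ) (μ : Module.Dual ℂ H) : Module.Dual ℂ H :=
  D.refl i (μ + ρ) - ρ

/-- The element `∑ n_i α_i` of `Q⁺`. -/
def weight (n : Fin ℓ →₀ ℕ) : Module.Dual ℂ H := ∑ i, (n i : ℂ) • D.root i

/-- The root space `𝔤_β`. -/
def rootSpace (β : Module.Dual ℂ H) : Submodule ℂ D.Alg :=
  ⨅ h : H, Module.End.eigenspace (br (D.algH h)) (β h)

/-- `𝔫⁺`, the sum of the root spaces of the positive roots. -/
def nPlus : Submodule ℂ D.Alg := ⨆ (n : Fin ℓ →₀ ℕ) (_ : n ≠ 0), D.rootSpace (D.weight n)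

/-- The weight space `N_ν = {v | h v = ν(h) v for all h ∈ 𝔥}`. -/
def weightSpace (N : D.Mod) (ν : Module.Dual ℂ H) : Submodule ℂ N :=
  ⨅ h : H, Module.End.eigenspace (Algebra.lsmul ℂ ℂ N (Env.ι (D.algH h))) (ν h)

/-- The category `𝒪`. -/
def catO : ObjectProperty D.Mod := fun N =>
  (⨆ ν, D.weightSpace N ν = ⊤) ∧ (∀ ν, FiniteDimensional ℂ (D.weightSpace N ν)) ∧
    ∃ Λ : Finset (Module.Dual ℂ H), ∀ ν, D.weightSpace N ν ≠ ⊥ →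
      ∃ l ∈ Λ, ∃ n : Fin ℓ →₀ ℕ, ν = l - D.weight n

/-- The category `ℳ(a)`: `h = α^∨` acts diagonally with eigenvalues in `a + ℤ`. -/
def catM (i : Fin ℓ) (a : ℂ) : ObjectProperty D.Mod := fun N =>
  ⨆ n : ℤ, Module.End.eigenspace
    (Algebra.lsmul ℂ ℂ N (Env.ι (D.algH (D.evenCoroot i)))) (a + n) = ⊤

/-- The category `𝒪^fin(a)`: the finitely generated modules in `𝒪 ∩ ℳ(a)`. -/
def catOFin (i : Fin ℓ) (a : ℂ) : ObjectProperty D.Mod := fun N =>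
  D.catO N ∧ Module.Finite (Env D.Alg) N ∧ D.catM i a N

/-- The left ideal defining the Verma module with a highest weight vector of weight `μ` and
parity `q`. -/
def vermaIdeal (μ : Module.Dual ℂ H) (q : ZMod 2) : Submodule (Env D.Alg) (Env D.Alg) :=
  Submodule.span (Env D.Alg)
    ({u | ∃ x ∈ D.nPlus, u = Env.ι x} ∪
      {u | ∃ h : H, u = Env.ι (D.algH h) - algebraMap ℂ (Env D.Alg) (μ h)} ∪
      {Env.σ - algebraMap ℂ (Env D.Alg) (sgn q)})

/-- The Verma module `M(μ)`, with highest weight vector of parity `q`. -/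
abbrev verma (μ : Module.Dual ℂ H) (q : ZMod 2) : Type u := Env D.Alg ⧸ D.vermaIdeal μ q

/-- The simple module `L(μ)`, with highest weight vector of parity `q`: the quotient of the Verma
module by its largest proper submodule. -/
def simpleModule (μ : Module.Dual ℂ H) (q : ZMod 2) : D.Mod :=
  ModuleCat.of (Env D.Alg)
    (D.verma μ q ⧸ sSup {P : Submodule (Env D.Alg) (D.verma μ q) | P ≠ ⊤})

/-- The parity of `∑ n_i α_i`. -/
def weightParity (n : Fin ℓ →₀ ℕ) : ZMod 2 := ∑ i, (n i : ZMod 2) * D.p i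

/-- The factor of the Weyl denominator corresponding to `γ = ∑ n_i α_i`, as a power series in the
variables `X_i = e^{-α_i}`: `(1 - e^{-γ})^{dim 𝔤_γ}` for even `γ`, and `(1 + e^{-γ})^{-dim 𝔤_γ}` for
odd `γ`. (It is `1` if `γ` is not a root.) -/
def denomFactor (n : Fin ℓ →₀ ℕ) : MvPowerSeries (Fin ℓ) ℚ :=
  if D.weightParity n = 0 then
    (1 - MvPowerSeries.monomial n 1) ^ Module.finrank ℂ (D.rootSpace (D.weight n))
  else (1 + MvPowerSeries.monomial n 1)⁻¹ ^ Module.finrank ℂ (D.rootSpace (D.weight n))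

/-- The Weyl denominator `R = ∏_γ denomFactor γ` over all positive `γ`, as a power series in the
`e^{-α_i}`. The coefficient at `n` only involves the finitely many factors with `γ ≤ n`. -/
def weylDenom : MvPowerSeries (Fin ℓ) ℚ := fun n =>
  MvPowerSeries.coeff n (∏ m ∈ (Finset.Iic n).erase 0, D.denomFactor m)

/-- The character of `N`, as the function sending `ν` to the coefficient of `e^ν`. -/
def ch (N : D.Mod) (ν : Module.Dual ℂ H) : ℚ := Module.finrank ℂ (D.weightSpace N ν)

/-- The formal sum `R e^ρ ch N`, as the function sending `μ` to the coefficient of `e^μ`; if `N`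
belongs to `𝒪` only finitely many summands are nonzero. -/
def denomCh (ρ : Module.Dual ℂ H) (N : D.Mod) (μ : Module.Dual ℂ H) : ℚ :=
  ∑ᶠ n : Fin ℓ →₀ ℕ, MvPowerSeries.coeff n D.weylDenom * D.ch N (μ - ρ + D.weight n)

/-- The action `r_α(∑ c_ν e^ν) = ∑ c_ν e^{r_α ν}` on formal sums; the coefficient of `e^μ` is
`c_{r_α μ}` as `r_α` is an involution. -/
def reflSum (i : Fin ℓ) (c : Module.Dual ℂ H → ℚ) : Module.Dual ℂ H → ℚ := fun μ => c (D.refl i μ)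

end CartanDatum

end Modules

end KMSuper

end

/-!
Everything takes place in `U = U(𝔤)`, extended by the parity operator, with its triple
`e, f, h` spanning `𝔰𝔩₂(α)`. On `D_a(N)`, identified with `N[f⁻¹]`, the element `u` acts as
`ψ_a(u) = f^{-a} u f^a` (`psi`). This fixes `u` if it commutes with `f`, and it sends `h ↦ h - 2a` and
`e ↦ e + a f⁻¹(h - a + 1)`, so that the twisted action is explicit on generators.

*The equivalence.* Let `N` be a module on which `h` is diagonalizable with eigenvalues in `a + ℤ`,
`a ∉ ℤ`, and on which `e` is locally nilpotent (`IsWeightNilp`). By `𝔰𝔩₂`-theory `f` acts injectively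
on `N`, and every vector of `D_a(N)` is moved into `C_a(N)` by a power of `f`. Hence
`C_a(N)[f⁻¹] = D_a(N)`, the twists by `a` and `-a` cancel, and `C_{-a}(C_a(N))` is the space of
`e`-finite vectors in `N[f⁻¹]`. This space is `N`: in the quotient the operator `f` would be
injective by the same `𝔰𝔩₂`-theory, but every vector is killed by a power of `f`. So `C_{-a} C_a ≅ id`
(`enrightEnrightEquiv`), and submodules of `N` and of `C_a(N)` correspond to each other, which
transports finite generation and simplicity.

*Category `𝒪`.* A vector `v` of weight `μ` killed by `e_i`, with `μ(h) = a + n`, yields a vector of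
weight `r_α μ - α_i = r_α . μ` in `C_a(N)` which is killed by `e_i`: it is `f^{a + n + 1} v` for even
`α_i` and `f^{a + n} f_i v` for odd `α_i` (`singMap`). If `v` is singular then so is its image, since
`𝔫⁺` is generated by the `e_j`. This identifies `C_a(L(λ))`, which is simple, with `L(r_α . λ)`, and
bounds the weights of `C_a` of a module generated by a highest weight vector. As `C_a` is exact, a
finitely generated module in `𝒪` is treated by induction along a filtration with such subquotients
(`catOFin_enright`).

*Characters.* The operator `e_i` maps `N_ν` onto `N_{ν + α_i}`, because `e f` is injective on the
finite-dimensional weight spaces. So `(1 - e^{-α_i}) ch N`, up to a shift, counts the vectors killed by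
`e_i` (`finrank_kerSpace`), and `singMap` with its inverse for `-a` shows that these numbers for `N`
and `C_a(N)` are exchanged by the dot action of `r_α` (`finrank_kerSpace_enright`). On the other hand
`R = (1 - e^{-α_i}) R'`, where `R'` is the product over the positive roots which are not multiples of
`α_i` (`coeff_weylDenom`). These are permuted by `r_α`, with their parities and multiplicities, so
`R'` is invariant under `r_α` (`transDenom_refl`). Multiplying the two facts gives the formula.
-/

noncomputable section

namespace KMSuper

/-! ### Modules over `𝔰𝔩₂` with non-integral weights -/

/-- `e`, `f`, `h` satisfy the relations of the standard basis of `𝔰𝔩₂` in an associative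
algebra. -/
structure IsSl2 {U : Type*} [Ring U] (e f h : U) : Prop where
  ef : e * f - f * e = h
  he : h * e - e * h = 2 * e
  hf : h * f - f * h = -(2 * f)

lemma IsSl2.symm {U : Type*} [Ring U] {e f h : U} (S : IsSl2 e f h) : IsSl2 f e (-h) where
  ef := by rw [← S.ef, neg_sub]
  he := by rw [neg_mul, mul_neg, sub_neg_eq_add, neg_add_eq_sub, ← neg_sub, S.hf, neg_neg]
  hf := by rw [neg_mul, mul_neg, sub_neg_eq_add, neg_add_eq_sub, ← neg_sub, S.he]

section Vectors

variable {U : Type*} [Ring U] [Algebra ℂ U] {e f h : U} {N : Type*} [AddCommGroup N] [Module U N]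
  [Module ℂ N] [IsScalarTower ℂ U N]

lemma IsSl2.h_smul_e (S : IsSl2 e f h) {c : ℂ} {v : N} (hv : h • v = c • v) :
    h • e • v = (c + 2) • e • v := by
  have := congrArg (· • v) S.he
  simp only [sub_smul, mul_smul, hv, smul_comm e c] at this
  rw [sub_eq_iff_eq_add.mp this, add_smul, add_comm, ofNat_smul_eq_nsmul ℂ, ofNat_smul_eq_nsmul U]

lemma IsSl2.h_smul_f (S : IsSl2 e f h) {c : ℂ} {v : N} (hv : h • v = c • v) :
    h • f • v = (c - 2) • f • v := by
  have := S.symm.h_smul_e (c := -c) (v := v) (by rw [neg_smul, hv, neg_smul])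
  rw [neg_smul, neg_eq_iff_eq_neg] at this
  rw [this, ← neg_smul]
  congr 1
  ring

lemma IsSl2.h_smul_e_pow (S : IsSl2 e f h) {c : ℂ} {v : N} (hv : h • v = c • v) (n : ℕ) :
    h • e ^ n • v = (c + 2 * n) • e ^ n • v := by
  induction n with
  | zero => simpa using hv
  | succ n ih =>
    rw [pow_succ', mul_smul, S.h_smul_e ih]
    push_cast
    congr 1
    ring

lemma IsSl2.h_smul_f_pow (S : IsSl2 e f h) {c : ℂ} {v : N} (hv : h • v = c • v) (n : ℕ) :
    h • f ^ n • v = (c - 2 * n) • f ^ n • v := by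
  induction n with
  | zero => simpa using hv
  | succ n ih =>
    rw [pow_succ', mul_smul, S.h_smul_f ih]
    push_cast
    congr 1
    ring

omit [Algebra ℂ U] [IsScalarTower ℂ U N] in
lemma IsSl2.e_smul_f (S : IsSl2 e f h) {c : ℂ} {v : N} (hv : h • v = c • v) :
    e • f • v = f • e • v + c • v := by
  have := congrArg (· • v) S.ef
  simp only [sub_smul, mul_smul, hv] at this
  rw [sub_eq_iff_eq_add.mp this, add_comm]

lemma IsSl2.e_smul_f_pow (S : IsSl2 e f h) {c : ℂ} {v : N} (hv : h • v = c • v) (n : ℕ) :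
    e • f ^ (n + 1) • v = f ^ (n + 1) • e • v + ((n + 1 : ℂ) * (c - n)) • f ^ n • v := by
  induction n with
  | zero => simpa using S.e_smul_f hv
  | succ n ih =>
    have h1 : f • f ^ n • v = f ^ (n + 1) • v := by rw [pow_succ' f n, mul_smul]
    have h2 : f • f ^ (n + 1) • e • v = f ^ (n + 1 + 1) • e • v := by
      rw [pow_succ' f (n + 1), mul_smul]
    rw [pow_succ' f (n + 1), mul_smul f _ v, S.e_smul_f (S.h_smul_f_pow hv (n + 1)), ih, smul_add,
      smul_comm f ((n + 1 : ℂ) * (c - n)), h1, h2, ← pow_succ', add_assoc, ← add_smul]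
    congr 2
    push_cast
    ring

lemma IsSl2.f_smul_e_pow (S : IsSl2 e f h) {c : ℂ} {v : N} (hv : h • v = c • v) (n : ℕ) :
    f • e ^ (n + 1) • v = e ^ (n + 1) • f • v + ((n + 1 : ℂ) * (-c - n)) • e ^ n • v :=
  S.symm.e_smul_f_pow (by rw [neg_smul, hv, neg_smul]) n

/-- A vector with `f v = 0` of non-integral weight vanishes, if `e` is nilpotent on it: by
`f e ^ (n + 1) v = (n + 1) (-c - n) e ^ n v` the order of nilpotency can be lowered. -/
lemma IsSl2.eq_zero_of_f_smul (S : IsSl2 e f h) {c : ℂ} (hc : ∀ n : ℤ, c ≠ n) {v : N}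
    (hv : h • v = c • v) (hf : f • v = 0) (n : ℕ) (hn : e ^ n • v = 0) : v = 0 := by
  induction n with
  | zero => simpa using hn
  | succ n ih =>
    refine ih ?_
    have h1 := S.f_smul_e_pow hv n
    rw [hn, hf, smul_zero, smul_zero, zero_add] at h1
    refine (smul_eq_zero.mp h1.symm).resolve_left (mul_ne_zero (by exact_mod_cast n.succ_ne_zero) ?_)
    intro h2
    refine hc (-n) ?_
    push_cast
    linear_combination -h2

/-- A vector with `e f v = 0` of non-integral weight vanishes, if `e` is nilpotent on it. -/
lemma IsSl2.eq_zero_of_e_smul_f_smul (S : IsSl2 e f h) {c : ℂ} (hc : ∀ n : ℤ, c ≠ n) {v : N}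
    (hv : h • v = c • v) (hf : e • f • v = 0) (n : ℕ) (hn : e ^ n • v = 0) : v = 0 := by
  induction n with
  | zero => simpa using hn
  | succ n ih =>
    refine ih ?_
    have h1 := S.f_smul_e_pow hv n
    rw [hn, pow_succ, mul_smul, hf, smul_zero, smul_zero, zero_add] at h1
    refine (smul_eq_zero.mp h1.symm).resolve_left (mul_ne_zero (by exact_mod_cast n.succ_ne_zero) ?_)
    intro h2
    refine hc (-n) ?_
    push_cast
    linear_combination -h2

/-- In non-integral weights `f ^ n v ≠ 0` can be moved back to a multiple of `v` by `e ^ n`, if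
`e v = 0`. -/
lemma IsSl2.e_pow_smul_f_pow (S : IsSl2 e f h) {c : ℂ} (hc : ∀ n : ℤ, c ≠ n) {v : N}
    (hv : h • v = c • v) (he : e • v = 0) (n : ℕ) :
    ∃ b : ℂ, b ≠ 0 ∧ e ^ n • f ^ n • v = b • v := by
  induction n with
  | zero => exact ⟨1, one_ne_zero, by simp⟩
  | succ n ih =>
    obtain ⟨b, hb, h1⟩ := ih
    refine ⟨((n + 1 : ℂ) * (c - n)) * b, mul_ne_zero (mul_ne_zero
      (by exact_mod_cast n.succ_ne_zero) ?_) hb, ?_⟩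
    · intro h2
      exact hc n (by push_cast; linear_combination h2)
    · rw [pow_succ e, mul_smul, S.e_smul_f_pow hv, he, smul_zero, zero_add, smul_comm (e ^ n), h1,
        smul_smul]

/-- If `e` is locally nilpotent, then `f ^ k` is injective on the vectors of weight `k ≥ 0`. -/
lemma IsSl2.eq_zero_of_f_pow_smul (S : IsSl2 e f h) (n : ℕ) : ∀ (k : ℕ) (v : N),
    h • v = (k : ℂ) • v → e ^ n • v = 0 → f ^ k • v = 0 → v = 0 := by
  induction n with
  | zero => intro k v _ h2 _; simpa using h2
  | succ n ih =>
    intro k v hv hn hf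
    have he : e • v = 0 := by
      refine ih (k + 2) (e • v) (by rw [S.h_smul_e hv]; push_cast; rfl)
        (by rwa [← mul_smul, ← pow_succ]) ?_
      have h1 := S.e_smul_f_pow hv (k + 1)
      have h2 : f ^ (k + 1) • v = 0 := by rw [pow_succ', mul_smul, hf, smul_zero]
      rw [h2, smul_zero, add_zero, pow_succ' f (k + 1), mul_smul f, h2, smul_zero, smul_zero] at h1
      rw [pow_succ' f (k + 1), mul_smul]
      rw [mul_smul] at h1
      exact h1.symm
    have key : ∀ j : ℕ, j ≤ k → f ^ j • v = 0 → v = 0 := by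
      intro j
      induction j with
      | zero => intro _ h; simpa using h
      | succ j ih2 =>
        intro hj h1
        refine ih2 (by omega) ?_
        have h2 := S.e_smul_f_pow hv j
        rw [h1, he, smul_zero, smul_zero, zero_add] at h2
        refine (smul_eq_zero.mp h2.symm).resolve_left (mul_ne_zero
          (by exact_mod_cast j.succ_ne_zero) (sub_ne_zero.mpr ?_))
        exact_mod_cast (by omega : k ≠ j)
    exact key k le_rfl hf

end Vectors

lemma eq_zero_of_sum_eq_zero_of_iSupIndep {R V ι : Type*} [Ring R] [AddCommGroup V] [Module R V]
    {W : ι → Submodule R V} (hW : iSupIndep W) (s : Finset ι) (w : ι → V)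
    (hw : ∀ i ∈ s, w i ∈ W i) (hs : ∑ i ∈ s, w i = 0) : ∀ i ∈ s, w i = 0 := by
  classical
  intro i hi
  refine Submodule.disjoint_def.mp (hW i) _ (hw i hi) ?_
  rw [← Finset.add_sum_erase _ _ hi] at hs
  rw [eq_neg_of_add_eq_zero_left hs]
  refine Submodule.neg_mem _ (Submodule.sum_mem _ fun j hj => ?_)
  exact Submodule.mem_iSup_of_mem j (Submodule.mem_iSup_of_mem (Finset.ne_of_mem_erase hj)
    (hw j (Finset.mem_of_mem_erase hj)))

/-- Components of a vector of a subspace `P` with respect to subspaces whose images modulo `P` are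
independent lie in `P`. -/
lemma mem_of_sum_mem {R V ι : Type*} [Ring R] [AddCommGroup V] [Module R V] (P : Submodule R V)
    (W' : ι → Submodule R (V ⧸ P)) (hind : iSupIndep W') (s : Finset ι) (w : ι → V)
    (hw : ∀ i ∈ s, P.mkQ (w i) ∈ W' i) (hs : ∑ i ∈ s, w i ∈ P) : ∀ i ∈ s, w i ∈ P := by
  intro i hi
  refine (Submodule.Quotient.mk_eq_zero P).mp (eq_zero_of_sum_eq_zero_of_iSupIndep hind s
    (fun i => P.mkQ (w i)) hw ?_ i hi)
  rw [← map_sum]; exact (Submodule.Quotient.mk_eq_zero P).mpr hs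

/-- The element `h` acts diagonally on `N` with eigenvalues in `a + ℤ`, and `e` acts locally
nilpotently. Scalars act through `algebraMap`, so that no separate `ℂ`-module structure is needed. -/
structure IsWeightNilp {U : Type*} [Ring U] [Algebra ℂ U] (e h : U) (a : ℂ) (N : Type*)
    [AddCommGroup N] [Module U N] : Prop where
  diag : ∀ v : N, ∃ (s : Finset ℤ) (w : ℤ → N),
    (∀ n ∈ s, h • w n = algebraMap ℂ U (a + n) • w n) ∧ v = ∑ n ∈ s, w n
  nilp : ∀ v : N, ∃ k : ℕ, e ^ k • v = 0

section WeightNilp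

variable {U : Type*} [Ring U] [Algebra ℂ U] {e f h : U} {a : ℂ} {N : Type*} [AddCommGroup N]
  [Module U N]

/-- The `h`-components of a vector of a subgroup stable under `h` and under scalars belong to the
subgroup. -/
lemma comp_mem_of_sum_mem (P : AddSubgroup N) (hP : ∀ v ∈ P, h • v ∈ P)
    (hc : ∀ (c : ℂ), ∀ v ∈ P, algebraMap ℂ U c • v ∈ P) (s : Finset ℤ) (w : ℤ → N)
    (hw : ∀ n ∈ s, h • w n = algebraMap ℂ U (a + n) • w n) (hs : ∑ n ∈ s, w n ∈ P) :
    ∀ n ∈ s, w n ∈ P := by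
  let _ : Module ℂ N := Module.compHom N (algebraMap ℂ U)
  have _ : IsScalarTower ℂ U N := ⟨fun c u v => by
    rw [Algebra.smul_def, mul_smul]; rfl⟩
  let P' : Submodule ℂ N := { P with smul_mem' := hc }
  let T : Module.End ℂ (N ⧸ P') := P'.mapQ P' (Algebra.lsmul ℂ ℂ N h) hP
  have hinj : Function.Injective fun n : ℤ => a + (n : ℂ) := fun m n hmn => by
    simpa using hmn
  refine mem_of_sum_mem P' (fun n : ℤ => Module.End.eigenspace T (a + n))
    ((Module.End.eigenspaces_iSupIndep T).comp hinj) s w (fun n hn => ?_) hs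
  rw [Module.End.mem_eigenspace_iff, ← map_smul]
  exact congrArg P'.mkQ (hw n hn)

lemma IsWeightNilp.submodule (hN : IsWeightNilp e h a N) (P : Submodule U N) :
    IsWeightNilp e h a P where
  diag v := by
    classical
    obtain ⟨s, w, hw, hs⟩ := hN.diag v
    have hmem : ∀ n ∈ s, w n ∈ P := comp_mem_of_sum_mem P.toAddSubgroup
      (fun v hv => P.smul_mem _ hv) (fun c v hv => P.smul_mem _ hv) s w hw (hs ▸ v.2)
    refine ⟨s, fun n => if hn : n ∈ s then ⟨w n, hmem n hn⟩ else 0, fun n hn => ?_, ?_⟩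
    · simp only [hn, dif_pos]
      exact Subtype.ext (hw n hn)
    · ext
      rw [hs, AddSubmonoidClass.coe_finsetSum]
      exact Finset.sum_congr rfl fun n hn => by simp [hn]
  nilp v := by
    obtain ⟨k, hk⟩ := hN.nilp v
    exact ⟨k, Subtype.ext hk⟩

lemma IsWeightNilp.of_surjective {N' : Type*} [AddCommGroup N'] [Module U N']
    (hN : IsWeightNilp e h a N) (g : N →ₗ[U] N') (hg : Function.Surjective g) :
    IsWeightNilp e h a N' where
  diag v := by
    obtain ⟨v, rfl⟩ := hg v
    obtain ⟨s, w, hw, hs⟩ := hN.diag v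
    exact ⟨s, fun n => g (w n), fun n hn => by rw [← map_smul, hw n hn, map_smul],
      by rw [hs, map_sum]⟩
  nilp v := by
    obtain ⟨v, rfl⟩ := hg v
    obtain ⟨k, hk⟩ := hN.nilp v
    exact ⟨k, by rw [← map_smul, hk, map_zero]⟩

lemma IsWeightNilp.quotient (hN : IsWeightNilp e h a N) (P : Submodule U N) :
    IsWeightNilp e h a (N ⧸ P) :=
  hN.of_surjective P.mkQ P.mkQ_surjective

/-- In non-integral weights `f` acts injectively. -/
lemma IsWeightNilp.eq_zero_of_f_smul (S : IsSl2 e f h) (ha : ∀ n : ℤ, a ≠ n)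
    (hN : IsWeightNilp e h a N) {v : N} (hv : f • v = 0) : v = 0 := by
  let _ : Module ℂ N := Module.compHom N (algebraMap ℂ U)
  have _ : IsScalarTower ℂ U N := ⟨fun c u v => by
    rw [Algebra.smul_def, mul_smul]; rfl⟩
  obtain ⟨s, w, hw, hs⟩ := hN.diag v
  have key := comp_mem_of_sum_mem (h := h) (a := a)
    (LinearMap.ker (Algebra.lsmul ℂ ℂ N f)).toAddSubgroup (fun v hv => ?_) (fun c v hv => ?_) s w hw
    (by rw [← hs]; exact hv)
  · rw [hs]
    refine Finset.sum_eq_zero fun n hn => ?_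
    obtain ⟨k, hk⟩ := hN.nilp (w n)
    refine S.eq_zero_of_f_smul (c := a + n) (fun m hm => ha (m - n) ?_) (hw n hn) (key n hn) k hk
    push_cast
    linear_combination hm
  · have hv' : f • v = 0 := hv
    change f • h • v = 0
    have h1 : f * h = h * f + 2 * f := by
      have := S.hf
      rw [sub_eq_iff_eq_add] at this
      rw [this]; abel
    rw [smul_smul, h1, add_smul, mul_smul, mul_smul, hv', smul_zero, smul_zero, add_zero]
  · exact (LinearMap.ker (Algebra.lsmul ℂ ℂ N f)).smul_mem c hv

lemma IsWeightNilp.eq_zero_of_f_pow_smul (S : IsSl2 e f h) (ha : ∀ n : ℤ, a ≠ n)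
    (hN : IsWeightNilp e h a N) {v : N} (k : ℕ) (hv : f ^ k • v = 0) : v = 0 := by
  induction k with
  | zero => simpa using hv
  | succ k ih =>
    rw [pow_succ', mul_smul] at hv
    exact ih (hN.eq_zero_of_f_smul S ha hv)

/-- A submodule which contains `f ^ k v` contains `v`. -/
lemma IsWeightNilp.mem_of_f_pow_smul_mem (S : IsSl2 e f h) (ha : ∀ n : ℤ, a ≠ n)
    (hN : IsWeightNilp e h a N) (P : Submodule U N) {v : N} (k : ℕ) (hv : f ^ k • v ∈ P) :
    v ∈ P :=
  (Submodule.Quotient.mk_eq_zero P).mp ((hN.quotient P).eq_zero_of_f_pow_smul S ha k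
    (by rw [← Submodule.Quotient.mk_smul]; exact (Submodule.Quotient.mk_eq_zero P).mpr hv))

end WeightNilp


/-! ### The automorphisms `φ_a` -/

section Phi

variable {U : Type u} [Ring U] [Algebra ℂ U] {f g : U}

lemma phiFun_of_adOp_eq_zero (a : ℂ) {u : U} (hu : adOp f u = 0) : phiFun f g a u = u := by
  rw [phiFun_eq_sum f g a u 1 (by simpa using hu)]; simp

lemma phiFun_of_adOp_sq_eq_zero (a : ℂ) {u : U} (hu : adOp f (adOp f u) = 0) :
    phiFun f g a u = u + a • (adOp f u * g) := by
  rw [phiFun_eq_sum f g a u 2 (by simpa [pow_two] using hu), Finset.sum_range_succ]; simp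

lemma choose_two (a : ℂ) : Ring.choose a 2 = a * (a - 1) / 2 := by
  rw [← choosePoly_eval, choosePoly]
  simp [descPochhammer_succ_right]
  ring

lemma phiFun_of_adOp_cube_eq_zero (a : ℂ) {u : U} (hu : adOp f (adOp f (adOp f u)) = 0) :
    phiFun f g a u = u + a • (adOp f u * g) + (a * (a - 1) / 2) • (adOp f (adOp f u) * g ^ 2) := by
  rw [phiFun_eq_sum f g a u 3 (by simpa [pow_succ] using hu), Finset.sum_range_succ,
    Finset.sum_range_succ, choose_two]
  simp [pow_two]

lemma phiFun_smul [AdLocNilp f] (a c : ℂ) (u : U) : phiFun f g a (c • u) = c • phiFun f g a u := by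
  obtain ⟨n, hn⟩ := AdLocNilp.out (f := f) u
  rw [phiFun_eq_sum f g a u n hn, phiFun_eq_sum f g a (c • u) n (by rw [map_smul, hn, smul_zero]),
    Finset.smul_sum]
  refine Finset.sum_congr rfl fun i _ => ?_
  rw [map_smul, smul_mul_assoc, smul_comm]

variable [AdLocNilp f] (hfg : f * g = 1) (hgf : g * f = 1)

omit [AdLocNilp f] in
include hfg hgf in
lemma phiFun_inv (a : ℂ) : phiFun f g a g = g :=
  phiFun_of_adOp_eq_zero a (by rw [adOp_apply, hfg, hgf, sub_self])

include hfg hgf in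
/-- The one-parameter group law `φ_a ∘ φ_b = φ_{a+b}`: Vandermonde's identity. -/
lemma phiFun_phiFun (a b : ℂ) (u : U) :
    phiFun f g a (phiFun f g b u) = phiFun f g (a + b) u := by
  obtain ⟨K, hK⟩ := AdLocNilp.out (f := f) u
  have h1 : ∀ i ∈ Finset.range K, phiFun f g a (Ring.choose b i • ((adOp f ^ i) u * g ^ i)) =
      ∑ j ∈ Finset.range (K - i), (Ring.choose b i * Ring.choose a j) •
        ((adOp f ^ (i + j)) u * g ^ (i + j)) := by
    intro i hi
    have h2 : phiFun f g a (g ^ i) = g ^ i := by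
      have := map_pow (phi f g hfg hgf a) g i
      rwa [show phi f g hfg hgf a g = g from phiFun_inv hfg hgf a] at this
    rw [phiFun_smul, phiFun_mul f g hfg hgf, h2, phiFun_eq_sum f g a _ (K - i) (by
      rw [← Module.End.mul_apply, ← pow_add, Nat.sub_add_cancel (Finset.mem_range.mp hi).le, hK]),
      Finset.sum_mul, Finset.smul_sum]
    refine Finset.sum_congr rfl fun j _ => ?_
    rw [smul_mul_assoc, smul_smul, mul_assoc, ← pow_add, ← Module.End.mul_apply, ← pow_add,
      add_comm j i]
  have h3 : phiFun f g a (phiFun f g b u) = ∑ i ∈ Finset.range K,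
      phiFun f g a (Ring.choose b i • ((adOp f ^ i) u * g ^ i)) := by
    rw [phiFun_eq_sum f g b u K hK]
    exact map_sum (phi f g hfg hgf a) _ _
  rw [h3, Finset.sum_congr rfl h1, phiFun_eq_sum f g _ u K hK,
    ← Finset.sum_range_diag_flip K fun i j => (Ring.choose b i * Ring.choose a j) •
        ((adOp f ^ (i + j)) u * g ^ (i + j))]
  refine Finset.sum_congr rfl fun n _ => ?_
  rw [add_comm a b, Ring.add_choose_eq n (Commute.all b a),
    Finset.Nat.sum_antidiagonal_eq_sum_range_succ (fun i j => Ring.choose b i * Ring.choose a j),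
    Finset.sum_smul]
  refine Finset.sum_congr rfl fun i hi => ?_
  rw [Nat.add_sub_cancel' (Nat.lt_succ_iff.mp (Finset.mem_range.mp hi))]

lemma phiFun_zero (u : U) : phiFun f g 0 u = u := by
  obtain ⟨K, hK⟩ := AdLocNilp.out (f := f) u
  rw [phiFun_eq_sum f g 0 u (K + 1) (adOp_pow_zero_of_le hK (by omega)), Finset.sum_range_succ']
  simp

/-- For integers `k` the automorphism `φ_k` is the conjugation by `f ^ k`. -/
lemma phiFun_intCast (F : Uˣ) [AdLocNilp (F : U)] (k : ℤ) (u : U) :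
    phiFun (F : U) ((F⁻¹ : Uˣ) : U) (k : ℂ) u = ((F ^ k : Uˣ) : U) * u * ((F ^ (-k) : Uˣ) : U) := by
  have hnat : ∀ (s : ℕ) (u : U), phiFun (F : U) ((F⁻¹ : Uˣ) : U) (s : ℂ) u =
      ((F ^ s : Uˣ) : U) * u * (((F ^ s)⁻¹ : Uˣ) : U) := fun s u => by
    obtain ⟨K, hK⟩ := AdLocNilp.out (f := (F : U)) u
    rw [phiFun_natCast _ _ F.mul_inv F.inv_mul s u K hK, ← inv_pow]
    simp
  obtain ⟨s, rfl | rfl⟩ := k.eq_nat_or_neg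
  · have := hnat s u
    simpa using this
  · have h1 := hnat s (phiFun (F : U) ((F⁻¹ : Uˣ) : U) (-s : ℂ) u)
    rw [phiFun_phiFun F.mul_inv F.inv_mul, add_neg_cancel, phiFun_zero] at h1
    rw [neg_neg, zpow_neg, zpow_natCast, Int.cast_neg, Int.cast_natCast]
    conv_rhs => rw [h1]
    rw [mul_assoc, mul_assoc, mul_assoc, Units.inv_mul, mul_one, ← mul_assoc, Units.inv_mul,
      one_mul]

end Phi

/-! ### Localizations of modules -/

section Localization

variable {U : Type u} [Ring U] [Algebra ℂ U] (f : U) [AdLocNilp f]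

/-- The image of `f` in `U[f⁻¹]`, as a unit. -/
def Loc.unit : (Loc f)ˣ := ⟨Loc.num f, Loc.inv f, Loc.num_mul_inv f, Loc.inv_mul_num f⟩

/-- The action map of the twisted localization `D_a`: the element `u` acts on `f^a ⊗ v` as
`f^a ⊗ ψ_a(u) v`. -/
def psi (a : ℂ) : U →+* Loc f :=
  (phi (Loc.num f) (Loc.inv f) (Loc.num_mul_inv f) (Loc.inv_mul_num f) (-a)).comp (Loc.of f)

variable {f}

lemma psi_apply (a : ℂ) (u : U) :
    psi f a u = phiFun (Loc.num f) (Loc.inv f) (-a) (Loc.of f u) := rfl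

lemma Loc.adOp_num (u : U) : adOp (Loc.num f) (Loc.of f u) = Loc.of f (adOp f u) := by
  simpa using Loc.adOp_of f u 1

lemma psi_of_adOp_eq_zero (a : ℂ) {u : U} (hu : adOp f u = 0) : psi f a u = Loc.of f u := by
  rw [psi_apply, phiFun_of_adOp_eq_zero]
  rw [Loc.adOp_num, hu, map_zero]

lemma psi_of_adOp_sq_eq_zero (a : ℂ) {u : U} (hu : adOp f (adOp f u) = 0) :
    psi f a u = Loc.of f u - a • (Loc.of f (adOp f u) * Loc.inv f) := by
  rw [psi_apply, phiFun_of_adOp_sq_eq_zero, Loc.adOp_num, neg_smul, sub_eq_add_neg]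
  rw [Loc.adOp_num, Loc.adOp_num, hu, map_zero]

lemma psi_self (a : ℂ) : psi f a f = Loc.num f :=
  psi_of_adOp_eq_zero a (by rw [adOp_apply, sub_self])

lemma psi_algebraMap (a c : ℂ) : psi f a (algebraMap ℂ U c) = algebraMap ℂ (Loc f) c :=
  psi_of_adOp_eq_zero a (by rw [adOp_apply, Algebra.commutes, sub_self])

/-- `f ^ k` intertwines the twists by `a` and by `a + k`. -/
lemma psi_mul_zpow (a : ℂ) (k : ℤ) (u : U) :
    psi f a u * ((Loc.unit f ^ k : (Loc f)ˣ) : Loc f) =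
      ((Loc.unit f ^ k : (Loc f)ˣ) : Loc f) * psi f (a + k) u := by
  have : AdLocNilp ((Loc.unit f : (Loc f)ˣ) : Loc f) := Loc.adLocNilp f
  have h1 := phiFun_intCast (Loc.unit f) k (psi f (a + k) u)
  have h2 := phiFun_phiFun (f := Loc.num f) (g := Loc.inv f) (Loc.num_mul_inv f)
    (Loc.inv_mul_num f) k (-(a + k)) (Loc.of f u)
  rw [show (k : ℂ) + -(a + k) = -a by ring] at h2
  have h3 := h2.symm.trans h1
  rw [psi_apply, h3, mul_assoc, ← Units.val_mul, ← zpow_add]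
  simp

lemma psi_zero (u : U) : psi f 0 u = Loc.of f u := by
  rw [psi_apply, neg_zero, phiFun_zero]

lemma psi_h {e h : U} (S : IsSl2 e f h) (a : ℂ) :
    psi f a h = Loc.of f h - algebraMap ℂ (Loc f) (2 * a) := by
  have h1 : adOp f h = 2 * f := by rw [adOp_apply, ← neg_sub, S.hf, neg_neg]
  rw [psi_of_adOp_sq_eq_zero a (by
    rw [h1, adOp_apply, two_mul, mul_add, add_mul, sub_self]), h1, map_mul]
  rw [mul_assoc, show Loc.of f f * Loc.inv f = 1 from Loc.num_mul_inv f, mul_one, map_ofNat,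
    Algebra.algebraMap_eq_smul_one, mul_comm 2 a, mul_smul]
  congr 2
  rw [ofNat_smul_eq_nsmul ℂ, nsmul_one, Nat.cast_ofNat]

lemma num_mul_psi_e {e h : U} (S : IsSl2 e f h) (a : ℂ) :
    Loc.num f * psi f a e = Loc.of f (f * e) + a • (Loc.of f h - algebraMap ℂ (Loc f) (a - 1)) := by
  have h1 : adOp f e = -h := by rw [adOp_apply, ← S.ef, neg_sub]
  have h2 : adOp f (-h) = -(2 * f) := by
    rw [adOp_apply, ← S.hf]; noncomm_ring
  have h3 : adOp f (-(2 * f)) = 0 := by rw [adOp_apply]; noncomm_ring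
  rw [psi_apply, phiFun_of_adOp_cube_eq_zero _ (by
    rw [Loc.adOp_num, Loc.adOp_num, Loc.adOp_num, h1, h2, h3, map_zero]), Loc.adOp_num,
    Loc.adOp_num, h1, h2]
  have hfh : f * h = h * f + 2 * f := by
    have := S.hf
    rw [sub_eq_iff_eq_add] at this
    rw [this]; abel
  have h4 : Loc.num f * (Loc.of f (-h) * Loc.inv f) = -(Loc.of f h + 2) := by
    have h5 : Loc.num f * Loc.of f h = (Loc.of f h + 2) * Loc.num f := by
      rw [Loc.num, ← map_mul, hfh, add_mul, map_add, map_mul, map_mul, map_ofNat]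
    rw [map_neg, neg_mul, mul_neg, ← mul_assoc, h5, mul_assoc, Loc.num_mul_inv, mul_one]
  have h6 : Loc.num f * (Loc.of f (-(2 * f)) * Loc.inv f ^ 2) = -2 := by
    rw [map_neg, map_mul, map_ofNat, pow_two, neg_mul, mul_assoc, ← mul_assoc (Loc.of f f),
      show Loc.of f f * Loc.inv f = 1 from Loc.num_mul_inv f, one_mul, mul_neg, two_mul, mul_add,
      Loc.num_mul_inv]
    norm_num
  rw [mul_add, mul_add, mul_smul_comm, mul_smul_comm, h4, h6, map_mul, Algebra.algebraMap_eq_smul_one]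
  have h7 : (2 : Loc f) = (2 : ℂ) • 1 := by
    rw [ofNat_smul_eq_nsmul ℂ, nsmul_one, Nat.cast_ofNat]
  rw [h7]
  change Loc.of f f * Loc.of f e + _ + _ = _
  generalize Loc.of f f * Loc.of f e = x
  generalize Loc.of f h = y
  generalize (1 : Loc f) = z
  module

variable (N : ModuleCat.{u} U)

/-- The canonical map `N → N[f⁻¹]`. -/
def toLoc : N →+ (locFunctor f).obj N where
  toFun v := (v /ₒ 1 : OreLocalization (Submonoid.powers f) N)
  map_zero' := OreLocalization.zero_oreDiv 1
  map_add' _ _ := OreLocalization.add_oreDiv.symm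

variable {N}

lemma of_smul_toLoc (u : U) (v : N) : Loc.of f u • toLoc (f := f) N v = toLoc N (u • v) :=
  OreLocalization.smul_div_one

lemma exists_num_pow_smul (x : (locFunctor f).obj N) :
    ∃ (k : ℕ) (v : N), Loc.num f ^ k • x = toLoc N v := by
  induction x using OreLocalization.ind with
  | _ r s =>
    obtain ⟨_, k, rfl⟩ := s
    refine ⟨k, r, ?_⟩
    rw [Loc.num, ← map_pow]
    exact OreLocalization.smul_cancel (s := (⟨f ^ k, k, rfl⟩ : Submonoid.powers f)) (t := 1)

lemma exists_pow_smul_eq_zero {v : N} (hv : toLoc (f := f) N v = 0) : ∃ k : ℕ, f ^ k • v = 0 := by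
  have h0 : (v /ₒ (1 : Submonoid.powers f)) = (0 : N) /ₒ 1 :=
    hv.trans (OreLocalization.zero_oreDiv 1).symm
  obtain ⟨⟨_, k, rfl⟩, w, h1, h2⟩ := OreLocalization.oreDiv_eq_iff.mp h0
  refine ⟨k, ?_⟩
  simp only [OneMemClass.coe_one, mul_one] at h2
  rw [smul_zero] at h1
  rw [h2, ← h1]

lemma locFunctor_map_toLoc {N' : ModuleCat.{u} U} (g : N ⟶ N') (v : N) :
    ((locFunctor f).map g).hom (toLoc N v) = toLoc N' (g.hom v) :=
  OreLocalization.liftExpand_of (S := Submonoid.powers f)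
    (P := fun n s => OreLocalization.oreDiv (g.hom n) s)
    (hP := fun r t s hst => by simpa using OreLocalization.expand (g.hom r) s t hst) v 1

lemma twistedLoc_smul (a : ℂ) (u : U) (x : (twistedLoc f a).obj N) :
    u • x = (show (twistedLoc f a).obj N from
      (psi f a u • (show (locFunctor f).obj N from x) : (locFunctor f).obj N)) := rfl

end Localization


/-! ### The Enright functor on modules with non-integral weights -/

open scoped ModuleCat

section Enright

variable {U : Type u} [Ring U] [Algebra ℂ U] {e f h : U}

lemma exists_sum_of_mem_closure {a : ℂ} {N : Type*} [AddCommGroup N] [Module U N] {v : N}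
    (hv : v ∈ AddSubmonoid.closure {w : N | ∃ n : ℤ, h • w = algebraMap ℂ U (a + n) • w}) :
    ∃ (s : Finset ℤ) (w : ℤ → N),
      (∀ n ∈ s, h • w n = algebraMap ℂ U (a + n) • w n) ∧ v = ∑ n ∈ s, w n := by
  classical
  induction hv using AddSubmonoid.closure_induction with
  | mem x hx =>
    obtain ⟨n, hn⟩ := hx
    exact ⟨{n}, fun _ => x, fun m hm => by rw [Finset.mem_singleton.mp hm]; exact hn, by simp⟩
  | zero => exact ⟨∅, 0, by simp, by simp⟩
  | add x y _ _ hx hy =>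
    obtain ⟨s, w, hw, rfl⟩ := hx
    obtain ⟨s', w', hw', rfl⟩ := hy
    refine ⟨s ∪ s', fun n => (if n ∈ s then w n else 0) + if n ∈ s' then w' n else 0,
      fun n _ => ?_, ?_⟩
    · have h1 : h • (if n ∈ s then w n else 0) =
          algebraMap ℂ U (a + n) • (if n ∈ s then w n else 0) := by
        split_ifs with h
        · exact hw n h
        · simp
      have h2 : h • (if n ∈ s' then w' n else 0) =
          algebraMap ℂ U (a + n) • (if n ∈ s' then w' n else 0) := by
        split_ifs with h
        · exact hw' n h
        · simp
      rw [smul_add, smul_add, h1, h2]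
    · rw [Finset.sum_add_distrib, Finset.sum_ite_mem, Finset.sum_ite_mem,
        Finset.union_inter_cancel_left, Finset.union_inter_cancel_right]

lemma isEFinite_of_pow_smul_eq_zero {N : ModuleCat.{u} U} {v : N} (k : ℕ) (hk : e ^ k • v = 0) :
    IsEFinite e v := by
  have hfin := FiniteDimensional.span_of_finite ℂ
    ((Set.finite_Iio k).image fun j => e ^ j • v)
  refine Submodule.finiteDimensional_of_le
    (S₂ := Submodule.span ℂ ((fun j => e ^ j • v) '' Set.Iio k)) (Submodule.span_le.mpr ?_)
  rintro _ ⟨j, rfl⟩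
  rcases lt_or_ge j k with hj | hj
  · exact Submodule.subset_span ⟨j, hj, rfl⟩
  · obtain ⟨m, rfl⟩ := Nat.exists_eq_add_of_le hj
    simp only [SetLike.mem_coe]
    rw [add_comm, pow_add, mul_smul, hk, smul_zero]
    exact Submodule.zero_mem _

lemma exists_pow_smul_eq_zero_of_isEFinite {N : ModuleCat.{u} U} (S : IsSl2 e f h) {c : ℂ} {v : N}
    (hv : h • v = c • v) (hfin : IsEFinite e v) : ∃ k : ℕ, e ^ k • v = 0 := by
  by_contra! hne
  have hfin' : FiniteDimensional ℂ (polySpan e v) := hfin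
  have hinj : Function.Injective fun n : ℕ => c + 2 * (n : ℂ) := fun m n hmn => by
    simpa using hmn
  have hli : LinearIndependent ℂ fun k : ℕ => e ^ k • v :=
    Module.End.eigenvectors_linearIndependent' (Algebra.lsmul ℂ ℂ N h) _ hinj _ fun k =>
      ⟨Module.End.mem_eigenspace_iff.mpr (S.h_smul_e_pow hv k), hne k⟩
  have hli2 : LinearIndependent ℂ fun k : ℕ =>
      (⟨e ^ k • v, Submodule.subset_span ⟨k, rfl⟩⟩ : polySpan e v) :=
    LinearIndependent.of_comp (polySpan e v).subtype hli
  exact (not_finite_iff_infinite.mpr inferInstance) hli2.finite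

variable [AdLocNilp e] [AdLocNilp f] {a b : ℂ} {N : ModuleCat.{u} U}

omit [AdLocNilp e] in
lemma toLoc_injective (S : IsSl2 e f h) (hb : ∀ n : ℤ, b ≠ n) (hN : IsWeightNilp e h b N) :
    Function.Injective (toLoc (f := f) N) := by
  refine (injective_iff_map_eq_zero _).mpr fun v hv => ?_
  obtain ⟨k, hk⟩ := exists_pow_smul_eq_zero hv
  exact hN.eq_zero_of_f_pow_smul S hb k hk

/-- The vector `f ^ (a + k) ⊗ v` of `D_a(N)`. -/
def twistedVec (a : ℂ) (k : ℤ) (v : N) : (twistedLoc f a).obj N :=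
  (((Loc.unit f ^ k : (Loc f)ˣ) : Loc f) • toLoc N v : (locFunctor f).obj N)

lemma smul_twistedVec (k : ℤ) (u : U) (v : N) : u • twistedVec (f := f) a k v =
    (((Loc.unit f ^ k : (Loc f)ˣ) : Loc f) • psi f (a + k) u • toLoc N v :
      (locFunctor f).obj N) := by
  rw [twistedLoc_smul, twistedVec, ← mul_smul, ← mul_smul, ← psi_mul_zpow]

lemma smul_twistedVec_of_commute (k : ℤ) {u : U} (hu : adOp f u = 0) (v : N) :
    u • twistedVec (f := f) a k v = twistedVec a k (u • v) := by
  rw [smul_twistedVec, psi_of_adOp_eq_zero _ hu, of_smul_toLoc]; rfl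

lemma twistedVec_f_smul (k : ℤ) (v : N) :
    twistedVec (f := f) a k (f • v) = twistedVec a (k + 1) v := by
  rw [twistedVec, twistedVec, ← of_smul_toLoc, ← mul_smul, zpow_add, zpow_one]; rfl

lemma f_smul_twistedVec (k : ℤ) (v : N) :
    f • twistedVec (f := f) a k v = twistedVec a (k + 1) v := by
  rw [smul_twistedVec_of_commute k (by rw [adOp_apply, sub_self]), twistedVec_f_smul]

lemma f_pow_smul_twistedVec (k : ℤ) (n : ℕ) (v : N) :
    f ^ n • twistedVec (f := f) a k v = twistedVec a (k + n) v := by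
  induction n with
  | zero => simp
  | succ n ih => rw [pow_succ', mul_smul, ih, f_smul_twistedVec, Nat.cast_succ, add_assoc]

lemma twistedVec_f_pow_smul (k : ℤ) (n : ℕ) (v : N) :
    twistedVec (f := f) a k (f ^ n • v) = twistedVec a (k + n) v := by
  induction n generalizing k with
  | zero => simp
  | succ n ih =>
    rw [pow_succ', mul_smul, twistedVec_f_smul, ih]; congr 1; push_cast; ring

lemma twistedVec_add (k : ℤ) (v w : N) :
    twistedVec (f := f) a k (v + w) = twistedVec a k v + twistedVec a k w := by
  rw [twistedVec, map_add, smul_add]; rfl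

lemma twistedVec_zero (k : ℤ) : twistedVec (f := f) a k (0 : N) = 0 := by
  rw [twistedVec, map_zero, smul_zero]; rfl

/-- `v ↦ f ^ (a + k) ⊗ v` as a linear map. -/
def twistedVecHom (a : ℂ) (k : ℤ) : N →ₗ[ℂ] (twistedLoc f a).obj N where
  toFun := twistedVec a k
  map_add' := twistedVec_add k
  map_smul' c v := by
    have h1 : adOp f (algebraMap ℂ U c) = 0 := by rw [adOp_apply, Algebra.commutes, sub_self]
    exact (smul_twistedVec_of_commute k h1 v).symm

lemma twistedVecHom_apply (k : ℤ) (v : N) : twistedVecHom (f := f) a k v = twistedVec a k v := rfl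

omit [AdLocNilp e] in
lemma twistedVec_injective (S : IsSl2 e f h) (hb : ∀ n : ℤ, b ≠ n) (hN : IsWeightNilp e h b N)
    (k : ℤ) : Function.Injective (twistedVec (f := f) (N := N) a k) := by
  intro v w hvw
  refine toLoc_injective S hb hN ?_
  have := congrArg (fun x : (locFunctor f).obj N =>
    (((Loc.unit f ^ k)⁻¹ : (Loc f)ˣ) : Loc f) • x) hvw
  simpa only [twistedVec, ← mul_smul, Units.inv_mul, one_smul] using this

lemma exists_twistedVec (x : (twistedLoc f a).obj N) :
    ∃ (k : ℕ) (v : N), x = twistedVec a (-k) v := by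
  obtain ⟨k, v, hk⟩ := exists_num_pow_smul (f := f) (N := N) x
  refine ⟨k, v, ?_⟩
  have h1 : ((Loc.unit f ^ (-(k : ℤ)) : (Loc f)ˣ) : Loc f) * Loc.num f ^ k = 1 := by
    rw [zpow_neg, zpow_natCast, show Loc.num f ^ k = ((Loc.unit f ^ k : (Loc f)ˣ) : Loc f) from
      (Units.val_pow_eq_pow_val (Loc.unit f) k).symm, Units.inv_mul]
  have h2 : ∀ y : (locFunctor f).obj N, Loc.num f ^ k • y = toLoc N v →
      y = ((Loc.unit f ^ (-(k : ℤ)) : (Loc f)ˣ) : Loc f) • toLoc N v := fun y hy => by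
    rw [← hy, ← mul_smul, h1, one_smul]
  exact h2 x hk

lemma toLoc_smul (c : ℂ) (v : N) :
    toLoc (f := f) N (c • v) = algebraMap ℂ (Loc f) c • toLoc N v :=
  (of_smul_toLoc (f := f) (algebraMap ℂ U c) v).symm

omit [AdLocNilp e] in
lemma h_smul_twistedVec (S : IsSl2 e f h) {c : ℂ} {v : N} (hv : h • v = c • v) (k : ℤ) :
    h • twistedVec (f := f) a k v = (c - 2 * (a + k)) • twistedVec a k v := by
  have h1 : psi f (a + k) h • toLoc (f := f) N v = toLoc N ((c - 2 * (a + k)) • v) := by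
    rw [psi_h S, sub_smul, of_smul_toLoc, hv, toLoc_smul, toLoc_smul, map_sub, sub_smul]
  rw [smul_twistedVec, h1]
  exact map_smul (twistedVecHom a k) (c - 2 * (a + k)) v

omit [AdLocNilp e] in
/-- A vector `v` of weight `c` killed by `e` gives the vector `f ^ (c + 1) ⊗ v` killed by `e`. -/
lemma e_smul_twistedVec (S : IsSl2 e f h) {c : ℂ} {v : N} (hv : h • v = c • v) (he : e • v = 0)
    (k : ℤ) (hk : a + k = c + 1) : e • twistedVec (f := f) a k v = 0 := by
  rw [smul_twistedVec, hk]
  have h1 : Loc.num f • psi f (c + 1) e • toLoc (f := f) N v = 0 := by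
    rw [← mul_smul, num_mul_psi_e S, add_smul, of_smul_toLoc, mul_smul, he, smul_zero, map_zero,
      zero_add, Algebra.smul_def, mul_smul, sub_smul, of_smul_toLoc, hv, add_sub_cancel_right]
    rw [toLoc_smul, sub_self, smul_zero]
  have h2 : psi f (c + 1) e • toLoc (f := f) N v = 0 := by
    rw [← one_smul (Loc f) (psi f (c + 1) e • _), ← Loc.inv_mul_num, mul_smul, h1, smul_zero]
  rw [h2, smul_zero]; rfl

omit [AdLocNilp e] in
lemma twistedLoc_diag (S : IsSl2 e f h) (hN : IsWeightNilp e h b N) (x : (twistedLoc f a).obj N) :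
    ∃ (s : Finset ℤ) (w : ℤ → (twistedLoc f a).obj N),
      (∀ n ∈ s, h • w n = algebraMap ℂ U (b - 2 * a + n) • w n) ∧ x = ∑ n ∈ s, w n := by
  obtain ⟨k, v, rfl⟩ := exists_twistedVec x
  obtain ⟨s, w, hw, rfl⟩ := hN.diag v
  refine exists_sum_of_mem_closure ?_
  rw [← twistedVecHom_apply, map_sum]
  refine AddSubmonoid.sum_mem _ fun n hn => AddSubmonoid.subset_closure ⟨n + 2 * k, ?_⟩
  rw [twistedVecHom_apply]
  refine (h_smul_twistedVec S (hw n hn) _).trans ?_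
  change _ = ((b - 2 * a + (n + 2 * k : ℤ) : ℂ)) • (twistedVec a (-k) (w n))
  congr 1
  push_cast
  ring

/-- On the `e`-finite part of `D_a(N)` the element `e` is locally nilpotent, and the `h`-weights are
those of `N` shifted by `-2a` and by integers. -/
lemma isWeightNilp_eFinite (S : IsSl2 e f h) (hN : IsWeightNilp e h b N) :
    IsWeightNilp e h (b - 2 * a) (eFinite e ((twistedLoc f a).obj N)) := by
  have hdiag : ∀ x : eFinite e ((twistedLoc f a).obj N), ∃ (s : Finset ℤ)
      (w : ℤ → eFinite e ((twistedLoc f a).obj N)),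
      (∀ n ∈ s, h • w n = algebraMap ℂ U (b - 2 * a + n) • w n) ∧ x = ∑ n ∈ s, w n := by
    classical
    intro x
    obtain ⟨s, w, hw, hs⟩ := twistedLoc_diag (a := a) S hN x.1
    have hmem := comp_mem_of_sum_mem (h := h) (a := b - 2 * a)
      (eFinite e ((twistedLoc f a).obj N)).toAddSubgroup
      (fun v hv => Submodule.smul_mem _ _ hv) (fun c v hv => Submodule.smul_mem _ _ hv)
      s w hw (hs ▸ x.2)
    refine ⟨s, fun n => if hn : n ∈ s then ⟨w n, hmem n hn⟩ else 0, fun n hn => ?_, ?_⟩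
    · simp only [hn, dif_pos]
      exact Subtype.ext (hw n hn)
    · ext
      rw [hs, AddSubmonoidClass.coe_finsetSum]
      exact Finset.sum_congr rfl fun n hn => by simp [hn]
  refine ⟨hdiag, fun x => ?_⟩
  obtain ⟨s, w, hw, rfl⟩ := hdiag x
  have h1 : ∀ n ∈ s, ∃ k : ℕ, e ^ k • w n = 0 := fun n hn => by
    obtain ⟨k, hk⟩ := exists_pow_smul_eq_zero_of_isEFinite S (c := b - 2 * a + n)
      (congrArg Subtype.val (hw n hn)) (w n).2
    exact ⟨k, Subtype.ext hk⟩
  choose! k hk using h1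
  refine ⟨s.sup k, ?_⟩
  rw [Finset.smul_sum]
  refine Finset.sum_eq_zero fun n hn => ?_
  obtain ⟨m, hm⟩ := Nat.exists_eq_add_of_le (Finset.le_sup (f := k) hn)
  rw [hm, add_comm, pow_add, mul_smul, hk n hn, smul_zero]

/-- `D_a(N)` is `f`-power torsion modulo its `e`-finite part. -/
lemma exists_f_pow_smul_mem_eFinite (S : IsSl2 e f h) (ha : ∀ n : ℤ, a ≠ n)
    (hN : IsWeightNilp e h a N) (x : (twistedLoc f a).obj N) :
    ∃ k : ℕ, f ^ k • x ∈ eFinite e ((twistedLoc f a).obj N) := by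
  set Z := eFinite e ((twistedLoc f a).obj N) with hZ
  have hup : ∀ (v : N) (k l : ℤ), k ≤ l → twistedVec a k v ∈ Z → twistedVec (f := f) a l v ∈ Z := by
    intro v k l hkl hk
    obtain ⟨m, rfl⟩ := Int.le.dest hkl
    rw [← f_pow_smul_twistedVec]
    exact Z.smul_mem _ hk
  have key : ∀ (n : ℕ) (m : ℤ) (v : N), h • v = (a + m : ℂ) • v → e ^ n • v = 0 →
      ∃ k : ℤ, twistedVec a k v ∈ Z := by
    intro n
    induction n with
    | zero =>
      intro m v _ hv
      rw [pow_zero, one_smul] at hv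
      exact ⟨0, by rw [hv, twistedVec_zero]; exact Z.zero_mem⟩
    | succ n ih =>
      intro m v hv hn
      have hu := S.h_smul_e_pow hv n
      have heu : e • e ^ n • v = 0 := by rw [← mul_smul, ← pow_succ', hn]
      obtain ⟨c, hc, h1⟩ := S.e_pow_smul_f_pow (c := a + m + 2 * n) (fun q hq => ha (q - m - 2 * n)
        (by push_cast; linear_combination hq)) hu heu n
      obtain ⟨k1, hk1⟩ := ih m (v - c⁻¹ • f ^ n • e ^ n • v) (by
          have := S.h_smul_f_pow hu n
          rw [add_sub_cancel_right] at this
          rw [smul_sub, hv, smul_comm h, this, smul_sub, smul_comm c⁻¹])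
        (by rw [smul_sub, smul_comm (e ^ n), h1, smul_smul, inv_mul_cancel₀ hc, one_smul, sub_self])
      have hk2 : twistedVec (f := f) a (m + 2 * n + 1) (e ^ n • v) ∈ Z := by
        refine isEFinite_of_pow_smul_eq_zero 1 ?_
        rw [pow_one]
        exact e_smul_twistedVec S hu heu _ (by push_cast; ring)
      have hk3 : twistedVec (f := f) a (m + 2 * n + 1) (f ^ n • e ^ n • v) ∈ Z := by
        rw [twistedVec_f_pow_smul]
        exact hup _ _ _ (by omega) hk2
      refine ⟨max k1 (m + 2 * n + 1), ?_⟩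
      have h4 : v = (v - c⁻¹ • f ^ n • e ^ n • v) + c⁻¹ • f ^ n • e ^ n • v := by abel
      rw [h4, twistedVec_add]
      refine Z.add_mem (hup _ _ _ (le_max_left _ _) hk1) ?_
      rw [← twistedVecHom_apply, map_smul]
      exact Z.smul_mem (algebraMap ℂ U c⁻¹) (hup _ _ _ (le_max_right _ _) hk3)
  obtain ⟨k0, v, rfl⟩ := exists_twistedVec x
  obtain ⟨s, w, hw, rfl⟩ := hN.diag v
  have h1 : ∀ n ∈ s, ∃ k : ℤ, twistedVec a k (w n) ∈ Z := fun n hn => by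
    obtain ⟨q, hq⟩ := hN.nilp (w n)
    exact key q n (w n) (hw n hn) hq
  choose! k hk using h1
  refine ⟨s.sup fun n => (k n + k0).toNat, ?_⟩
  rw [f_pow_smul_twistedVec, ← twistedVecHom_apply, map_sum]
  refine Submodule.sum_mem _ fun n hn => hup _ _ _ ?_ (hk n hn)
  have := Finset.le_sup (f := fun n => (k n + k0).toNat) hn
  have h2 := Int.self_le_toNat (k n + k0)
  have : ((k n + k0).toNat : ℤ) ≤ (s.sup fun n => (k n + k0).toNat : ℕ) := by exact_mod_cast this
  omega

/-- The `e`-finite part of `N[f⁻¹]` is `N`. -/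
lemma exists_toLoc_eq_of_mem_eFinite (S : IsSl2 e f h) (hb : ∀ n : ℤ, b ≠ n)
    (hN : IsWeightNilp e h b N) (x : (twistedLoc f 0).obj N)
    (hx : x ∈ eFinite e ((twistedLoc f 0).obj N)) : ∃ v : N, x = twistedVec 0 0 v := by
  have hlin : ∀ (u : U) (v : N), u • twistedVec (f := f) 0 0 v = twistedVec 0 0 (u • v) :=
    fun u v => by
      rw [smul_twistedVec, Int.cast_zero, add_zero, psi_zero, of_smul_toLoc]; rfl
  let P : Submodule U (eFinite e ((twistedLoc f 0).obj N)) :=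
    { carrier := {y | ∃ v : N, y.1 = twistedVec 0 0 v}
      zero_mem' := ⟨0, (twistedVec_zero 0).symm⟩
      add_mem' := by
        rintro y y' ⟨v, hv⟩ ⟨v', hv'⟩
        exact ⟨v + v', by rw [twistedVec_add, ← hv, ← hv']; rfl⟩
      smul_mem' := by
        rintro u y ⟨v, hv⟩
        exact ⟨u • v, by rw [← hlin, ← hv]; rfl⟩ }
  have h1 := isWeightNilp_eFinite (f := f) (a := 0) S hN
  obtain ⟨k, v, hk⟩ := exists_twistedVec x
  exact h1.mem_of_f_pow_smul_mem S (fun n hn => hb n (by linear_combination hn)) P (v := ⟨x, hx⟩) k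
    ⟨v, by
      change f ^ k • x = _
      rw [hk, f_pow_smul_twistedVec, neg_add_cancel]⟩

lemma twistedVec_mem_eFinite (hN : IsWeightNilp e h b N) (v : N) :
    twistedVec (f := f) 0 0 v ∈ eFinite e ((twistedLoc f 0).obj N) := by
  obtain ⟨k, hk⟩ := hN.nilp v
  refine isEFinite_of_pow_smul_eq_zero k ?_
  rw [smul_twistedVec, Int.cast_zero, add_zero, psi_zero, of_smul_toLoc, hk]
  exact twistedVec_zero 0

end Enright


/-! ### The equivalence given by the Enright functors `C_a` and `C_{-a}` -/

open scoped ModuleCat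

section Lift

variable {U : Type u} [Ring U] [Algebra ℂ U] {f : U} [AdLocNilp f] {Z : ModuleCat.{u} U}
  {Q : Type*} [AddCommGroup Q] [Module (Loc f) Q]

lemma oreDiv_mul_of (u : U) (s : Submonoid.powers f) (hs : u * (s : U) ∈ Submonoid.powers f) :
    (OreLocalization.oreDiv (1 : U) (⟨u * s, hs⟩ : Submonoid.powers f) : Loc f) * Loc.of f u =
      OreLocalization.oreDiv (1 : U) s := by
  have h1 : Loc.of f u = OreLocalization.oreDiv u (1 : Submonoid.powers f) := rfl
  rw [h1, OreLocalization.mul_div_one, one_mul, OreLocalization.expand 1 s u hs, smul_eq_mul,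
    mul_one]

/-- The extension to `Z[f⁻¹]` of an additive map `g` from `Z` to a `U[f⁻¹]`-module which is
semilinear along a ring homomorphism `t`. -/
def locLift (t : Loc f →+* Loc f) (g : Z →+ Q) (hg : ∀ u z, g (u • z) = t (Loc.of f u) • g z) :
    (locFunctor f).obj Z →+ Q where
  toFun := OreLocalization.liftExpand
    (fun z s => t (OreLocalization.oreDiv (1 : U) s : Loc f) • g z) (by
      intro z u s hs
      rw [hg, ← mul_smul, ← map_mul, oreDiv_mul_of])
  map_zero' := by
    change OreLocalization.liftExpand _ _ (0 : OreLocalization (Submonoid.powers f) Z) = 0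
    rw [← OreLocalization.zero_oreDiv 1, OreLocalization.liftExpand_of, map_zero, smul_zero]
  map_add' := by
    intro x y
    induction x using OreLocalization.ind with
    | _ r s =>
    induction y using OreLocalization.ind with
    | _ r' s' =>
    obtain ⟨w, q, h⟩ : ∃ (w : U) (q : Submonoid.powers f), (q : U) * s = w * s' :=
      ⟨_, _, OreLocalization.ore_eq (s : U) s'⟩
    have h1 := oreDiv_mul_of (q : U) s (q * s).2
    have h2 := oreDiv_mul_of w s' (by rw [← h]; exact (q * s).2)
    have h3 : (⟨w * s', by rw [← h]; exact (q * s).2⟩ : Submonoid.powers f) = q * s :=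
      Subtype.ext h.symm
    rw [h3] at h2
    change OreLocalization.liftExpand _ _
      ((OreLocalization.oreDiv r s + OreLocalization.oreDiv r' s' :
        OreLocalization (Submonoid.powers f) Z)) = _
    simp only [OreLocalization.oreDiv_add_char s s' w q h, OreLocalization.liftExpand_of]
    rw [map_add, Submonoid.smul_def, hg, hg, smul_add, ← mul_smul, ← mul_smul, ← map_mul,
      ← map_mul, h2]
    congr 3

lemma locLift_oreDiv (t : Loc f →+* Loc f) (g : Z →+ Q)
    (hg : ∀ u z, g (u • z) = t (Loc.of f u) • g z) (z : Z) (s : Submonoid.powers f) :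
    locLift t g hg (OreLocalization.oreDiv z s : OreLocalization (Submonoid.powers f) Z) =
      t (OreLocalization.oreDiv (1 : U) s : Loc f) • g z :=
  OreLocalization.liftExpand_of (S := Submonoid.powers f)
    (P := fun z s => t (OreLocalization.oreDiv (1 : U) s : Loc f) • g z)
    (hP := fun z u s hs => by rw [hg, ← mul_smul, ← map_mul, oreDiv_mul_of]) z s

lemma locLift_toLoc (t : Loc f →+* Loc f) (g : Z →+ Q)
    (hg : ∀ u z, g (u • z) = t (Loc.of f u) • g z) (z : Z) :
    locLift t g hg (toLoc Z z) = g z := by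
  rw [toLoc]
  refine (locLift_oreDiv t g hg z 1).trans ?_
  have : (OreLocalization.oreDiv (1 : U) (1 : Submonoid.powers f) : Loc f) = 1 :=
    OreLocalization.one_def.symm
  rw [this, map_one, one_smul]

lemma locLift_smul (t : Loc f →+* Loc f) (g : Z →+ Q)
    (hg : ∀ u z, g (u • z) = t (Loc.of f u) • g z) (c : Loc f) (x : (locFunctor f).obj Z) :
    locLift t g hg (c • x) = t c • locLift t g hg x := by
  induction x using OreLocalization.ind with
  | _ r s =>
  induction c using OreLocalization.ind with
  | _ u q =>
  obtain ⟨w, q', h⟩ : ∃ (w : U) (q' : Submonoid.powers f), (q' : U) * u = w * s :=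
    ⟨_, _, OreLocalization.ore_eq u s⟩
  have h1 : (OreLocalization.oreDiv u q • OreLocalization.oreDiv r s :
      OreLocalization (Submonoid.powers f) Z) = OreLocalization.oreDiv (w • r) (q' * q) :=
    OreLocalization.oreDiv_smul_char u _ q s w q' h
  have h2 : (OreLocalization.oreDiv u q * OreLocalization.oreDiv 1 s : Loc f) =
      OreLocalization.oreDiv (w * 1) (q' * q) :=
    OreLocalization.oreDiv_mul_char u 1 q s w q' h
  have h3 : (OreLocalization.oreDiv (1 : U) (q' * q) : Loc f) * Loc.of f w =
      OreLocalization.oreDiv (w * 1) (q' * q) := by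
    have h4 : Loc.of f w = OreLocalization.oreDiv w (1 : Submonoid.powers f) := rfl
    rw [h4, OreLocalization.mul_div_one, one_mul, mul_one]
  refine (congrArg (locLift t g hg) h1).trans ?_
  rw [locLift_oreDiv, hg, ← mul_smul, ← map_mul, h3, ← h2, map_mul, mul_smul, locLift_oreDiv]

end Lift

section Equivalence

variable {U : Type u} [Ring U] [Algebra ℂ U] {e f h : U} [AdLocNilp e] [AdLocNilp f] {a b : ℂ}
  {N : ModuleCat.{u} U}

/-- The inclusion `C_a N ⊆ D_a(N)`, where `f ^ a ⊗ v ∈ D_a(N)` is identified with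
`v ∈ N[f⁻¹]`. -/
def enrightIncl (e f : U) [AdLocNilp e] [AdLocNilp f] (a : ℂ) (N : ModuleCat.{u} U) :
    (enright e f a).obj N →+ (locFunctor f).obj N where
  toFun z := Subtype.val (p := (· ∈ eFinite e ((twistedLoc f a).obj N))) z
  map_zero' := rfl
  map_add' _ _ := rfl

/-- The automorphism `φ_a` of `U[f⁻¹]`. -/
abbrev phiLoc (f : U) [AdLocNilp f] (a : ℂ) : Loc f →+* Loc f :=
  phi (Loc.num f) (Loc.inv f) (Loc.num_mul_inv f) (Loc.inv_mul_num f) a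

lemma enrightIncl_smul (u : U) (z : (enright e f a).obj N) :
    enrightIncl e f a N (u • z) = phiLoc f (-a) (Loc.of f u) • enrightIncl e f a N z := rfl

lemma enrightIncl_injective : Function.Injective (enrightIncl e f a N) := Subtype.val_injective

/-- The `φ_{-a}`-semilinear map `(C_a N)[f⁻¹] → N[f⁻¹]` induced by the inclusion
`C_a N ⊆ D_a(N)`. -/
def enrightLocMap (e f : U) [AdLocNilp e] [AdLocNilp f] (a : ℂ) (N : ModuleCat.{u} U) :
    (locFunctor f).obj ((enright e f a).obj N) →+ (locFunctor f).obj N :=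
  locLift (phiLoc f (-a)) (enrightIncl e f a N) enrightIncl_smul

lemma enrightLocMap_smul (c : Loc f) (x : (locFunctor f).obj ((enright e f a).obj N)) :
    enrightLocMap e f a N (c • x) = phiLoc f (-a) c • enrightLocMap e f a N x :=
  locLift_smul _ _ _ c x

lemma enrightLocMap_toLoc (z : (enright e f a).obj N) :
    enrightLocMap e f a N (toLoc _ z) = enrightIncl e f a N z :=
  locLift_toLoc _ _ _ z

lemma phiLoc_num_pow (a : ℂ) (k : ℕ) : phiLoc f a (Loc.num f ^ k) = Loc.num f ^ k := by
  rw [map_pow]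
  congr 1
  exact phiFun_of_adOp_eq_zero a (by rw [adOp_apply, sub_self])

lemma inv_unit_pow_mul (k : ℕ) :
    (((Loc.unit f ^ k)⁻¹ : (Loc f)ˣ) : Loc f) * Loc.num f ^ k = 1 := by
  rw [show Loc.num f ^ k = ((Loc.unit f ^ k : (Loc f)ˣ) : Loc f) from
      (Units.val_pow_eq_pow_val (Loc.unit f) k).symm, Units.inv_mul]

lemma eq_zero_of_num_pow_smul {x : (locFunctor f).obj N} (k : ℕ) (hx : Loc.num f ^ k • x = 0) :
    x = 0 := by
  rw [← one_smul (Loc f) x, ← inv_unit_pow_mul k, mul_smul, hx, smul_zero]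

lemma enrightLocMap_injective : Function.Injective (enrightLocMap e f a N) := by
  refine (injective_iff_map_eq_zero _).mpr fun x hx => ?_
  obtain ⟨k, z, hz⟩ := exists_num_pow_smul x
  have h1 := enrightLocMap_smul (Loc.num f ^ k) x
  rw [hz, enrightLocMap_toLoc, hx, smul_zero] at h1
  have h2 : z = 0 := enrightIncl_injective (h1.trans (map_zero _).symm)
  rw [h2, map_zero] at hz
  exact eq_zero_of_num_pow_smul k hz

/-- Surjectivity holds because `D_a(N)` is `f`-power torsion modulo `C_a(N)`. -/
lemma enrightLocMap_surjective (S : IsSl2 e f h) (ha : ∀ n : ℤ, a ≠ n)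
    (hN : IsWeightNilp e h a N) : Function.Surjective (enrightLocMap e f a N) := by
  intro x
  obtain ⟨k, hk⟩ := exists_f_pow_smul_mem_eFinite S ha hN x
  obtain ⟨z, hz⟩ : ∃ z : (enright e f a).obj N, enrightIncl e f a N z = psi f a (f ^ k) • x :=
    ⟨⟨_, hk⟩, rfl⟩
  refine ⟨(((Loc.unit f ^ k)⁻¹ : (Loc f)ˣ) : Loc f) • toLoc _ z, ?_⟩
  rw [enrightLocMap_smul, enrightLocMap_toLoc, hz, map_pow, psi_self, ← mul_smul,
    ← phiLoc_num_pow (-a), ← map_mul, inv_unit_pow_mul, map_one, one_smul]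

/-- The linear map `D_b(C_a N) → N[f⁻¹]` for `a + b = 0`. -/
def enrightLocHom (e f : U) [AdLocNilp e] [AdLocNilp f] (hab : a + b = 0) (N : ModuleCat.{u} U) :
    (twistedLoc f b).obj ((enright e f a).obj N) →ₗ[U] (twistedLoc f 0).obj N where
  toFun x := (enrightLocMap e f a N x : (locFunctor f).obj N)
  map_add' x y := map_add (enrightLocMap e f a N) x y
  map_smul' u x := by
    refine (enrightLocMap_smul (psi f b u) x).trans ?_
    have : phiLoc f (-a) (psi f b u) = psi f 0 u := by
      refine (phiFun_phiFun (Loc.num_mul_inv f) (Loc.inv_mul_num f) (-a) (-b) _).trans ?_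
      rw [← neg_add, hab]; rfl
    rw [this]; rfl

lemma enrightLocHom_injective (hab : a + b = 0) :
    Function.Injective (enrightLocHom e f hab N) :=
  fun _ _ h => enrightLocMap_injective (e := e) (f := f) (a := a) (N := N) h

lemma enrightLocHom_surjective (S : IsSl2 e f h) (ha : ∀ n : ℤ, a ≠ n) (hab : a + b = 0)
    (hN : IsWeightNilp e h a N) : Function.Surjective (enrightLocHom e f hab N) :=
  fun x => enrightLocMap_surjective S ha hN x

/-- The embedding `N → N[f⁻¹]`. -/
def toTwistedLoc (f : U) [AdLocNilp f] (N : ModuleCat.{u} U) : N →ₗ[U] (twistedLoc f 0).obj N where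
  toFun := toLoc N
  map_add' := map_add _
  map_smul' u v := by
    rw [← of_smul_toLoc, ← psi_zero]; rfl

/-- The image of `C_b(C_a N)` in `N[f⁻¹]` consists of the `e`-finite vectors, which form `N`. -/
lemma range_enrightLocHom (S : IsSl2 e f h) (ha : ∀ n : ℤ, a ≠ n) (hab : a + b = 0)
    (hN : IsWeightNilp e h a N) :
    LinearMap.range (enrightLocHom e f hab N ∘ₗ
        (eFinite e ((twistedLoc f b).obj ((enright e f a).obj N))).subtype) =
      LinearMap.range (toTwistedLoc f N) := by
  have h0 : ∀ v : N, twistedVec (f := f) 0 0 v = toTwistedLoc f N v := fun v => by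
    rw [twistedVec, zpow_zero, Units.val_one, one_smul]; rfl
  apply le_antisymm
  · rintro _ ⟨x, rfl⟩
    obtain ⟨v, hv⟩ := exists_toLoc_eq_of_mem_eFinite S ha hN _
      (isEFinite_map e (ModuleCat.ofHom (enrightLocHom e f hab N)) x.1 x.2)
    exact ⟨v, (h0 v).symm.trans hv.symm⟩
  · rintro _ ⟨v, rfl⟩
    let E : (twistedLoc f b).obj ((enright e f a).obj N) ≃ₗ[U] (twistedLoc f 0).obj N :=
      LinearEquiv.ofBijective (enrightLocHom e f hab N)
        ⟨enrightLocHom_injective hab, enrightLocHom_surjective S ha hab hN⟩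
    have h1 := isEFinite_map e (ModuleCat.ofHom E.symm.toLinearMap) _
      (twistedVec_mem_eFinite (f := f) hN v)
    refine ⟨⟨E.symm (twistedVec 0 0 v), h1⟩, ?_⟩
    rw [← h0]
    exact E.apply_symm_apply _

/-- The isomorphism `C_b (C_a N) ≅ N` for `a + b = 0`. -/
def enrightEnrightEquiv (S : IsSl2 e f h) (ha : ∀ n : ℤ, a ≠ n) (hab : a + b = 0)
    (hN : IsWeightNilp e h a N) : (enright e f b).obj ((enright e f a).obj N) ≃ₗ[U] N :=
  (LinearEquiv.ofInjective (enrightLocHom e f hab N ∘ₗ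
      (eFinite e ((twistedLoc f b).obj ((enright e f a).obj N))).subtype)
    ((enrightLocHom_injective hab).comp Subtype.val_injective)).trans
  ((LinearEquiv.ofEq _ _ (range_enrightLocHom S ha hab hN)).trans
    (LinearEquiv.ofInjective (toTwistedLoc f N) (toLoc_injective S ha hN)).symm)

lemma toLoc_enrightEnrightEquiv (S : IsSl2 e f h) (ha : ∀ n : ℤ, a ≠ n) (hab : a + b = 0)
    (hN : IsWeightNilp e h a N) (x : (enright e f b).obj ((enright e f a).obj N)) :
    toLoc (f := f) N (enrightEnrightEquiv S ha hab hN x) =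
      enrightLocMap e f a N (enrightIncl e f b _ x) := by
  have h1 := (LinearEquiv.ofInjective (toTwistedLoc f N) (toLoc_injective S ha hN)).apply_symm_apply
    ((LinearEquiv.ofEq _ _ (range_enrightLocHom S ha hab hN)) (LinearEquiv.ofInjective
      (enrightLocHom e f hab N ∘ₗ
      (eFinite e ((twistedLoc f b).obj ((enright e f a).obj N))).subtype)
    ((enrightLocHom_injective hab).comp Subtype.val_injective) x))
  exact congrArg Subtype.val h1

lemma enrightLocMap_naturality {N' : ModuleCat.{u} U} (g : N ⟶ N')
    (x : (locFunctor f).obj ((enright e f a).obj N)) :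
    enrightLocMap e f a N' (((locFunctor f).map ((enright e f a).map g)).hom x) =
      ((locFunctor f).map g).hom (enrightLocMap e f a N x) := by
  obtain ⟨k, z, hz⟩ := exists_num_pow_smul x
  have hinj : ∀ y y' : (locFunctor f).obj N', Loc.num f ^ k • y = Loc.num f ^ k • y' → y = y' :=
    fun y y' h => sub_eq_zero.mp (eq_zero_of_num_pow_smul k (by rw [smul_sub, h, sub_self]))
  have hs : ∀ (M : ModuleCat.{u} U) (y : (locFunctor f).obj ((enright e f a).obj M)),
      Loc.num f ^ k • enrightLocMap e f a M y = enrightLocMap e f a M (Loc.num f ^ k • y) := by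
    intro M y
    rw [enrightLocMap_smul, phiLoc_num_pow]
  apply hinj
  rw [hs, ← map_smul, ← map_smul, hs, hz, locFunctor_map_toLoc, enrightLocMap_toLoc,
    enrightLocMap_toLoc]
  rfl

lemma enrightEnrightEquiv_naturality (S : IsSl2 e f h) (ha : ∀ n : ℤ, a ≠ n) (hab : a + b = 0)
    {N' : ModuleCat.{u} U} (hN : IsWeightNilp e h a N) (hN' : IsWeightNilp e h a N') (g : N ⟶ N')
    (x : (enright e f b).obj ((enright e f a).obj N)) :
    enrightEnrightEquiv S ha hab hN' (((enright e f b).map ((enright e f a).map g)).hom x) =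
      g.hom (enrightEnrightEquiv S ha hab hN x) := by
  apply toLoc_injective (f := f) S ha hN'
  rw [toLoc_enrightEnrightEquiv, ← locFunctor_map_toLoc, toLoc_enrightEnrightEquiv,
    ← enrightLocMap_naturality]
  rfl

/-- The Enright functors `C_a` and `C_{-a}` restrict to mutually inverse equivalences between
subcategories which they preserve. -/
lemma isEquivalence_enright (S : IsSl2 e f h) (ha : ∀ n : ℤ, a ≠ n) (hab : a + b = 0)
    (P Q : ObjectProperty (ModuleCat.{u} U)) (hP : ∀ N, P N → IsWeightNilp e h a N)
    (hQ : ∀ N, Q N → IsWeightNilp e h b N) (hQP : ∀ N, Q N → P ((enright e f b).obj N))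
    (hC : ∀ N : P.FullSubcategory, Q ((P.ι ⋙ enright e f a).obj N)) :
    (Q.lift (P.ι ⋙ enright e f a) hC).IsEquivalence := by
  have hb : ∀ n : ℤ, b ≠ n := fun n hn => ha (-n) (by
    push_cast; rw [← hn]; exact eq_neg_of_add_eq_zero_left hab)
  have hba : b + a = 0 := by rw [add_comm]; exact hab
  let F := Q.lift (P.ι ⋙ enright e f a) hC
  let G := P.lift (Q.ι ⋙ enright e f b) fun N => hQP _ N.2
  let η : 𝟭 P.FullSubcategory ≅ F ⋙ G := (NatIso.ofComponents
    (fun N => P.isoMk (enrightEnrightEquiv S ha hab (hP N.obj N.property)).toModuleIso) (by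
      intro N N' g
      apply ObjectProperty.hom_ext
      ext x
      exact enrightEnrightEquiv_naturality S ha hab (hP _ N.2) (hP _ N'.2) g.hom x)).symm
  let ε : G ⋙ F ≅ 𝟭 Q.FullSubcategory := NatIso.ofComponents
    (fun N => Q.isoMk (enrightEnrightEquiv S hb hba (hQ N.obj N.property)).toModuleIso) (by
      intro N N' g
      apply ObjectProperty.hom_ext
      ext x
      exact enrightEnrightEquiv_naturality S hb hba (hQ _ N.2) (hQ _ N'.2) g.hom x)
  exact (CategoryTheory.Equivalence.mk F G η ε).isEquivalence_functor

end Equivalence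


/-! ### Submodules of `C_a(N)` -/

open scoped ModuleCat

section Submodules

variable {U : Type u} [Ring U] [Algebra ℂ U] {e f h : U} [AdLocNilp e] [AdLocNilp f] {a b : ℂ}
  {N : ModuleCat.{u} U}

lemma isWeightNilp_enright (S : IsSl2 e f h) (hab : a + b = 0) (hN : IsWeightNilp e h a N) :
    IsWeightNilp e h b ((enright e f a).obj N) := by
  have := isWeightNilp_eFinite (f := f) (a := a) S hN
  rwa [show a - 2 * a = b by linear_combination -hab] at this

omit [AdLocNilp e] in
lemma twistedLoc_map_twistedVec {N' : ModuleCat.{u} U} (g : N ⟶ N') (k : ℤ) (v : N) :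
    ((twistedLoc f a).map g).hom (twistedVec a k v) = twistedVec a k (g.hom v) := by
  refine (map_smul ((locFunctor f).map g).hom _ _).trans ?_
  rw [locFunctor_map_toLoc]; rfl

omit [AdLocNilp e] in
/-- Every `u` is expressed by the twisted elements `ψ_b((ad f)^i u)`: the inverse of the twist is the
twist by `-b`. -/
lemma of_eq_sum_psi (b : ℂ) (u : U) (K : ℕ) (hK : (adOp f ^ K) u = 0) :
    Loc.of f u = ∑ i ∈ Finset.range K,
      Ring.choose b i • (psi f b ((adOp f ^ i) u) * Loc.inv f ^ i) := by
  have h1 := phiFun_phiFun (Loc.num_mul_inv f) (Loc.inv_mul_num f) (-b) b (Loc.of f u)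
  rw [neg_add_cancel, phiFun_zero, phiFun_eq_sum _ _ b _ K (by rw [Loc.adOp_of, hK, map_zero])] at h1
  refine h1.symm.trans ((map_sum (phiLoc f (-b)) _ _).trans (Finset.sum_congr rfl fun i _ => ?_))
  refine (phiFun_smul (f := Loc.num f) (g := Loc.inv f) _ _ _).trans ?_
  congr 1
  refine (map_mul (phiLoc f (-b)) _ _).trans ?_
  have h2 : phiLoc f (-b) (Loc.inv f) = Loc.inv f :=
    phiFun_inv (Loc.num_mul_inv f) (Loc.inv_mul_num f) (-b)
  rw [map_pow, Loc.adOp_of, h2]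
  rfl

omit [AdLocNilp e] in
/-- `f ^ (a + k) ⊗ u v = ∑ᵢ binom(a + k, i) (ad f)ⁱ(u) (f ^ (a + k - i) ⊗ v)`. -/
lemma twistedVec_smul (u : U) (k : ℤ) (K : ℕ) (hK : (adOp f ^ K) u = 0) (v : N) :
    twistedVec (f := f) a k (u • v) = ∑ i ∈ Finset.range K,
      algebraMap ℂ U (Ring.choose (a + k) i) • (adOp f ^ i) u • twistedVec (f := f) a (k - i) v := by
  have h1 : ∀ i ∈ Finset.range K, algebraMap ℂ U (Ring.choose (a + k) i) • (adOp f ^ i) u •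
      twistedVec (f := f) a (k - i) v =
      (show (twistedLoc f a).obj N from
      ((((Loc.unit f ^ k : (Loc f)ˣ) : Loc f) * Ring.choose (a + k) i •
        (psi f (a + k) ((adOp f ^ i) u) * Loc.inv f ^ i)) • toLoc N v : (locFunctor f).obj N)) := by
    intro i _
    rw [← mul_smul, ← Algebra.smul_def]
    change (psi f a (Ring.choose (a + k) i • (adOp f ^ i) u) •
      ((Loc.unit f ^ (k - i : ℤ) : (Loc f)ˣ) : Loc f) • toLoc N v : (locFunctor f).obj N) =
      ((((Loc.unit f ^ k : (Loc f)ˣ) : Loc f) * Ring.choose (a + k) i •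
        (psi f (a + k) ((adOp f ^ i) u) * Loc.inv f ^ i)) • toLoc N v : (locFunctor f).obj N)
    have h2 : ((Loc.unit f ^ (k - i : ℤ) : (Loc f)ˣ) : Loc f) =
        ((Loc.unit f ^ k : (Loc f)ˣ) : Loc f) * Loc.inv f ^ i := by
      rw [zpow_sub, zpow_natCast, Units.val_mul, ← inv_pow, Units.val_pow_eq_pow_val]; rfl
    rw [h2, Algebra.smul_def, map_mul, psi_algebraMap, ← Algebra.smul_def, ← mul_smul,
      smul_mul_assoc, ← mul_assoc, psi_mul_zpow, mul_smul_comm, mul_assoc]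
  rw [Finset.sum_congr rfl h1]
  have h3 : twistedVec (f := f) a k (u • v) = (show (twistedLoc f a).obj N from
      ((((Loc.unit f ^ k : (Loc f)ˣ) : Loc f) * Loc.of f u) • toLoc N v : (locFunctor f).obj N)) := by
    rw [twistedVec, ← of_smul_toLoc, ← mul_smul]
  rw [h3, of_eq_sum_psi (a + k) u K hK, Finset.mul_sum]
  exact Finset.sum_smul (R := Loc f) (M := (locFunctor f).obj N)

lemma exists_mem_twistedVec_of_le {P : Submodule U ((enright e f a).obj N)} {k l : ℤ} (hkl : k ≤ l) {v : N}
    (hk : ∃ z ∈ P, z.1 = twistedVec a k v) : ∃ z ∈ P, z.1 = twistedVec (f := f) a l v := by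
  obtain ⟨m, rfl⟩ := Int.le.dest hkl
  obtain ⟨z, hz, hv⟩ := hk
  refine ⟨f ^ m • z, P.smul_mem _ hz, ?_⟩
  rw [← f_pow_smul_twistedVec, ← hv]; rfl

/-- The submodule of the `v ∈ N` such that `f ^ (a + k) ⊗ v` belongs to the submodule `P` of
`C_a(N)` for large `k`. -/
def untwist (P : Submodule U ((enright e f a).obj N)) : Submodule U N where
  carrier := {v | ∃ k : ℤ, ∃ z ∈ P, z.1 = twistedVec a k v}
  zero_mem' := ⟨0, 0, P.zero_mem, (twistedVec_zero 0).symm⟩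
  add_mem' := by
    rintro v w ⟨k, hk⟩ ⟨l, hl⟩
    obtain ⟨z, hz, hz'⟩ := exists_mem_twistedVec_of_le (le_max_left k l) hk
    obtain ⟨y, hy, hy'⟩ := exists_mem_twistedVec_of_le (le_max_right k l) hl
    exact ⟨max k l, z + y, P.add_mem hz hy, by rw [twistedVec_add, ← hz', ← hy']; rfl⟩
  smul_mem' := by
    rintro u v ⟨k, hk⟩
    obtain ⟨K, hK⟩ := AdLocNilp.out (f := f) u
    have h1 : ∀ i : ℕ, ∃ z, i ∈ Finset.range K → z ∈ P ∧ z.1 = twistedVec a (k + K - i) v := by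
      intro i
      by_cases hi : i ∈ Finset.range K
      · obtain ⟨z, hz⟩ := exists_mem_twistedVec_of_le (l := k + K - i)
          (by have := Finset.mem_range.mp hi; omega) hk
        exact ⟨z, fun _ => hz⟩
      · exact ⟨0, fun h => absurd h hi⟩
    choose z hz using h1
    refine ⟨k + K, ∑ i ∈ Finset.range K, algebraMap ℂ U (Ring.choose (a + (k + K : ℤ)) i) •
      (adOp f ^ i) u • z i, P.sum_mem fun i hi => P.smul_mem _ (P.smul_mem _ (hz i hi).1), ?_⟩
    rw [twistedVec_smul u _ K hK]
    refine (map_sum (enrightIncl e f a N) _ _).trans (Finset.sum_congr rfl fun i hi => ?_)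
    rw [← (hz i hi).2]; rfl

lemma mem_untwist {P : Submodule U ((enright e f a).obj N)} {v : N} :
    v ∈ untwist P ↔ ∃ k : ℤ, ∃ z ∈ P, z.1 = twistedVec a k v := Iff.rfl

lemma exists_f_pow_smul_eq_twistedVec (z : (enright e f a).obj N) :
    ∃ (k : ℕ) (v : N), (f ^ k • z).1 = twistedVec a 0 v := by
  obtain ⟨k, v, hv⟩ := exists_twistedVec z.1
  refine ⟨k, v, ?_⟩
  change f ^ k • z.1 = _
  rw [hv, f_pow_smul_twistedVec, neg_add_cancel]

lemma untwist_top (S : IsSl2 e f h) (ha : ∀ n : ℤ, a ≠ n) (hN : IsWeightNilp e h a N) :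
    untwist (⊤ : Submodule U ((enright e f a).obj N)) = ⊤ := by
  refine eq_top_iff.mpr fun v _ => ?_
  obtain ⟨k, hk⟩ := exists_f_pow_smul_mem_eFinite S ha hN (twistedVec a 0 v)
  rw [f_pow_smul_twistedVec] at hk
  exact ⟨0 + k, ⟨_, hk⟩, trivial, rfl⟩

lemma untwist_bot (S : IsSl2 e f h) (ha : ∀ n : ℤ, a ≠ n) (hN : IsWeightNilp e h a N) :
    untwist (⊥ : Submodule U ((enright e f a).obj N)) = ⊥ := by
  refine eq_bot_iff.mpr ?_
  rintro v ⟨k, z, hz, hv⟩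
  refine (Submodule.mem_bot U).mpr (twistedVec_injective (f := f) (a := a) S ha hN k ?_)
  rw [← hv, twistedVec_zero, (Submodule.mem_bot U).mp hz]; rfl

lemma eq_top_of_untwist_eq_top (S : IsSl2 e f h) (ha : ∀ n : ℤ, a ≠ n) (hab : a + b = 0)
    (hN : IsWeightNilp e h a N) {P : Submodule U ((enright e f a).obj N)} (hP : untwist P = ⊤) :
    P = ⊤ := by
  have hb : ∀ n : ℤ, b ≠ n := fun n hn => ha (-n) (by
    push_cast; rw [← hn]; exact eq_neg_of_add_eq_zero_left hab)
  refine eq_top_iff.mpr fun z _ => ?_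
  obtain ⟨k, v, hv⟩ := exists_f_pow_smul_eq_twistedVec z
  obtain ⟨l, hl⟩ : v ∈ untwist P := hP ▸ trivial
  obtain ⟨y, hy, hy'⟩ := exists_mem_twistedVec_of_le (Int.self_le_toNat l) hl
  refine (isWeightNilp_enright S hab hN).mem_of_f_pow_smul_mem S hb P (l.toNat + k) ?_
  rw [pow_add, mul_smul]
  have h1 : f ^ l.toNat • f ^ k • z = y := by
    refine Subtype.ext ?_
    change f ^ l.toNat • (f ^ k • z).1 = _
    rw [hv, f_pow_smul_twistedVec, hy', zero_add]
  rwa [h1]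

lemma eq_bot_of_untwist_eq_bot (S : IsSl2 e f h) (ha : ∀ n : ℤ, a ≠ n) (hab : a + b = 0)
    (hN : IsWeightNilp e h a N) {P : Submodule U ((enright e f a).obj N)} (hP : untwist P = ⊥) :
    P = ⊥ := by
  have hb : ∀ n : ℤ, b ≠ n := fun n hn => ha (-n) (by
    push_cast; rw [← hn]; exact eq_neg_of_add_eq_zero_left hab)
  refine eq_bot_iff.mpr fun z hz => (Submodule.mem_bot U).mpr ?_
  obtain ⟨k, v, hv⟩ := exists_f_pow_smul_eq_twistedVec z
  have h1 : v ∈ untwist P := ⟨0, f ^ k • z, P.smul_mem _ hz, hv⟩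
  rw [hP, Submodule.mem_bot] at h1
  rw [h1, twistedVec_zero] at hv
  exact (isWeightNilp_enright S hab hN).eq_zero_of_f_pow_smul S hb k (Subtype.ext hv)

/-- Lifts of the generators of `N` generate a submodule of `C_a(N)` whose untwist is `N`. -/
lemma finite_enright (S : IsSl2 e f h) (ha : ∀ n : ℤ, a ≠ n) (hab : a + b = 0)
    (hN : IsWeightNilp e h a N) (hfin : Module.Finite U N) :
    Module.Finite U ((enright e f a).obj N) := by
  classical
  obtain ⟨s, hs⟩ := hfin.fg_top
  have h1 : ∀ v : N, ∃ (k : ℤ) (z : (enright e f a).obj N), z.1 = twistedVec a k v := by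
    intro v
    obtain ⟨k, z, -, hz⟩ : v ∈ untwist (⊤ : Submodule U ((enright e f a).obj N)) := by
      rw [untwist_top S ha hN]; trivial
    exact ⟨k, z, hz⟩
  choose k z hz using h1
  refine ⟨⟨s.image z, eq_top_of_untwist_eq_top S ha hab hN (eq_top_iff.mpr ?_)⟩⟩
  rw [← hs, Submodule.span_le]
  intro v hv
  exact ⟨k v, z v, Submodule.subset_span (Finset.mem_coe.mpr (Finset.mem_image_of_mem z hv)), hz v⟩

lemma isSimpleModule_enright (S : IsSl2 e f h) (ha : ∀ n : ℤ, a ≠ n) (hab : a + b = 0)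
    (hN : IsWeightNilp e h a N) [IsSimpleModule U N] :
    IsSimpleModule U ((enright e f a).obj N) := by
  have hne : (⊥ : Submodule U ((enright e f a).obj N)) ≠ ⊤ := fun h0 =>
    bot_ne_top (α := Submodule U N) (by rw [← untwist_bot (f := f) S ha hN, h0, untwist_top S ha hN])
  have : Nontrivial (Submodule U ((enright e f a).obj N)) := ⟨⟨_, _, hne⟩⟩
  refine (isSimpleModule_iff _ _).mpr ⟨fun P => ?_⟩
  rcases eq_bot_or_eq_top (untwist P) with h0 | h0
  · exact Or.inl (eq_bot_of_untwist_eq_bot S ha hab hN h0)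
  · exact Or.inr (eq_top_of_untwist_eq_top S ha hab hN h0)

lemma enright_map_val {N' : ModuleCat.{u} U} (g : N ⟶ N') (z : (enright e f a).obj N) :
    (((enright e f a).map g).hom z).1 = ((twistedLoc f a).map g).hom z.1 := rfl

/-- The Enright functor is exact in the middle on modules with non-integral weights. -/
lemma exists_enright_map_eq (S : IsSl2 e f h) (ha : ∀ n : ℤ, a ≠ n) (hab : a + b = 0)
    (hN : IsWeightNilp e h a N) (P : Submodule U N) (z : (enright e f a).obj N)
    (hz : ((enright e f a).map (ModuleCat.ofHom P.mkQ)).hom z = 0) :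
    ∃ y : (enright e f a).obj (ModuleCat.of U P),
      ((enright e f a).map (ModuleCat.ofHom P.subtype)).hom y = z := by
  obtain ⟨k, v, hv⟩ := exists_twistedVec z.1
  have h1 : twistedVec (f := f) a (-k) (P.mkQ v) = twistedVec (N := ModuleCat.of U (N ⧸ P)) a (-k) 0 := by
    have h2 := congrArg Subtype.val hz
    rw [enright_map_val, hv, twistedLoc_map_twistedVec] at h2
    rw [twistedVec_zero]
    exact h2
  have h3 := twistedVec_injective (f := f) (N := ModuleCat.of U (N ⧸ P)) S ha (hN.quotient P) _ h1
  have hvP : v ∈ P := (Submodule.Quotient.mk_eq_zero P).mp h3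
  obtain ⟨n, hn⟩ := (isWeightNilp_enright S hab hN).nilp z
  let y : (twistedLoc f a).obj (ModuleCat.of U P) := twistedVec a (-k) (⟨v, hvP⟩ : P)
  have hyz : ((twistedLoc f a).map (ModuleCat.ofHom P.subtype)).hom y = z.1 := by
    rw [twistedLoc_map_twistedVec, hv]; rfl
  have hy : e ^ n • y = 0 := by
    obtain ⟨l, p, hp⟩ := exists_twistedVec (e ^ n • y)
    have h4 : ((twistedLoc f a).map (ModuleCat.ofHom P.subtype)).hom (e ^ n • y) = 0 := by
      rw [map_smul, hyz]
      exact congrArg Subtype.val hn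
    rw [hp, twistedLoc_map_twistedVec, ← twistedVec_zero (-l)] at h4
    have h5 : p = 0 := Subtype.ext (twistedVec_injective (f := f) S ha hN _ h4)
    rw [hp, h5, twistedVec_zero]
  exact ⟨⟨y, isEFinite_of_pow_smul_eq_zero n hy⟩, Subtype.ext hyz⟩

end Submodules


/-! ### Simultaneous eigenspaces -/

/-- Simultaneous eigenspaces of commuting operators are independent. -/
lemma iSupIndep_iInf_eigenspace {ι V : Type*} [AddCommGroup V] [Module ℂ V]
    (T : ι → Module.End ℂ V) (hT : ∀ i j, Commute (T i) (T j)) :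
    iSupIndep fun χ : ι → ℂ => ⨅ i, Module.End.eigenspace (T i) (χ i) := by
  refine (Module.End.independent_iInf_maxGenEigenspace_of_forall_mapsTo T
    (fun i j c => Module.End.mapsTo_maxGenEigenspace_of_comm (hT j i) c)).mono
    fun χ => iInf_mono fun i => ?_
  exact Module.End.genEigenspace_le_maximal (f := T i) (χ i) 1

/-- If a family of vectors `v i ∈ W (w i)` spans, where the subspaces `W` are independent, then
`W β` is spanned by the `v i` with `w i = β`. -/
lemma eq_span_of_iSupIndep {ι X V : Type*} [AddCommGroup V] [Module ℂ V] {W : X → Submodule ℂ V}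
    (hW : iSupIndep W) (v : ι → V) (w : ι → X) (hv : ∀ i, v i ∈ W (w i))
    (hspan : Submodule.span ℂ (Set.range v) = ⊤) (β : X) :
    W β = Submodule.span ℂ (v '' {i | w i = β}) := by
  apply le_antisymm
  · intro x hx
    have h1 : Submodule.span ℂ (v '' {i | w i = β}) ⊔ Submodule.span ℂ (v '' {i | w i ≠ β}) = ⊤ := by
      rw [← Submodule.span_union, ← Set.image_union, ← hspan, ← Set.image_univ]
      congr 2
      ext i
      simp [em]
    obtain ⟨y, hy, z, hz, rfl⟩ := Submodule.mem_sup.mp (by rw [h1]; trivial : x ∈ _ ⊔ _)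
    have h2 : Submodule.span ℂ (v '' {i | w i = β}) ≤ W β := by
      rw [Submodule.span_le]
      rintro _ ⟨i, rfl, rfl⟩
      exact hv i
    have h3 : Submodule.span ℂ (v '' {i | w i ≠ β}) ≤ ⨆ γ, ⨆ (_ : γ ≠ β), W γ := by
      rw [Submodule.span_le]
      rintro _ ⟨i, hi, rfl⟩
      exact Submodule.mem_iSup_of_mem (w i) (Submodule.mem_iSup_of_mem hi (hv i))
    have h4 : z ∈ W β := by
      have := (W β).sub_mem hx (h2 hy)
      rwa [add_sub_cancel_left] at this
    rw [Submodule.disjoint_def.mp (hW β) z h4 (h3 hz), add_zero]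
    exact hy
  · rw [Submodule.span_le]
    rintro _ ⟨i, rfl, rfl⟩
    exact hv i

/-! ### The triangular decomposition -/

open LieSuperalgebra

namespace ChevalleyGens

variable {ℓ : ℕ} {H : Type u} [AddCommGroup H] [Module ℂ H]
  {A : Matrix (Fin ℓ) (Fin ℓ) ℂ} {p : Fin ℓ → ZMod 2} {α : Fin ℓ → Module.Dual ℂ H}
  {αv : Fin ℓ → H} {L : Type u} [AddCommGroup L] [Module ℂ L] [LieSuperalgebra L]
  (C : ChevalleyGens A p α αv L)

/-- The iterated bracket `[e_{j_1}, [e_{j_2}, …, [e_{j_r}, e_k]…]]`. -/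
def mon (l : List (Fin ℓ)) (k : Fin ℓ) : L := l.foldr (fun j y => br (C.e j) y) (C.e k)

lemma mon_cons (j : Fin ℓ) (l : List (Fin ℓ)) (k : Fin ℓ) :
    C.mon (j :: l) k = br (C.e j) (C.mon l k) := rfl

lemma mon_nil (k : Fin ℓ) : C.mon [] k = C.e k := rfl

/-- The degree of an iterated bracket, in the coordinates given by the simple roots. -/
def monDeg (l : List (Fin ℓ)) (k : Fin ℓ) : Fin ℓ →₀ ℕ :=
  l.foldr (fun j n => Finsupp.single j 1 + n) (Finsupp.single k 1)

lemma monDeg_cons (j : Fin ℓ) (l : List (Fin ℓ)) (k : Fin ℓ) :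
    monDeg (j :: l) k = Finsupp.single j 1 + monDeg l k := rfl

lemma monDeg_nil (k : Fin ℓ) : monDeg [] k = Finsupp.single k 1 := rfl

lemma t_mon (x : H) (l : List (Fin ℓ)) (k : Fin ℓ) :
    br (C.t x) (C.mon l k) = (∑ i, (monDeg l k i : ℂ) * α i x) • C.mon l k := by
  induction l with
  | nil =>
    rw [mon_nil, C.te, monDeg_nil, Finset.sum_eq_single k (fun i _ hi => by simp [hi.symm])
      (by simp)]
    simp
  | cons j l ih =>
    rw [mon_cons, C.t_jac, C.te, ih, map_smul, map_smul, LinearMap.smul_apply, ← add_smul,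
      monDeg_cons]
    have h : ∑ i, ((Finsupp.single j 1 : Fin ℓ →₀ ℕ) i : ℂ) * α i x = α j x := by
      rw [Finset.sum_eq_single j (fun i _ hi => by simp [hi.symm]) (by simp)]
      simp
    congr 1
    simp only [Finsupp.add_apply, Nat.cast_add, add_mul, Finset.sum_add_distrib, h]

lemma θ_mon (l : List (Fin ℓ)) (k : Fin ℓ) : ∃ i : ZMod 2, θ (C.mon l k) = sgn i • C.mon l k := by
  induction l with
  | nil => exact ⟨_, C.e_par k⟩
  | cons j l ih =>
    obtain ⟨i, hi⟩ := ih
    refine ⟨p j + i, ?_⟩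
    rw [mon_cons, θ_br, hi, C.e_par, map_smul, map_smul, LinearMap.smul_apply, smul_smul, sgn_add,
      mul_comm]

/-- The subspace spanned by the iterated brackets of the `e_i`. -/
def posPart : Submodule ℂ L := Submodule.span ℂ (Set.range fun q : List (Fin ℓ) × Fin ℓ =>
  C.mon q.1 q.2)

lemma mon_mem (l : List (Fin ℓ)) (k : Fin ℓ) : C.mon l k ∈ C.posPart :=
  Submodule.subset_span ⟨(l, k), rfl⟩

lemma e_posPart (j : Fin ℓ) (y : L) (hy : y ∈ C.posPart) : br (C.e j) y ∈ C.posPart := by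
  have : C.posPart ≤ C.posPart.comap (br (C.e j)) := by
    refine Submodule.span_le.mpr ?_
    rintro _ ⟨q, rfl⟩
    exact C.mon_mem (j :: q.1) q.2
  exact this hy

lemma t_posPart (x : H) (y : L) (hy : y ∈ C.posPart) : br (C.t x) y ∈ C.posPart := by
  have : C.posPart ≤ C.posPart.comap (br (C.t x)) := by
    refine Submodule.span_le.mpr ?_
    rintro _ ⟨q, rfl⟩
    rw [SetLike.mem_coe, Submodule.mem_comap, C.t_mon]
    exact Submodule.smul_mem _ _ (C.mon_mem _ _)
  exact this hy

lemma et (i : Fin ℓ) (x : H) : br (C.e i) (C.t x) = -(α i x • C.e i) := by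
  rw [skew _ _ _ _ (C.e_par i) (C.t_par' x), mul_zero, sgn_zero, one_smul, C.te]

lemma f_mon (j : Fin ℓ) (l : List (Fin ℓ)) (k : Fin ℓ) :
    br (C.f j) (C.mon l k) ∈ C.posPart ⊔ LinearMap.range C.t := by
  induction l with
  | nil =>
    rw [mon_nil]
    by_cases h : j = k
    · subst h
      rw [C.fe]
      exact Submodule.mem_sup_right (Submodule.neg_mem _ (Submodule.smul_mem _ _ ⟨_, rfl⟩))
    · rw [C.fe_ne j k h]; exact Submodule.zero_mem _
  | cons m l ih =>
    rw [mon_cons, jacobi _ _ _ _ _ (C.f_par j) (C.e_par m)]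
    refine Submodule.add_mem _ (Submodule.mem_sup_left ?_) (Submodule.smul_mem _ _ ?_)
    · by_cases h : j = m
      · subst h
        rw [C.fe, map_neg, map_smul, LinearMap.neg_apply, LinearMap.smul_apply]
        exact Submodule.neg_mem _ (Submodule.smul_mem _ _ (C.t_posPart _ _ (C.mon_mem _ _)))
      · rw [C.fe_ne j m h, map_zero]; exact Submodule.zero_mem _
    · obtain ⟨y, hy, _, ⟨x, rfl⟩, h⟩ := Submodule.mem_sup.mp ih
      rw [← h, map_add, C.et]
      refine Submodule.mem_sup_left (Submodule.add_mem _ (C.e_posPart m y hy)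
        (Submodule.neg_mem _ (Submodule.smul_mem _ _ (C.mon_mem [] m))))

lemma f_posPart (j : Fin ℓ) (y : L) (hy : y ∈ C.posPart) :
    br (C.f j) y ∈ C.posPart ⊔ LinearMap.range C.t := by
  have : C.posPart ≤ (C.posPart ⊔ LinearMap.range C.t).comap (br (C.f j)) := by
    refine Submodule.span_le.mpr ?_
    rintro _ ⟨q, rfl⟩
    exact C.f_mon j q.1 q.2
  exact this hy

lemma θ_posPart (y : L) (hy : y ∈ C.posPart) : (θ y : L) ∈ C.posPart := by
  have : C.posPart ≤ C.posPart.comap θ := by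
    refine Submodule.span_le.mpr ?_
    rintro _ ⟨q, rfl⟩
    obtain ⟨i, hi⟩ := C.θ_mon q.1 q.2
    rw [SetLike.mem_coe, Submodule.mem_comap, hi]
    exact Submodule.smul_mem _ _ (C.mon_mem _ _)
  exact this hy

/-- The triangular decomposition `𝔫⁺ + 𝔥 + 𝔫⁻`: the sum is stable under the adjoint action of all
generators, hence it is an ideal, and it contains the generators. -/
lemma posPart_sup_range_sup_negPart :
    C.posPart ⊔ LinearMap.range C.t ⊔ C.swap.posPart = ⊤ := by
  set T := C.posPart ⊔ LinearMap.range C.t ⊔ C.swap.posPart with hT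
  have hp : C.posPart ≤ T := le_sup_left.trans le_sup_left
  have ht : LinearMap.range C.t ≤ T := le_sup_right.trans le_sup_left
  have hn : C.swap.posPart ≤ T := le_sup_right
  have ind : ∀ d : L →ₗ[ℂ] L, (∀ y ∈ C.posPart, d y ∈ T) → (∀ x, d (C.t x) ∈ T) →
      (∀ y ∈ C.swap.posPart, d y ∈ T) → ∀ y ∈ T, d y ∈ T := by
    intro d h1 h2 h3 y hy
    have : T ≤ T.comap d := sup_le (sup_le h1 (by rintro _ ⟨x, rfl⟩; exact h2 x)) h3
    exact this hy
  have hθ : ∀ y ∈ T, (θ y : L) ∈ T := ind θ (fun y hy => hp (C.θ_posPart y hy))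
    (fun x => by rw [C.t_par]; exact ht ⟨x, rfl⟩) (fun y hy => hn (C.swap.θ_posPart y hy))
  have hfe : ∀ j, ∀ y ∈ T, br (C.e j) y ∈ T := fun j => ind _ (fun y hy => hp (C.e_posPart j y hy))
    (fun x => by
      rw [C.et]; exact T.neg_mem (T.smul_mem _ (hp (C.mon_mem [] j))))
    (fun y hy => by
      have h1 := C.swap.f_posPart j y hy
      have h2 : C.swap.posPart ⊔ LinearMap.range C.swap.t ≤ T := sup_le hn ht
      have h3 := T.smul_mem (sgn (p j)) (h2 h1)
      have h4 : C.swap.f j = sgn (p j) • C.e j := rfl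
      rwa [h4, map_smul, LinearMap.smul_apply, smul_smul, sgn_sq, one_smul] at h3)
  have hff : ∀ j, ∀ y ∈ T, br (C.f j) y ∈ T := fun j => ind _
    (fun y hy => (sup_le hp ht : C.posPart ⊔ LinearMap.range C.t ≤ T) (C.f_posPart j y hy))
    (fun x => by
      rw [C.ft]; exact T.smul_mem _ (hn (C.swap.mon_mem [] j)))
    (fun y hy => hn (C.swap.e_posPart j y hy))
  have htt : ∀ x, ∀ y ∈ T, br (C.t x) y ∈ T := fun x => ind _
    (fun y hy => hp (C.t_posPart x y hy)) (fun y => by rw [C.tt]; exact T.zero_mem)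
    (fun y hy => hn (C.swap.t_posPart x y hy))
  let S : Submodule ℂ L :=
    { carrier := {z | ∀ s ∈ T, br z s ∈ T}
      zero_mem' := fun s _ => by simp
      add_mem' := fun ha hb s hs => by
        rw [map_add, LinearMap.add_apply]; exact T.add_mem (ha s hs) (hb s hs)
      smul_mem' := fun c z hz s hs => by
        rw [map_smul, LinearMap.smul_apply]; exact T.smul_mem c (hz s hs) }
  have hS : S = ⊤ := C.generate S (fun a ha b hb => stabilizer_br T hθ a b ha hb) htt hfe hff
  exact C.generate T (fun x _ y hy => (hS ▸ trivial : x ∈ S) y hy) (fun x => ht ⟨x, rfl⟩)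
    (fun j => hp (C.mon_mem [] j)) (fun j => hn (C.swap.mon_mem [] j))

lemma commute_br_t (x y : H) : Commute (br (C.t x)) (br (C.t y)) := by
  refine LinearMap.ext fun z => ?_
  have := C.t_jac x (C.t y) z
  rw [C.tt, map_zero, LinearMap.zero_apply, zero_add] at this
  exact this

end ChevalleyGens

namespace CartanDatum

variable {ℓ : ℕ} {H : Type u} [AddCommGroup H] [Module ℂ H] (D : CartanDatum ℓ H)

lemma weight_apply (n : Fin ℓ →₀ ℕ) (x : H) : D.weight n x = ∑ i, (n i : ℂ) * D.root i x := by
  simp [weight, LinearMap.sum_apply]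

lemma weight_add (m n : Fin ℓ →₀ ℕ) : D.weight (m + n) = D.weight m + D.weight n := by
  simp [weight, add_smul, Finset.sum_add_distrib]

lemma weight_zero : D.weight 0 = 0 := by simp [weight]

lemma weight_single (i : Fin ℓ) : D.weight (Finsupp.single i 1) = D.root i := by
  rw [weight, Finset.sum_eq_single i (fun j _ hj => by simp [hj.symm]) (by simp)]
  simp

lemma eq_of_sum_smul_root_eq (c c' : Fin ℓ → ℂ)
    (h : ∑ i, c i • D.root i = ∑ i, c' i • D.root i) : c = c' := by
  have h1 := Fintype.linearIndependent_iff.mp D.root_linearIndependent (c - c') (by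
    simp only [Pi.sub_apply, sub_smul, Finset.sum_sub_distrib, h, sub_self])
  funext i
  exact sub_eq_zero.mp (h1 i)

lemma weight_injective : Function.Injective D.weight := by
  intro m n h
  ext i
  have := congrFun (D.eq_of_sum_smul_root_eq (fun i => (m i : ℂ)) (fun i => (n i : ℂ)) h) i
  exact_mod_cast this

lemma mem_rootSpace {β : Module.Dual ℂ H} {x : D.Alg} :
    x ∈ D.rootSpace β ↔ ∀ h, br (D.algH h) x = β h • x := by
  simp [rootSpace]

lemma iSupIndep_rootSpace : iSupIndep D.rootSpace :=
  (iSupIndep_iInf_eigenspace (fun h : H => br (D.algH h)) fun x y => D.algGens.commute_br_t x y).comp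
    (f := fun β : Module.Dual ℂ H => (β : H → ℂ)) DFunLike.coe_injective

/-- The spanning family of root vectors given by the triangular decomposition. -/
def rootVec : (List (Fin ℓ) × Fin ℓ) ⊕ H ⊕ (List (Fin ℓ) × Fin ℓ) → D.Alg
  | .inl q => D.algGens.mon q.1 q.2
  | .inr (.inl x) => D.algH x
  | .inr (.inr q) => D.algGens.swap.mon q.1 q.2

/-- The weights of the vectors `rootVec`. -/
def rootVecWeight : (List (Fin ℓ) × Fin ℓ) ⊕ H ⊕ (List (Fin ℓ) × Fin ℓ) → Module.Dual ℂ H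
  | .inl q => D.weight (ChevalleyGens.monDeg q.1 q.2)
  | .inr (.inl _) => 0
  | .inr (.inr q) => -D.weight (ChevalleyGens.monDeg q.1 q.2)

lemma mon_mem_rootSpace (l : List (Fin ℓ)) (k : Fin ℓ) :
    D.algGens.mon l k ∈ D.rootSpace (D.weight (ChevalleyGens.monDeg l k)) := by
  rw [mem_rootSpace]
  intro x
  rw [weight_apply]
  exact D.algGens.t_mon x l k

lemma rootVec_mem (q) : D.rootVec q ∈ D.rootSpace (D.rootVecWeight q) := by
  rcases q with q | x | q
  · exact D.mon_mem_rootSpace q.1 q.2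
  · rw [mem_rootSpace]
    intro y
    rw [rootVecWeight, LinearMap.zero_apply, zero_smul]
    exact D.algGens.tt y x
  · rw [mem_rootSpace]
    intro y
    refine (D.algGens.swap.t_mon y q.1 q.2).trans ?_
    rw [rootVecWeight, LinearMap.neg_apply, weight_apply, ← Finset.sum_neg_distrib]
    congr 1
    exact Finset.sum_congr rfl fun i _ => mul_neg _ _

lemma span_rootVec : Submodule.span ℂ (Set.range D.rootVec) = ⊤ := by
  rw [eq_top_iff, ← D.algGens.posPart_sup_range_sup_negPart]
  refine sup_le (sup_le ?_ ?_) ?_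
  · exact Submodule.span_mono (by rintro _ ⟨q, rfl⟩; exact ⟨.inl q, rfl⟩)
  · rintro _ ⟨x, rfl⟩
    exact Submodule.subset_span ⟨.inr (.inl x), rfl⟩
  · exact Submodule.span_mono (by rintro _ ⟨q, rfl⟩; exact ⟨.inr (.inr q), rfl⟩)

lemma weight_ne_neg_weight {m n : Fin ℓ →₀ ℕ} (hn : n ≠ 0) : D.weight n ≠ -D.weight m := by
  intro h
  rw [← add_eq_zero_iff_eq_neg, ← weight_add, ← weight_zero] at h
  have := D.weight_injective h
  exact hn (by ext i; have := DFunLike.congr_fun this i; simp at this ⊢; omega)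

/-- A positive root space is spanned by the iterated brackets of the right degree. -/
lemma rootSpace_weight {n : Fin ℓ →₀ ℕ} (hn : n ≠ 0) : D.rootSpace (D.weight n) =
    Submodule.span ℂ ((fun q : List (Fin ℓ) × Fin ℓ => D.algGens.mon q.1 q.2) ''
      {q | ChevalleyGens.monDeg q.1 q.2 = n}) := by
  rw [eq_span_of_iSupIndep D.iSupIndep_rootSpace D.rootVec D.rootVecWeight D.rootVec_mem
    D.span_rootVec]
  congr 1
  ext x
  constructor
  · rintro ⟨q | y | q, hq, rfl⟩
    · exact ⟨q, D.weight_injective hq, rfl⟩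
    · exact absurd (D.weight_injective (D.weight_zero.trans hq)) hn.symm
    · exact absurd hq.symm (D.weight_ne_neg_weight hn)
  · rintro ⟨q, hq, rfl⟩
    exact ⟨.inl q, congrArg D.weight hq, rfl⟩

lemma exists_of_rootSpace_ne_bot {β : Module.Dual ℂ H} (h : D.rootSpace β ≠ ⊥) :
    ∃ n, β = D.weight n ∨ β = -D.weight n := by
  by_contra! hne
  refine h ?_
  rw [eq_span_of_iSupIndep D.iSupIndep_rootSpace D.rootVec D.rootVecWeight D.rootVec_mem
    D.span_rootVec, Submodule.span_eq_bot]
  rintro _ ⟨q | y | q, hq, rfl⟩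
  · exact absurd hq.symm (hne _).1
  · exact absurd (hq.symm.trans D.weight_zero.symm) (hne 0).1
  · exact absurd hq.symm (hne _).2

lemma nPlus_le : D.nPlus ≤ D.algGens.posPart := by
  refine iSup₂_le fun n hn => ?_
  rw [D.rootSpace_weight hn]
  exact Submodule.span_mono (by rintro _ ⟨q, -, rfl⟩; exact ⟨q, rfl⟩)

lemma algE_mem_nPlus (i : Fin ℓ) : D.algE i ∈ D.nPlus :=
  Submodule.mem_iSup_of_mem (Finsupp.single i 1) (Submodule.mem_iSup_of_mem (by simp)
    (D.mon_mem_rootSpace [] i))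

end CartanDatum


/-! ### The enveloping algebra and its `𝔰𝔩₂`-triple -/

open LieSuperalgebra
open scoped ModuleCat

section Env

variable {L : Type u} [AddCommGroup L] [Module ℂ L] [LieSuperalgebra L]

namespace Env

lemma ι_mul_ι {i j : ZMod 2} {x y : L} (hx : θ x = sgn i • x) (hy : θ y = sgn j • y) :
    ι x * ι y = sgn (i * j) • (ι y * ι x) + ι (br x y) := by
  have := mk_rel (.bracket i j x y hx hy)
  rwa [map_mul, map_add, map_smul, map_mul] at this

lemma σ_mul_σ : (σ : Env L) * σ = 1 := by
  have := mk_rel (L := L) .parity_sq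
  rwa [map_mul, map_one] at this

lemma σ_mul_ι (x : L) : (σ : Env L) * ι x = ι (θ x) * σ := by
  have := mk_rel (.parity_mul x)
  rwa [map_mul, map_mul] at this

lemma adOp_σ {x : L} (hx : θ x = x) : adOp (ι x) (σ : Env L) = 0 := by
  rw [adOp_apply, σ_mul_ι, hx, sub_self]

/-- The algebra `U(L) ⋊ ℤ/2` is generated by `σ` and by generators of `L`. -/
lemma subalgebra_eq_top {ℓ : ℕ} {H : Type u} [AddCommGroup H] [Module ℂ H]
    {A : Matrix (Fin ℓ) (Fin ℓ) ℂ} {p : Fin ℓ → ZMod 2} {α : Fin ℓ → Module.Dual ℂ H}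
    {αv : Fin ℓ → H} (C : ChevalleyGens A p α αv L) (B : Subalgebra ℂ (Env L)) (hσ : σ ∈ B)
    (ht : ∀ x, ι (C.t x) ∈ B) (he : ∀ j, ι (C.e j) ∈ B) (hf : ∀ j, ι (C.f j) ∈ B) : B = ⊤ := by
  let S : Submodule ℂ L := (Subalgebra.toSubmodule B).comap ι
  have hθ : ∀ x ∈ S, (θ x : L) ∈ S := fun x hx => by
    have h1 : ι (θ x) = σ * ι x * (σ : Env L) := by rw [σ_mul_ι, mul_assoc, σ_mul_σ, mul_one]
    change ι (θ x) ∈ B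
    rw [h1]
    exact B.mul_mem (B.mul_mem hσ hx) hσ
  have hS : S = ⊤ := C.generate S (fun x hx y hy => by
    refine br_mem_of_hom S S S hθ hθ (fun i j x y hx hy h1 h2 => ?_) x y hx hy
    change ι (br x y) ∈ B
    rw [eq_sub_of_add_eq' (ι_mul_ι h1 h2).symm]
    exact B.sub_mem (B.mul_mem hx hy) (B.smul_mem (B.mul_mem hy hx) _)) ht he hf
  refine eq_top_iff.mpr fun u hu => ?_
  clear hu
  obtain ⟨w, rfl⟩ := RingQuot.mkAlgHom_surjective ℂ (EnvRel L) u
  change Env.mk L w ∈ B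
  induction w using FreeAlgebra.induction with
  | grade0 r => rw [AlgHom.commutes]; exact B.algebraMap_mem r
  | grade1 z =>
    rcases z with _ | y
    · exact hσ
    · exact (hS ▸ trivial : y ∈ S)
  | mul a b ha hb => rw [map_mul]; exact B.mul_mem ha hb
  | add a b ha hb => rw [map_add]; exact B.add_mem ha hb

variable {N : Type*} [AddCommGroup N] [Module (Env L) N] [Module ℂ N] [IsScalarTower ℂ (Env L) N]

lemma smul_mem_of_stable {ℓ : ℕ} {H : Type u} [AddCommGroup H] [Module ℂ H]
    {A : Matrix (Fin ℓ) (Fin ℓ) ℂ} {p : Fin ℓ → ZMod 2} {α : Fin ℓ → Module.Dual ℂ H}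
    {αv : Fin ℓ → H} (C : ChevalleyGens A p α αv L) (P : Submodule ℂ N)
    (hσ : ∀ v ∈ P, (σ : Env L) • v ∈ P) (ht : ∀ x, ∀ v ∈ P, ι (C.t x) • v ∈ P)
    (he : ∀ j, ∀ v ∈ P, ι (C.e j) • v ∈ P) (hf : ∀ j, ∀ v ∈ P, ι (C.f j) • v ∈ P)
    (u : Env L) (v : N) (hv : v ∈ P) : u • v ∈ P := by
  let B : Subalgebra ℂ (Env L) :=
    { carrier := {u | ∀ v ∈ P, u • v ∈ P}
      mul_mem' := fun ha hb v hv => by rw [mul_smul]; exact ha _ (hb v hv)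
      add_mem' := fun ha hb v hv => by rw [add_smul]; exact P.add_mem (ha v hv) (hb v hv)
      algebraMap_mem' := fun c v hv => by rw [algebraMap_smul]; exact P.smul_mem c hv }
  have hB : B = ⊤ := subalgebra_eq_top C B hσ ht he hf
  exact (hB ▸ trivial : u ∈ B) v hv

lemma posPart_smul_eq_zero {ℓ : ℕ} {H : Type u} [AddCommGroup H] [Module ℂ H]
    {A : Matrix (Fin ℓ) (Fin ℓ) ℂ} {p : Fin ℓ → ZMod 2} {α : Fin ℓ → Module.Dual ℂ H}
    {αv : Fin ℓ → H} (C : ChevalleyGens A p α αv L) {v : N} (hv : ∀ j, ι (C.e j) • v = 0)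
    {x : L} (hx : x ∈ C.posPart) : ι x • v = 0 := by
  have hmon : ∀ (l : List (Fin ℓ)) (k : Fin ℓ), ι (C.mon l k) • v = 0 := by
    intro l k
    induction l with
    | nil => exact hv k
    | cons j l ih =>
      obtain ⟨i, hi⟩ := C.θ_mon l k
      rw [C.mon_cons, eq_sub_of_add_eq' (ι_mul_ι (C.e_par j) hi).symm, sub_smul, mul_smul,
        smul_assoc, mul_smul, ih, hv, smul_zero, smul_zero, smul_zero, sub_zero]
  have : C.posPart ≤ LinearMap.ker ((LinearMap.toSpanSingleton (Env L) N v).restrictScalars ℂ ∘ₗ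
      (ι : L →ₗ[ℂ] Env L)) := by
    refine Submodule.span_le.mpr ?_
    rintro _ ⟨q, rfl⟩
    exact hmon q.1 q.2
  exact this hx

end Env

end Env

namespace ChevalleyGens

variable {ℓ : ℕ} {H : Type u} [AddCommGroup H] [Module ℂ H]
  {A : Matrix (Fin ℓ) (Fin ℓ) ℂ} {p : Fin ℓ → ZMod 2} {α : Fin ℓ → Module.Dual ℂ H}
  {αv : Fin ℓ → H} {L : Type u} [AddCommGroup L] [Module ℂ L] [LieSuperalgebra L]
  (C : ChevalleyGens A p α αv L)

lemma e_ff {i : Fin ℓ} (hi : A i i = 2) (hp : p i = 1) :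
    br (C.e i) (br (C.f i) (C.f i)) = -((4 : ℂ) • C.f i) := by
  rw [C.e_step, C.ef, C.tf, C.pairing, hi, C.ft, C.pairing, hi, hp, mul_one, sgn_one]
  module

lemma ee_apply {i : Fin ℓ} (hp : p i = 1) (y : L) :
    br (br (C.e i) (C.e i)) y = (2 : ℂ) • br (C.e i) (br (C.e i) y) := by
  have hj := jacobi _ _ (C.e i) (C.e i) y (C.e_par i) (C.e_par i)
  rw [hp, mul_one, sgn_one, neg_one_smul] at hj
  linear_combination (norm := module) -hj

lemma e_ff_ne {i j : Fin ℓ} (hij : j ≠ i) : br (C.e j) (br (C.f i) (C.f i)) = 0 := by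
  rw [C.e_step, C.ef_ne j i hij, map_zero, map_zero, LinearMap.zero_apply, smul_zero, add_zero]

end ChevalleyGens

namespace CartanDatum

variable {ℓ : ℕ} {H : Type u} [AddCommGroup H] [Module ℂ H] (D : CartanDatum ℓ H) {i : Fin ℓ}

lemma parity_cases (i : Fin ℓ) : D.p i = 0 ∨ D.p i = 1 := by
  have h01 : ∀ k : ZMod 2, k = 0 ∨ k = 1 := by decide
  exact h01 _

lemma θ_algE (i : Fin ℓ) : θ (D.algE i) = sgn (D.p i) • D.algE i := D.algGens.e_par i

lemma θ_algF (i : Fin ℓ) : θ (D.algF i) = sgn (D.p i) • D.algF i := D.algGens.f_par i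

lemma θ_algH (x : H) : θ (D.algH x) = sgn 0 • D.algH x := D.algGens.t_par' x

lemma θ_sl2E (i : Fin ℓ) : θ (D.sl2E i) = D.sl2E i :=
  ChevalleyGens.evenElt_par _ _ _ (D.algGens.e_par i)

lemma θ_sl2F (i : Fin ℓ) : θ (D.sl2F i) = D.sl2F i :=
  ChevalleyGens.evenElt_par _ _ _ (D.algGens.f_par i)

lemma sl2E_even (h : D.p i = 0) : D.sl2E i = D.algE i := if_pos h

lemma sl2F_even (h : D.p i = 0) : D.sl2F i = D.algF i := if_pos h

lemma sl2E_odd (h : D.p i = 1) : D.sl2E i = (4 : ℂ)⁻¹ • br (D.algE i) (D.algE i) :=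
  if_neg (by rw [h]; exact one_ne_zero)

lemma sl2F_odd (h : D.p i = 1) : D.sl2F i = -(4 : ℂ)⁻¹ • br (D.algF i) (D.algF i) :=
  if_neg (by rw [h]; exact one_ne_zero)

lemma evenRoot_even (h : D.p i = 0) : D.evenRoot i = D.root i := if_pos h

lemma evenRoot_odd (h : D.p i = 1) : D.evenRoot i = (2 : ℂ) • D.root i :=
  if_neg (by rw [h]; exact one_ne_zero)

lemma evenCoroot_even (h : D.p i = 0) : D.evenCoroot i = D.coroot i := if_pos h

lemma evenCoroot_odd (h : D.p i = 1) : D.evenCoroot i = (2 : ℂ)⁻¹ • D.coroot i :=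
  if_neg (by rw [h]; exact one_ne_zero)

lemma root_coroot_self (hi : D.A i i = 2) : D.root i (D.coroot i) = 2 := by
  rw [D.root_coroot, hi]

lemma evenRoot_evenCoroot (hi : D.A i i = 2) : D.evenRoot i (D.evenCoroot i) = 2 := by
  rcases D.parity_cases i with h | h
  · rw [D.evenRoot_even h, D.evenCoroot_even h, D.root_coroot_self hi]
  · rw [D.evenRoot_odd h, D.evenCoroot_odd h, LinearMap.smul_apply, map_smul,
      D.root_coroot_self hi]
    norm_num

lemma exists_root_evenCoroot (hi : D.A i i = 2) (j : Fin ℓ) :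
    ∃ n : ℤ, D.root j (D.evenCoroot i) = n := by
  rcases D.parity_cases i with h | h
  · rw [D.evenCoroot_even h, D.root_coroot]
    rcases eq_or_ne j i with rfl | hj
    · exact ⟨2, by rw [hi]; norm_num⟩
    · obtain ⟨n, hn, -⟩ := D.entry i j hj hi
      exact ⟨-n, by rw [hn]; push_cast; ring⟩
  · rw [D.evenCoroot_odd h, map_smul, D.root_coroot]
    rcases eq_or_ne j i with rfl | hj
    · exact ⟨1, by rw [hi]; norm_num⟩
    · obtain ⟨n, hn, hpar, -⟩ := D.entry i j hj hi
      obtain ⟨m, rfl⟩ := hpar h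
      exact ⟨-m, by rw [hn, smul_eq_mul]; push_cast; ring⟩

lemma br_algH_sl2E (x : H) : br (D.algH x) (D.sl2E i) = D.evenRoot i x • D.sl2E i := by
  rcases D.parity_cases i with h | h
  · rw [D.sl2E_even h, D.evenRoot_even h]
    exact D.algGens.te x i
  · have h1 : br (D.algH x) (br (D.algE i) (D.algE i)) =
        (2 * D.root i x) • br (D.algE i) (D.algE i) := by
      refine (D.algGens.t_jac x _ _).trans ?_
      have h2 : br (D.algH x) (D.algE i) = D.root i x • D.algE i := D.algGens.te x i
      change br (br (D.algH x) (D.algE i)) (D.algE i) + br (D.algE i) (br (D.algH x) (D.algE i)) = _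
      rw [h2, map_smul, map_smul, LinearMap.smul_apply]
      module
    rw [D.sl2E_odd h, D.evenRoot_odd h, map_smul, h1, LinearMap.smul_apply, smul_eq_mul,
      smul_comm]

lemma br_algH_sl2F (x : H) : br (D.algH x) (D.sl2F i) = -(D.evenRoot i x • D.sl2F i) := by
  rcases D.parity_cases i with h | h
  · rw [D.sl2F_even h, D.evenRoot_even h]
    exact D.algGens.tf x i
  · have h1 : br (D.algH x) (br (D.algF i) (D.algF i)) =
        -((2 * D.root i x) • br (D.algF i) (D.algF i)) := by
      refine (D.algGens.t_jac x _ _).trans ?_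
      have h2 : br (D.algH x) (D.algF i) = -(D.root i x • D.algF i) := D.algGens.tf x i
      change br (br (D.algH x) (D.algF i)) (D.algF i) + br (D.algF i) (br (D.algH x) (D.algF i)) = _
      rw [h2, map_neg, map_neg, map_smul, map_smul, LinearMap.neg_apply, LinearMap.smul_apply]
      module
    rw [D.sl2F_odd h, D.evenRoot_odd h, map_smul, h1, LinearMap.smul_apply, smul_eq_mul,
      smul_neg, smul_comm]

lemma br_algE_sl2F (hi : D.A i i = 2) (h : D.p i = 1) : br (D.algE i) (D.sl2F i) = D.algF i := by
  have h1 : br (D.algE i) (br (D.algF i) (D.algF i)) = -((4 : ℂ) • D.algF i) :=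
    D.algGens.e_ff hi h
  rw [D.sl2F_odd h, map_smul, h1]
  module

lemma br_sl2F_algE (hi : D.A i i = 2) (h : D.p i = 1) :
    br (D.sl2F i) (D.algE i) = -D.algF i := by
  rw [skew 0 _ _ _ (by rw [D.θ_sl2F, sgn_zero, one_smul]) (D.θ_algE i), zero_mul, sgn_zero,
    one_smul]
  exact congrArg _ (D.br_algE_sl2F hi h)

lemma br_sl2F_algE_ne {j : Fin ℓ} (hj : j ≠ i) : br (D.sl2F i) (D.algE j) = 0 := by
  rw [skew 0 _ _ _ (by rw [D.θ_sl2F, sgn_zero, one_smul]) (D.θ_algE j), zero_mul, sgn_zero,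
    one_smul, neg_eq_zero]
  rcases D.parity_cases i with h | h
  · rw [D.sl2F_even h]
    exact D.algGens.ef_ne j i hj
  · rw [D.sl2F_odd h, map_smul]
    have : br (D.algE j) (br (D.algF i) (D.algF i)) = 0 := D.algGens.e_ff_ne hj
    exact (congrArg _ this).trans (smul_zero _)

lemma br_sl2F_algF : br (D.sl2F i) (D.algF i) = 0 := by
  rcases D.parity_cases i with h | h
  · rw [D.sl2F_even h]
    exact D.algGens.ff_even i h
  · rw [skew 0 _ _ _ (by rw [D.θ_sl2F, sgn_zero, one_smul]) (D.θ_algF i), zero_mul,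
      sgn_zero, one_smul, neg_eq_zero, D.sl2F_odd h, map_smul]
    have : br (D.algF i) (br (D.algF i) (D.algF i)) = 0 :=
      ChevalleyGens.br_self _ _ (D.algGens.f_par i)
    exact (congrArg _ this).trans (smul_zero _)

lemma br_sl2E_sl2F (hi : D.A i i = 2) : br (D.sl2E i) (D.sl2F i) = D.algH (D.evenCoroot i) := by
  rcases D.parity_cases i with h | h
  · rw [D.sl2E_even h, D.sl2F_even h, D.evenCoroot_even h]
    exact D.algGens.ef i
  · have h1 : br (br (D.algE i) (D.algE i)) (D.sl2F i) =
        (2 : ℂ) • br (D.algE i) (br (D.algE i) (D.sl2F i)) := D.algGens.ee_apply h _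
    have h2 : br (D.algE i) (D.algF i) = D.algH (D.coroot i) := D.algGens.ef i
    rw [D.sl2E_odd h, D.evenCoroot_odd h, map_smul, LinearMap.smul_apply, h1,
      D.br_algE_sl2F hi h, h2, map_smul, smul_smul]
    norm_num

/-- The element `e` of the enveloping algebra. -/
abbrev envE (i : Fin ℓ) : Env D.Alg := Env.ι (D.sl2E i)

/-- The element `f` of the enveloping algebra. -/
abbrev envF (i : Fin ℓ) : Env D.Alg := Env.ι (D.sl2F i)

/-- The element `h = α^∨` of the enveloping algebra. -/
abbrev envH (i : Fin ℓ) : Env D.Alg := Env.ι (D.algH (D.evenCoroot i))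

lemma adOp_envF_algH (x : H) :
    adOp (D.envF i) (Env.ι (D.algH x)) = D.evenRoot i x • D.envF i := by
  rw [Env.adOp_ι _ _ (D.θ_sl2F i), skew 0 0 _ _ (by rw [D.θ_sl2F, sgn_zero, one_smul])
    (D.θ_algH x), zero_mul, sgn_zero, one_smul]
  rw [D.br_algH_sl2F, neg_neg, map_smul]

lemma isSl2 (hi : D.A i i = 2) : IsSl2 (D.envE i) (D.envF i) (D.envH i) where
  ef := by
    have := Env.adOp_ι (D.sl2E i) (D.sl2F i) (D.θ_sl2E i)
    rwa [D.br_sl2E_sl2F hi] at this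
  he := by
    have := Env.adOp_ι (D.algH (D.evenCoroot i)) (D.sl2E i) (D.algGens.t_par _)
    rw [D.br_algH_sl2E, D.evenRoot_evenCoroot hi, map_smul, two_smul] at this
    rw [two_mul]
    exact this
  hf := by
    have := Env.adOp_ι (D.algH (D.evenCoroot i)) (D.sl2F i) (D.algGens.t_par _)
    rw [D.br_algH_sl2F, D.evenRoot_evenCoroot hi, map_neg, map_smul, two_smul] at this
    rw [two_mul]
    exact this

lemma envF_odd (h : D.p i = 1) :
    D.envF i = -(2 : ℂ)⁻¹ • (Env.ι (D.algF i) * Env.ι (D.algF i)) := by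
  have h1 := Env.ι_mul_ι (D.θ_algF i) (D.θ_algF i)
  rw [h, mul_one, sgn_one, neg_one_smul] at h1
  have h2 : Env.ι (br (D.algF i) (D.algF i)) =
      (2 : ℂ) • (Env.ι (D.algF i) * Env.ι (D.algF i)) := by
    linear_combination (norm := module) -h1
  rw [envF, D.sl2F_odd h, map_smul, h2, smul_smul]
  norm_num

lemma envE_odd (h : D.p i = 1) :
    D.envE i = (2 : ℂ)⁻¹ • (Env.ι (D.algE i) * Env.ι (D.algE i)) := by
  have h1 := Env.ι_mul_ι (D.θ_algE i) (D.θ_algE i)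
  rw [h, mul_one, sgn_one, neg_one_smul] at h1
  have h2 : Env.ι (br (D.algE i) (D.algE i)) =
      (2 : ℂ) • (Env.ι (D.algE i) * Env.ι (D.algE i)) := by
    linear_combination (norm := module) -h1
  rw [envE, D.sl2E_odd h, map_smul, h2, smul_smul]
  norm_num

end CartanDatum


/-! ### Weight modules -/

open LieSuperalgebra
open scoped ModuleCat

/-- The components of a vector of a subspace stable under commuting operators, in its decomposition
into simultaneous eigenvectors, belong to the subspace. -/
lemma mem_of_sum_mem_of_stable {X ι V : Type*} [AddCommGroup V] [Module ℂ V]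
    (T : ι → Module.End ℂ V) (hT : ∀ i j, Commute (T i) (T j)) (χ : X → ι → ℂ)
    (hχ : Function.Injective χ) (P : Submodule ℂ V) (hP : ∀ i, ∀ v ∈ P, T i v ∈ P)
    (s : Finset X) (w : X → V) (hw : ∀ x ∈ s, ∀ i, T i (w x) = χ x i • w x)
    (hs : ∑ x ∈ s, w x ∈ P) : ∀ x ∈ s, w x ∈ P := by
  let T' : ι → Module.End ℂ (V ⧸ P) := fun i => P.mapQ P (T i) (hP i)
  have hT' : ∀ i j, Commute (T' i) (T' j) := fun i j => by
    refine LinearMap.ext fun y => ?_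
    obtain ⟨y, rfl⟩ := P.mkQ_surjective y
    exact congrArg P.mkQ (LinearMap.congr_fun (hT i j) y)
  refine mem_of_sum_mem P _ ((iSupIndep_iInf_eigenspace T' hT').comp hχ) s w (fun x hx => ?_) hs
  simp only [Function.comp_apply, Submodule.mem_iInf, Module.End.mem_eigenspace_iff]
  intro i
  exact (congrArg P.mkQ (hw x hx i)).trans (map_smul _ _ _)

namespace CartanDatum

variable {ℓ : ℕ} {H : Type u} [AddCommGroup H] [Module ℂ H] (D : CartanDatum ℓ H) {i : Fin ℓ}

section

variable {N N' : D.Mod} {ν : Module.Dual ℂ H} {v : N}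

lemma mem_weightSpace : v ∈ D.weightSpace N ν ↔ ∀ x, Env.ι (D.algH x) • v = ν x • v := by
  simp [weightSpace]

lemma commute_lsmul_algH (x y : H) : Commute (Algebra.lsmul ℂ ℂ N (Env.ι (D.algH x)))
    (Algebra.lsmul ℂ ℂ N (Env.ι (D.algH y))) := by
  have h1 : Commute (Env.ι (D.algH x)) (Env.ι (D.algH y)) := by
    have h2 := Env.adOp_ι (D.algH x) (D.algH y) (D.algGens.t_par x)
    have h3 : br (D.algH x) (D.algH y) = 0 := D.algGens.tt x y
    rw [h3, map_zero, adOp_apply] at h2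
    exact sub_eq_zero.mp h2
  exact h1.map (Algebra.lsmul ℂ ℂ N)

lemma iSupIndep_weightSpace (N : D.Mod) : iSupIndep (D.weightSpace N) :=
  (iSupIndep_iInf_eigenspace (fun x : H => (Algebra.lsmul ℂ ℂ N (Env.ι (D.algH x)) :
    Module.End ℂ N)) fun x y => D.commute_lsmul_algH x y).comp
    (f := fun β : Module.Dual ℂ H => (β : H → ℂ)) DFunLike.coe_injective

lemma ι_smul_mem_weightSpace {β : Module.Dual ℂ H} {x : D.Alg}
    (hx : ∀ y, br (D.algH y) x = β y • x) (hv : v ∈ D.weightSpace N ν) :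
    Env.ι x • v ∈ D.weightSpace N (ν + β) := by
  rw [mem_weightSpace] at *
  intro y
  have h := Env.adOp_ι (D.algH y) x (D.algGens.t_par y)
  rw [hx, map_smul, adOp_apply] at h
  rw [← mul_smul, eq_add_of_sub_eq' h, add_smul, mul_smul, hv, smul_comm, smul_assoc,
    LinearMap.add_apply, add_smul]

lemma algE_smul_mem (j : Fin ℓ) (hv : v ∈ D.weightSpace N ν) :
    Env.ι (D.algE j) • v ∈ D.weightSpace N (ν + D.root j) :=
  D.ι_smul_mem_weightSpace (fun y => D.algGens.te y j) hv

lemma algF_smul_mem (j : Fin ℓ) (hv : v ∈ D.weightSpace N ν) :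
    Env.ι (D.algF j) • v ∈ D.weightSpace N (ν - D.root j) := by
  rw [sub_eq_add_neg]
  exact D.ι_smul_mem_weightSpace (fun y => (D.algGens.tf y j).trans (by
    rw [LinearMap.neg_apply, neg_smul]; rfl)) hv

lemma envE_smul_mem (hv : v ∈ D.weightSpace N ν) :
    D.envE i • v ∈ D.weightSpace N (ν + D.evenRoot i) :=
  D.ι_smul_mem_weightSpace (fun y => D.br_algH_sl2E y) hv

lemma envF_smul_mem (hv : v ∈ D.weightSpace N ν) :
    D.envF i • v ∈ D.weightSpace N (ν - D.evenRoot i) := by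
  rw [sub_eq_add_neg]
  exact D.ι_smul_mem_weightSpace (fun y => (D.br_algH_sl2F y).trans (by
    rw [LinearMap.neg_apply, neg_smul])) hv

lemma envE_pow_smul_mem (hv : v ∈ D.weightSpace N ν) (n : ℕ) :
    D.envE i ^ n • v ∈ D.weightSpace N (ν + n • D.evenRoot i) := by
  induction n with
  | zero => simpa using hv
  | succ n ih =>
    rw [pow_succ', mul_smul, succ_nsmul, ← add_assoc]
    exact D.envE_smul_mem ih

lemma σ_smul_mem (hv : v ∈ D.weightSpace N ν) : (Env.σ : Env D.Alg) • v ∈ D.weightSpace N ν := by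
  rw [mem_weightSpace] at *
  intro y
  have h := Env.σ_mul_ι (D.algH y)
  have h2 : θ (D.algH y) = D.algH y := D.algGens.t_par y
  rw [h2] at h
  rw [← mul_smul, ← h, mul_smul, hv, smul_comm]

lemma map_mem_weightSpace (g : N →ₗ[Env D.Alg] N') (hv : v ∈ D.weightSpace N ν) :
    g v ∈ D.weightSpace N' ν := by
  rw [mem_weightSpace] at *
  intro y
  rw [← map_smul, hv]
  exact (g.restrictScalars ℂ).map_smul _ _

lemma exists_sum_of_mem_iSup (hv : v ∈ ⨆ ν, D.weightSpace N ν) :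
    ∃ (s : Finset (Module.Dual ℂ H)) (w : Module.Dual ℂ H → N),
      (∀ ν ∈ s, w ν ∈ D.weightSpace N ν) ∧ v = ∑ ν ∈ s, w ν := by
  obtain ⟨f, hf, rfl⟩ := (Submodule.mem_iSup_iff_exists_finsupp _ _).mp hv
  exact ⟨f.support, f, fun ν _ => hf ν, rfl⟩

lemma comp_mem_of_sum_mem_submodule (P : Submodule (Env D.Alg) N) (s : Finset (Module.Dual ℂ H))
    (w : Module.Dual ℂ H → N) (hw : ∀ ν ∈ s, w ν ∈ D.weightSpace N ν) (hs : ∑ ν ∈ s, w ν ∈ P) :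
    ∀ ν ∈ s, w ν ∈ P :=
  mem_of_sum_mem_of_stable (fun x : H => (Algebra.lsmul ℂ ℂ N (Env.ι (D.algH x)) :
    Module.End ℂ N)) (fun x y => D.commute_lsmul_algH x y) (fun β : Module.Dual ℂ H => (β : H → ℂ))
    DFunLike.coe_injective (P.restrictScalars ℂ) (fun _ _ hv => P.smul_mem _ hv) s w
    (fun ν hν x => D.mem_weightSpace.mp (hw ν hν) x) hs

lemma iSup_weightSpace_submodule (hN : ⨆ ν, D.weightSpace N ν = ⊤) (P : Submodule (Env D.Alg) N) :
    ⨆ ν, D.weightSpace (ModuleCat.of (Env D.Alg) P) ν = ⊤ := by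
  classical
  refine eq_top_iff.mpr fun z _ => ?_
  obtain ⟨s, w, hw, hz⟩ := D.exists_sum_of_mem_iSup (N := N) (v := Subtype.val (p := (· ∈ P)) z)
    (by rw [hN]; trivial)
  have hP := D.comp_mem_of_sum_mem_submodule P s w hw (hz ▸ z.2)
  let w' : Module.Dual ℂ H → P := fun ν => if hν : ν ∈ s then ⟨w ν, hP ν hν⟩ else 0
  have h1 : z = ∑ ν ∈ s, w' ν := by
    refine Subtype.ext ?_
    rw [hz, Submodule.coe_sum]
    exact Finset.sum_congr rfl fun ν hν => by simp only [w', dif_pos hν]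
  rw [h1]
  refine Submodule.sum_mem _ fun ν hν => Submodule.mem_iSup_of_mem ν ?_
  rw [mem_weightSpace]
  intro x
  refine Subtype.ext ?_
  have := D.mem_weightSpace.mp (hw ν hν) x
  simp only [w', dif_pos hν]
  exact this

end

/-! ### Heights and local nilpotence -/

/-- An element of `𝔥` on which all simple roots take the value `1`. -/
def gradElt : H :=
  haveI := D.finiteDimensional
  (ChevalleyGens.exists_grading_element D.root_linearIndependent).choose

lemma root_gradElt (j : Fin ℓ) : D.root j D.gradElt = 1 :=
  haveI := D.finiteDimensional
  (ChevalleyGens.exists_grading_element D.root_linearIndependent).choose_spec j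

/-- The height of a weight. -/
def height (ν : Module.Dual ℂ H) : ℝ := (ν D.gradElt).re

lemma height_add (μ ν : Module.Dual ℂ H) : D.height (μ + ν) = D.height μ + D.height ν := by
  simp [height]

lemma height_sub (μ ν : Module.Dual ℂ H) : D.height (μ - ν) = D.height μ - D.height ν := by
  simp [height]

lemma height_nsmul (n : ℕ) (ν : Module.Dual ℂ H) : D.height (n • ν) = n * D.height ν := by
  simp [height]

lemma height_root (j : Fin ℓ) : D.height (D.root j) = 1 := by
  simp [height, root_gradElt]

lemma one_le_height_evenRoot (i : Fin ℓ) : 1 ≤ D.height (D.evenRoot i) := by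
  rcases D.parity_cases i with h | h
  · rw [D.evenRoot_even h, D.height_root]
  · rw [D.evenRoot_odd h]
    simp [height, root_gradElt]

lemma weight_gradElt (n : Fin ℓ →₀ ℕ) : D.weight n D.gradElt = (n.degree : ℂ) := by
  rw [weight_apply, Finsupp.degree_eq_sum]
  simp [root_gradElt]

lemma height_weight (n : Fin ℓ →₀ ℕ) : D.height (D.weight n) = n.degree := by
  simp [height, weight_gradElt]

/-- The weights of `N` lie in a finite union of sets `λ - Q⁺`. -/
def IsBounded (N : D.Mod) : Prop :=
  ∃ Λ : Finset (Module.Dual ℂ H), ∀ ν, D.weightSpace N ν ≠ ⊥ →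
    ∃ l ∈ Λ, ∃ n : Fin ℓ →₀ ℕ, ν = l - D.weight n

variable {D} in
lemma IsBounded.exists_height_le {N : D.Mod} (hN : D.IsBounded N) :
    ∃ B : ℝ, ∀ ν, D.weightSpace N ν ≠ ⊥ → D.height ν ≤ B := by
  obtain ⟨Λ, hΛ⟩ := hN
  obtain ⟨B, hB⟩ := (Λ.image D.height).bddAbove
  refine ⟨B, fun ν hν => ?_⟩
  obtain ⟨l, hl, n, rfl⟩ := hΛ ν hν
  rw [height_sub, height_weight]
  have h1 := hB (Finset.mem_coe.mpr (Finset.mem_image_of_mem D.height hl))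
  have h2 : (0 : ℝ) ≤ n.degree := Nat.cast_nonneg _
  linarith

variable {D} in
lemma IsBounded.exists_envE_pow_smul_eq_zero {N : D.Mod} (hN : D.IsBounded N)
    {ν : Module.Dual ℂ H} {v : N} (hv : v ∈ D.weightSpace N ν) : ∃ n, D.envE i ^ n • v = 0 := by
  obtain ⟨B, hB⟩ := hN.exists_height_le
  obtain ⟨n, hn⟩ := exists_nat_gt (B - D.height ν)
  refine ⟨n, ?_⟩
  by_contra hne
  have h1 := hB _ (Submodule.ne_bot_iff _ |>.mpr ⟨_, D.envE_pow_smul_mem (i := i) hv n, hne⟩)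
  rw [height_add, height_nsmul] at h1
  have h2 := mul_le_mul_of_nonneg_left (D.one_le_height_evenRoot i) (Nat.cast_nonneg (α := ℝ) n)
  linarith

/-- On a weight module with weights bounded above `e` is locally nilpotent. -/
lemma isWeightNilp {N : D.Mod} {a : ℂ} (hdiag : ⨆ ν, D.weightSpace N ν = ⊤) (hbd : D.IsBounded N)
    (hM : D.catM i a N) : IsWeightNilp (D.envE i) (D.envH i) a N where
  diag v := by
    refine exists_sum_of_mem_closure ?_
    have h1 : v ∈ ⨆ n : ℤ, Module.End.eigenspace
      (Algebra.lsmul ℂ ℂ N (Env.ι (D.algH (D.evenCoroot i)))) (a + n) := by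
      rw [show _ = _ from hM]; trivial
    refine Submodule.iSup_induction _ (motive := fun v => v ∈ AddSubmonoid.closure _) h1
      (fun n w hw => AddSubmonoid.subset_closure ⟨n, ?_⟩) (AddSubmonoid.zero_mem _)
      (fun _ _ => AddSubmonoid.add_mem _)
    rw [Module.End.mem_eigenspace_iff] at hw
    rw [algebraMap_smul]
    exact hw
  nilp v := by
    have h1 : v ∈ ⨆ ν, D.weightSpace N ν := by rw [hdiag]; trivial
    refine Submodule.iSup_induction _ (motive := fun v => ∃ n, D.envE i ^ n • v = 0) h1
      (fun ν w hw => hbd.exists_envE_pow_smul_eq_zero hw) ⟨0, smul_zero _⟩ ?_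
    rintro v w ⟨n, hn⟩ ⟨m, hm⟩
    refine ⟨n + m, ?_⟩
    rw [smul_add, add_comm n m, pow_add, mul_smul, hn, smul_zero, zero_add, ← pow_add, add_comm m,
      pow_add, mul_smul, hm, smul_zero]

lemma catM_of_isWeightNilp {N : D.Mod} {a : ℂ} (hN : IsWeightNilp (D.envE i) (D.envH i) a N) :
    D.catM i a N := by
  refine eq_top_iff.mpr fun v _ => ?_
  obtain ⟨s, w, hw, rfl⟩ := hN.diag v
  refine Submodule.sum_mem _ fun n hn => Submodule.mem_iSup_of_mem n ?_
  rw [Module.End.mem_eigenspace_iff]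
  have := hw n hn
  rwa [algebraMap_smul] at this

/-- All weights of `N` take values in `a + ℤ` on `h`. -/
lemma weight_evenCoroot {N : D.Mod} {a : ℂ} (hN : IsWeightNilp (D.envE i) (D.envH i) a N)
    {ν : Module.Dual ℂ H} (hν : D.weightSpace N ν ≠ ⊥) : ∃ n : ℤ, ν (D.evenCoroot i) = a + n := by
  by_contra! hne
  obtain ⟨v, hv, hv0⟩ := (Submodule.ne_bot_iff _).mp hν
  obtain ⟨s, w, hw, rfl⟩ := hN.diag v
  refine hv0 ?_
  have h1 := Module.End.eigenspaces_iSupIndep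
    (Algebra.lsmul ℂ ℂ N (Env.ι (D.algH (D.evenCoroot i))) : Module.End ℂ N)
  refine Submodule.disjoint_def.mp (h1 (ν (D.evenCoroot i))) _
    (Module.End.mem_eigenspace_iff.mpr (D.mem_weightSpace.mp hv _)) ?_
  refine Submodule.sum_mem _ fun n hn => Submodule.mem_iSup_of_mem (a + n)
    (Submodule.mem_iSup_of_mem (hne n).symm (Module.End.mem_eigenspace_iff.mpr ?_))
  have := hw n hn
  rwa [algebraMap_smul] at this

/-! ### Highest weight modules -/

/-- `v` is a singular (highest weight) vector of weight `ν` and parity `q`. -/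
structure IsSingular (N : D.Mod) (ν : Module.Dual ℂ H) (q : ZMod 2) (v : N) : Prop where
  e : ∀ j, Env.ι (D.algE j) • v = 0
  wt : v ∈ D.weightSpace N ν
  par : (Env.σ : Env D.Alg) • v = sgn q • v

/-- The vector `f_{j_1} ⋯ f_{j_r} v`. -/
def fMon {N : D.Mod} (v : N) (l : List (Fin ℓ)) : N :=
  l.foldr (fun j y => Env.ι (D.algF j) • y) v

/-- The sum `α_{j_1} + ⋯ + α_{j_r}`, in coordinates. -/
def listDeg (l : List (Fin ℓ)) : Fin ℓ →₀ ℕ := l.foldr (fun j n => Finsupp.single j 1 + n) 0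

lemma degree_listDeg (l : List (Fin ℓ)) : (listDeg l).degree = l.length := by
  induction l with
  | nil => simp [listDeg]
  | cons j l ih =>
    have h : listDeg (j :: l) = Finsupp.single j 1 + listDeg l := rfl
    rw [h, map_add, ih, Finsupp.degree_single, List.length_cons, add_comm]

namespace IsSingular

variable {D} {N : D.Mod} {ν : Module.Dual ℂ H} {q : ZMod 2} {v : N} (hv : D.IsSingular N ν q v)

include hv

lemma fMon_mem (l : List (Fin ℓ)) : D.fMon v l ∈ D.weightSpace N (ν - D.weight (listDeg l)) := by
  induction l with
  | nil => simpa [listDeg, weight_zero, fMon] using hv.wt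
  | cons j l ih =>
    have h : listDeg (j :: l) = Finsupp.single j 1 + listDeg l := rfl
    rw [h, weight_add, weight_single, add_comm, ← sub_sub]
    exact D.algF_smul_mem j ih

lemma e_smul_fMon (j : Fin ℓ) (l : List (Fin ℓ)) :
    Env.ι (D.algE j) • D.fMon v l ∈ Submodule.span ℂ (Set.range (D.fMon v)) := by
  induction l with
  | nil => exact (hv.e j).symm ▸ Submodule.zero_mem _
  | cons k l ih =>
    have hf : Submodule.span ℂ (Set.range (D.fMon v)) ≤ (Submodule.span ℂ
        (Set.range (D.fMon v))).comap (Algebra.lsmul ℂ ℂ N (Env.ι (D.algF k))) := by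
      refine Submodule.span_le.mpr ?_
      rintro _ ⟨m, rfl⟩
      exact Submodule.subset_span ⟨k :: m, rfl⟩
    have h1 : D.fMon v (k :: l) = Env.ι (D.algF k) • D.fMon v l := rfl
    rw [h1, ← mul_smul, Env.ι_mul_ι (D.θ_algE j) (D.θ_algF k), add_smul, smul_assoc, mul_smul]
    refine Submodule.add_mem _ (Submodule.smul_mem _ _ (hf ih)) ?_
    rcases eq_or_ne j k with rfl | hjk
    · have h2 : br (D.algE j) (D.algF j) = D.algH (D.coroot j) := D.algGens.ef j
      rw [h2, D.mem_weightSpace.mp (hv.fMon_mem l)]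
      exact Submodule.smul_mem _ _ (Submodule.subset_span ⟨l, rfl⟩)
    · have h2 : br (D.algE j) (D.algF k) = 0 := D.algGens.ef_ne j k hjk
      rw [h2, map_zero, zero_smul]
      exact Submodule.zero_mem _

lemma σ_smul_fMon (l : List (Fin ℓ)) :
    ∃ c : ℂ, (Env.σ : Env D.Alg) • D.fMon v l = c • D.fMon v l := by
  induction l with
  | nil => exact ⟨_, hv.par⟩
  | cons k l ih =>
    obtain ⟨c, hc⟩ := ih
    have h1 : D.fMon v (k :: l) = Env.ι (D.algF k) • D.fMon v l := rfl
    refine ⟨sgn (D.p k) * c, ?_⟩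
    rw [h1, ← mul_smul, Env.σ_mul_ι, D.θ_algF, map_smul, mul_smul, hc, smul_assoc,
      smul_comm (Env.ι (D.algF k)) c, smul_smul]

/-- A highest weight module is spanned by the vectors `f_{j_1} ⋯ f_{j_r} v`. -/
lemma span_fMon (hspan : Submodule.span (Env D.Alg) {v} = ⊤) :
    Submodule.span ℂ (Set.range (D.fMon v)) = ⊤ := by
  have hst : ∀ (u : Env D.Alg) (w : N), w ∈ Submodule.span ℂ (Set.range (D.fMon v)) →
      u • w ∈ Submodule.span ℂ (Set.range (D.fMon v)) := by
    have ind : ∀ u : Env D.Alg, (∀ l, u • D.fMon v l ∈ Submodule.span ℂ (Set.range (D.fMon v))) →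
        ∀ w ∈ Submodule.span ℂ (Set.range (D.fMon v)),
          u • w ∈ Submodule.span ℂ (Set.range (D.fMon v)) := by
      intro u hu w hw
      have : Submodule.span ℂ (Set.range (D.fMon v)) ≤ (Submodule.span ℂ
          (Set.range (D.fMon v))).comap (Algebra.lsmul ℂ ℂ N u) := by
        refine Submodule.span_le.mpr ?_
        rintro _ ⟨m, rfl⟩
        exact hu m
      exact this hw
    refine Env.smul_mem_of_stable D.algGens _ (ind _ fun l => ?_) (fun x => ind _ fun l => ?_)
      (fun j => ind _ fun l => hv.e_smul_fMon j l)
      (fun j => ind _ fun l => Submodule.subset_span ⟨j :: l, rfl⟩)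
    · obtain ⟨c, hc⟩ := hv.σ_smul_fMon l
      rw [hc]
      exact Submodule.smul_mem _ _ (Submodule.subset_span ⟨l, rfl⟩)
    · have := D.mem_weightSpace.mp (hv.fMon_mem l) x
      refine (congrArg (· ∈ Submodule.span ℂ (Set.range (D.fMon v))) this).mpr
        (Submodule.smul_mem _ _ (Submodule.subset_span ⟨l, rfl⟩))
  refine eq_top_iff.mpr fun w _ => ?_
  obtain ⟨u, rfl⟩ := Submodule.mem_span_singleton.mp 
    (show w ∈ Submodule.span (Env D.Alg) {v} by rw [hspan]; trivial)
  exact hst u v (Submodule.subset_span ⟨[], rfl⟩)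

lemma weightSpace_eq (hspan : Submodule.span (Env D.Alg) {v} = ⊤) (β : Module.Dual ℂ H) :
    D.weightSpace N β = Submodule.span ℂ (D.fMon v '' {l | ν - D.weight (listDeg l) = β}) :=
  eq_span_of_iSupIndep (D.iSupIndep_weightSpace N) (D.fMon v) _ hv.fMon_mem (hv.span_fMon hspan) β

lemma iSup_weightSpace (hspan : Submodule.span (Env D.Alg) {v} = ⊤) :
    ⨆ β, D.weightSpace N β = ⊤ := by
  rw [eq_top_iff, ← hv.span_fMon hspan, Submodule.span_le]
  rintro _ ⟨l, rfl⟩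
  exact Submodule.mem_iSup_of_mem _ (hv.fMon_mem l)

lemma isBounded (hspan : Submodule.span (Env D.Alg) {v} = ⊤) : D.IsBounded N := by
  refine ⟨{ν}, fun β hβ => ⟨ν, Finset.mem_singleton_self ν, ?_⟩⟩
  by_contra! hne
  refine hβ ?_
  rw [hv.weightSpace_eq hspan, Submodule.span_eq_bot]
  rintro _ ⟨l, hl, -⟩
  exact absurd hl.symm (hne _)

lemma finiteDimensional_weightSpace (hspan : Submodule.span (Env D.Alg) {v} = ⊤)
    (β : Module.Dual ℂ H) : FiniteDimensional ℂ (D.weightSpace N β) := by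
  rw [hv.weightSpace_eq hspan]
  refine FiniteDimensional.span_of_finite ℂ (Set.Finite.image _ ?_)
  have h1 : ∀ l l' : List (Fin ℓ), ν - D.weight (listDeg l) = β → ν - D.weight (listDeg l') = β →
      l.length = l'.length := by
    intro l l' h h'
    rw [← degree_listDeg, ← degree_listDeg, D.weight_injective (sub_right_injective (h.trans h'.symm))]
  rcases Set.eq_empty_or_nonempty {l | ν - D.weight (listDeg l) = β} with h | ⟨l, hl⟩
  · rw [h]; exact Set.finite_empty
  · exact (List.finite_length_eq (Fin ℓ) l.length).subset fun l' hl' => h1 _ _ hl' hl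

lemma weightSpace_self (hspan : Submodule.span (Env D.Alg) {v} = ⊤) :
    D.weightSpace N ν = Submodule.span ℂ {v} := by
  rw [hv.weightSpace_eq hspan]
  congr 1
  ext w
  simp only [Set.mem_image, Set.mem_ofPred_eq, Set.mem_singleton_iff]
  constructor
  · rintro ⟨l, hl, rfl⟩
    have h1 : listDeg l = 0 := D.weight_injective (by
      rw [weight_zero]; exact sub_eq_self.mp hl)
    have h2 := degree_listDeg l
    rw [h1, map_zero] at h2
    rw [List.length_eq_zero_iff.mp h2.symm]; rfl
  · rintro rfl
    exact ⟨[], by simp [listDeg, weight_zero], rfl⟩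

lemma catM (hspan : Submodule.span (Env D.Alg) {v} = ⊤) (hi : D.A i i = 2) {a : ℂ}
    (ha : ∃ n : ℤ, ν (D.evenCoroot i) = a + n) : D.catM i a N := by
  refine eq_top_iff.mpr ?_
  rw [← hv.span_fMon hspan, Submodule.span_le]
  rintro _ ⟨l, rfl⟩
  obtain ⟨n, hn⟩ := ha
  choose m hm using D.exists_root_evenCoroot hi
  refine Submodule.mem_iSup_of_mem (n - ∑ j, listDeg l j * m j) ?_
  rw [Module.End.mem_eigenspace_iff]
  refine (D.mem_weightSpace.mp (hv.fMon_mem l) (D.evenCoroot i)).trans ?_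
  congr 1
  rw [LinearMap.sub_apply, weight_apply, hn]
  simp only [hm]
  push_cast
  ring

lemma map {N' : D.Mod} (g : N →ₗ[Env D.Alg] N') : D.IsSingular N' ν q (g v) where
  e j := by rw [← map_smul, hv.e, map_zero]
  wt := D.map_mem_weightSpace g hv.wt
  par := by rw [← map_smul, hv.par]; exact (g.restrictScalars ℂ).map_smul _ _

end IsSingular

end CartanDatum


/-! ### Weights and singular vectors of `C_a(N)` -/

open LieSuperalgebra
open scoped ModuleCat

namespace CartanDatum

variable {ℓ : ℕ} {H : Type u} [AddCommGroup H] [Module ℂ H] (D : CartanDatum ℓ H) {i : Fin ℓ}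
  {a b : ℂ} {N : D.Mod} {ν : Module.Dual ℂ H}

lemma root_evenCoroot_odd (hi : D.A i i = 2) (h : D.p i = 1) :
    D.root i (D.evenCoroot i) = 1 := by
  rw [D.evenCoroot_odd h, map_smul, D.root_coroot_self hi]; norm_num

lemma algE_algF_smul (hp : D.p i = 1) {v : N} (hv : v ∈ D.weightSpace N ν)
    (he : Env.ι (D.algE i) • v = 0) :
    Env.ι (D.algE i) • Env.ι (D.algF i) • v = (2 * ν (D.evenCoroot i)) • v := by
  have h1 : br (D.algE i) (D.algF i) = D.algH (D.coroot i) := D.algGens.ef i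
  rw [← mul_smul, Env.ι_mul_ι (D.θ_algE i) (D.θ_algF i), add_smul, smul_assoc, mul_smul, he,
    smul_zero, smul_zero, zero_add, h1, D.mem_weightSpace.mp hv, D.evenCoroot_odd hp, map_smul,
    smul_eq_mul, mul_inv_cancel_left₀ two_ne_zero]

lemma algF_algF_smul (hp : D.p i = 1) (v : N) :
    Env.ι (D.algF i) • Env.ι (D.algF i) • v = (-2 : ℂ) • D.envF i • v := by
  rw [D.envF_odd hp, smul_assoc, mul_smul, smul_smul (-2 : ℂ), neg_mul_neg, mul_inv_cancel₀ two_ne_zero,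
    one_smul]

lemma envE_algF_smul (hp : D.p i = 1) {v : N} (hv : v ∈ D.weightSpace N ν)
    (he : Env.ι (D.algE i) • v = 0) : D.envE i • Env.ι (D.algF i) • v = 0 := by
  rw [D.envE_odd hp, smul_assoc, mul_smul, D.algE_algF_smul hp hv he,
    smul_comm (Env.ι (D.algE i)), he, smul_zero, smul_zero]

lemma envE_smul_eq_zero {v : N} (he : Env.ι (D.algE i) • v = 0) : D.envE i • v = 0 := by
  rcases D.parity_cases i with h | h
  · rw [envE, D.sl2E_even h, he]
  · rw [D.envE_odd h, smul_assoc, mul_smul, he, smul_zero, smul_zero]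

lemma adOp_envF_algE_ne {j : Fin ℓ} (hj : j ≠ i) :
    adOp (D.envF i) (Env.ι (D.algE j)) = 0 := by
  rw [Env.adOp_ι _ _ (D.θ_sl2F i), D.br_sl2F_algE_ne hj, map_zero]

/-- The dot action in terms of `r_α` alone. -/
lemma dotRefl_eq {ρ : Module.Dual ℂ H} (hρ : D.IsWeylVector ρ) (hi : D.A i i = 2)
    (μ : Module.Dual ℂ H) : D.dotRefl ρ i μ = D.refl i μ - D.root i := by
  have h2 := hρ i
  rw [D.root_coroot_self hi] at h2
  have h1 : ρ (D.evenCoroot i) • D.evenRoot i = D.root i := by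
    rcases D.parity_cases i with h | h
    · rw [D.evenCoroot_even h, D.evenRoot_even h, h2]
      norm_num
    · rw [D.evenCoroot_odd h, D.evenRoot_odd h, map_smul, h2, smul_smul]
      norm_num
  rw [dotRefl, refl, refl, LinearMap.add_apply, add_smul, h1]
  abel

section

variable [AdLocNilp (D.envF i)]

lemma algH_smul_twistedVec (x : H) (k : ℤ) (v : N) :
    Env.ι (D.algH x) • twistedVec (f := D.envF i) a k v =
      twistedVec a k (Env.ι (D.algH x) • v - ((a + k) * D.evenRoot i x) • v) := by
  have h1 : adOp (D.envF i) (adOp (D.envF i) (Env.ι (D.algH x))) = 0 := by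
    rw [D.adOp_envF_algH, map_smul, adOp_apply, sub_self, smul_zero]
  have h2 : (adOp (D.envF i) ^ 2) (Env.ι (D.algH x)) = 0 := by
    rw [pow_two, Module.End.mul_apply, h1]
  have key := twistedVec_smul (f := D.envF i) (a := a) (Env.ι (D.algH x)) k 2 h2 v
  simp only [Finset.sum_range_succ, Finset.sum_range_zero, zero_add, Ring.choose_zero_right,
    Ring.choose_one_right, pow_zero, Module.End.one_apply, pow_one, D.adOp_envF_algH,
    algebraMap_smul, Nat.cast_zero, sub_zero, Nat.cast_one, one_smul, smul_assoc,
    f_smul_twistedVec, sub_add_cancel] at key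
  rw [smul_smul] at key
  have h3 := (twistedVecHom (f := D.envF i) (N := N) a k).map_sub (Env.ι (D.algH x) • v)
    (((a + k) * D.evenRoot i x) • v)
  rw [LinearMap.map_smul (twistedVecHom (f := D.envF i) a k)] at h3
  refine Eq.trans ?_ h3.symm
  exact eq_sub_of_add_eq key.symm

lemma twistedVec_mem_weightSpace {v : N} (hv : v ∈ D.weightSpace N ν) (k : ℤ) :
    twistedVec (f := D.envF i) a k v ∈
      D.weightSpace ((twistedLoc (D.envF i) a).obj N) (ν - (a + k) • D.evenRoot i) := by
  rw [mem_weightSpace]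
  intro x
  rw [D.algH_smul_twistedVec, D.mem_weightSpace.mp hv, ← sub_smul]
  exact (twistedVecHom (f := D.envF i) a k).map_smul _ _

section

variable [AdLocNilp (D.envE i)]

lemma mem_weightSpace_enright {z : (enright (D.envE i) (D.envF i) a).obj N} :
    z ∈ D.weightSpace _ ν ↔ z.1 ∈ D.weightSpace ((twistedLoc (D.envF i) a).obj N) ν := by
  rw [mem_weightSpace, mem_weightSpace]
  exact forall_congr' fun x => Subtype.ext_iff

lemma iSup_weightSpace_enright (hN : ⨆ ν, D.weightSpace N ν = ⊤) :
    ⨆ ν, D.weightSpace ((enright (D.envE i) (D.envF i) a).obj N) ν = ⊤ := by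
  refine D.iSup_weightSpace_submodule (N := (twistedLoc (D.envF i) a).obj N) ?_ _
  refine eq_top_iff.mpr fun x _ => ?_
  obtain ⟨k, v, rfl⟩ := exists_twistedVec x
  have h1 : v ∈ ⨆ ν, D.weightSpace N ν := by rw [hN]; trivial
  obtain ⟨s, w, hw, rfl⟩ := D.exists_sum_of_mem_iSup h1
  refine (congrArg (· ∈ _) (map_sum (twistedVecHom (f := D.envF i) (N := N) a (-k)) w s)).mpr ?_
  exact Submodule.sum_mem _ fun ν hν => Submodule.mem_iSup_of_mem _
    (D.twistedVec_mem_weightSpace (hw ν hν) (-k))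

end

/-- The map sending a vector `v` of weight `ν` with `e_i v = 0` and `ν(h) = a + n` to a vector of
`D_a(N)` killed by `e_i`: it is `f^{ν(h)+1} ⊗ v` if `α_i` is even, and `f^{ν(h)} ⊗ f_i v` if `α_i` is
odd. -/
def singMap (i : Fin ℓ) [AdLocNilp (D.envF i)] (a : ℂ) (N : D.Mod) (n : ℤ) :
    N →ₗ[ℂ] (twistedLoc (D.envF i) a).obj N :=
  if D.p i = 0 then twistedVecHom a (n + 1)
  else twistedVecHom a n ∘ₗ Algebra.lsmul ℂ ℂ N (Env.ι (D.algF i))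

lemma singMap_even (h : D.p i = 0) (n : ℤ) (v : N) :
    D.singMap i a N n v = twistedVec a (n + 1) v := by
  rw [singMap, if_pos h]; rfl

lemma singMap_odd (h : D.p i = 1) (n : ℤ) (v : N) :
    D.singMap i a N n v = twistedVec a n (Env.ι (D.algF i) • v) := by
  rw [singMap, if_neg (by rw [h]; exact one_ne_zero)]; rfl

lemma singMap_mem_weightSpace {n : ℤ} (hn : ν (D.evenCoroot i) = a + n) {v : N}
    (hv : v ∈ D.weightSpace N ν) :
    D.singMap i a N n v ∈ D.weightSpace _ (D.refl i ν - D.root i) := by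
  rcases D.parity_cases i with h | h
  · rw [D.singMap_even h]
    convert D.twistedVec_mem_weightSpace (i := i) (a := a) hv (n + 1) using 2
    rw [refl, hn, D.evenRoot_even h]
    push_cast
    module
  · rw [D.singMap_odd h]
    convert D.twistedVec_mem_weightSpace (i := i) (a := a) (D.algF_smul_mem i hv) n using 2
    rw [refl, hn]
    module

lemma envE_smul_singMap (hi : D.A i i = 2) {n : ℤ} (hn : ν (D.evenCoroot i) = a + n) {v : N}
    (hv : v ∈ D.weightSpace N ν) (he : Env.ι (D.algE i) • v = 0) :
    D.envE i • D.singMap i a N n v = 0 := by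
  rcases D.parity_cases i with h | h
  · rw [D.singMap_even h]
    exact e_smul_twistedVec (D.isSl2 hi) (D.mem_weightSpace.mp hv _) (D.envE_smul_eq_zero he) _
      (by rw [hn]; push_cast; ring)
  · rw [D.singMap_odd h]
    refine e_smul_twistedVec (D.isSl2 hi) (D.mem_weightSpace.mp (D.algF_smul_mem i hv) _)
      (D.envE_algF_smul h hv he) _ ?_
    rw [LinearMap.sub_apply, D.root_evenCoroot_odd hi h, hn]
    ring

lemma algE_smul_singMap (hi : D.A i i = 2) {n : ℤ} (hn : ν (D.evenCoroot i) = a + n) {v : N}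
    (hv : v ∈ D.weightSpace N ν) (he : Env.ι (D.algE i) • v = 0) :
    Env.ι (D.algE i) • D.singMap i a N n v = 0 := by
  rcases D.parity_cases i with h | h
  · have := D.envE_smul_singMap hi hn hv he
    rwa [envE, D.sl2E_even h] at this
  · rw [D.singMap_odd h]
    have h0 : adOp (D.envF i) (Env.ι (D.algE i)) = -Env.ι (D.algF i) := by
      rw [Env.adOp_ι _ _ (D.θ_sl2F i), D.br_sl2F_algE hi h, map_neg]
    have hF : adOp (D.envF i) (Env.ι (D.algF i)) = 0 := by
      rw [Env.adOp_ι _ _ (D.θ_sl2F i), D.br_sl2F_algF, map_zero]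
    have h2 : (adOp (D.envF i) ^ 2) (Env.ι (D.algE i)) = 0 := by
      rw [pow_two, Module.End.mul_apply, h0, map_neg, hF, neg_zero]
    have key := twistedVec_smul (f := D.envF i) (a := a) (Env.ι (D.algE i)) n 2 h2
      (Env.ι (D.algF i) • v)
    have hT : ∀ (k : ℤ) (c : ℂ) (w : N), twistedVec (f := D.envF i) a k (c • w) =
      c • twistedVec a k w := fun k c w => (twistedVecHom (f := D.envF i) a k).map_smul c w
    have hT' : ∀ (k : ℤ) (w : N), twistedVec (f := D.envF i) a k (-w) = -twistedVec a k w :=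
      fun k w => (twistedVecHom (f := D.envF i) a k).map_neg w
    simp only [Finset.sum_range_succ, Finset.sum_range_zero, zero_add, Ring.choose_zero_right,
      Ring.choose_one_right, pow_zero, Module.End.one_apply, pow_one, h0, hT', algebraMap_smul,
      Nat.cast_zero, sub_zero, Nat.cast_one, one_smul, neg_smul,
      smul_twistedVec_of_commute _ hF, D.algF_algF_smul h, D.algE_algF_smul h hv he, hT,
      twistedVec_f_smul, sub_add_cancel, hn] at key
    generalize Env.ι (D.algE i) • twistedVec (f := D.envF i) a n (Env.ι (D.algF i) • v) = X at key ⊢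
    linear_combination (norm := module) -key

lemma algE_smul_singMap_ne {j : Fin ℓ} (hj : j ≠ i) (n : ℤ) {v : N}
    (he : Env.ι (D.algE j) • v = 0) : Env.ι (D.algE j) • D.singMap i a N n v = 0 := by
  have h0 := D.adOp_envF_algE_ne hj
  rcases D.parity_cases i with h | h
  · rw [D.singMap_even h, smul_twistedVec_of_commute _ h0, he, twistedVec_zero]
  · have h1 : br (D.algE j) (D.algF i) = 0 := D.algGens.ef_ne j i hj
    rw [D.singMap_odd h, smul_twistedVec_of_commute _ h0, ← mul_smul,
      Env.ι_mul_ι (D.θ_algE j) (D.θ_algF i), h1, map_zero, add_zero, smul_assoc, mul_smul, he,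
      smul_zero, smul_zero, twistedVec_zero]

lemma σ_smul_singMap (n : ℤ) {v : N} {q : ZMod 2} (hv : (Env.σ : Env D.Alg) • v = sgn q • v) :
    (Env.σ : Env D.Alg) • D.singMap i a N n v = sgn (q + D.p i) • D.singMap i a N n v := by
  have h0 := Env.adOp_σ (D.θ_sl2F i)
  have hT : ∀ (k : ℤ) (c : ℂ) (w : N), twistedVec (f := D.envF i) a k (c • w) =
      c • twistedVec a k w := fun k c w => (twistedVecHom (f := D.envF i) a k).map_smul c w
  rcases D.parity_cases i with h | h
  · rw [D.singMap_even h, smul_twistedVec_of_commute _ h0, hv, h, add_zero, hT]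
  · rw [D.singMap_odd h, smul_twistedVec_of_commute _ h0, ← mul_smul, Env.σ_mul_ι, D.θ_algF,
      map_smul, mul_smul, hv, smul_assoc, smul_comm (Env.ι (D.algF i)) (sgn q), smul_smul, hT,
      ← sgn_add, add_comm]

lemma eq_zero_of_singMap (hi : D.A i i = 2) (ha : ∀ n : ℤ, a ≠ n)
    (hN : IsWeightNilp (D.envE i) (D.envH i) a N) {n : ℤ} (hn : ν (D.evenCoroot i) = a + n) {v : N}
    (hv : v ∈ D.weightSpace N ν) (he : Env.ι (D.algE i) • v = 0)
    (h0 : D.singMap i a N n v = 0) : v = 0 := by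
  have hinj := fun k => twistedVec_injective (f := D.envF i) (a := a) (D.isSl2 hi) ha hN k
  rcases D.parity_cases i with h | h
  · rw [D.singMap_even h, ← twistedVec_zero] at h0
    exact hinj _ h0
  · rw [D.singMap_odd h, ← twistedVec_zero] at h0
    have h1 := D.algE_algF_smul h hv he
    rw [hinj _ h0, smul_zero, hn] at h1
    refine (smul_eq_zero.mp h1.symm).resolve_left (mul_ne_zero two_ne_zero fun h2 => ha (-n) ?_)
    push_cast
    exact eq_neg_of_add_eq_zero_left h2

variable [AdLocNilp (D.envE i)]

lemma singMap_mem_eFinite (hi : D.A i i = 2) {n : ℤ} (hn : ν (D.evenCoroot i) = a + n) {v : N}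
    (hv : v ∈ D.weightSpace N ν) (he : Env.ι (D.algE i) • v = 0) :
    D.singMap i a N n v ∈ eFinite (D.envE i) ((twistedLoc (D.envF i) a).obj N) :=
  isEFinite_of_pow_smul_eq_zero 1 (by rw [pow_one, D.envE_smul_singMap hi hn hv he])

variable {D} in
/-- A singular vector of weight `ν` of `N` gives rise to a singular vector of weight `r_α.ν` of
`C_a(N)`, which generates `C_a(N)` if the original vector generates `N`. -/
lemma IsSingular.enright (hi : D.A i i = 2) (ha : ∀ n : ℤ, a ≠ n) (hab : a + b = 0)
    (hN : IsWeightNilp (D.envE i) (D.envH i) a N) {q : ZMod 2} {v : N}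
    (hv : D.IsSingular N ν q v) (hν : ∃ n : ℤ, ν (D.evenCoroot i) = a + n) :
    ∃ z : (KMSuper.enright (D.envE i) (D.envF i) a).obj N,
      D.IsSingular _ (D.refl i ν - D.root i) (q + D.p i) z ∧ (v ≠ 0 → z ≠ 0) ∧
      (Submodule.span (Env D.Alg) {v} = ⊤ → Submodule.span (Env D.Alg) {z} = ⊤) := by
  obtain ⟨n, hn⟩ := hν
  refine ⟨⟨D.singMap i a N n v, D.singMap_mem_eFinite hi hn hv.wt (hv.e i)⟩,
    ⟨fun j => Subtype.ext ?_, D.mem_weightSpace_enright.mpr (D.singMap_mem_weightSpace hn hv.wt),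
      Subtype.ext (D.σ_smul_singMap n hv.par)⟩, fun h0 hz => h0 ?_, fun hspan => ?_⟩
  · rcases eq_or_ne j i with rfl | hj
    · exact D.algE_smul_singMap hi hn hv.wt (hv.e j)
    · exact D.algE_smul_singMap_ne hj n (hv.e j)
  · exact D.eq_zero_of_singMap hi ha hN hn hv.wt (hv.e i) (congrArg Subtype.val hz)
  · refine eq_top_of_untwist_eq_top (D.isSl2 hi) ha hab hN (eq_top_iff.mpr ?_)
    rw [← hspan, Submodule.span_singleton_le_iff_mem]
    rcases D.parity_cases i with h | h
    · exact ⟨n + 1, _, Submodule.mem_span_singleton_self _, D.singMap_even h n v⟩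
    · have h1 := Submodule.smul_mem (untwist (Submodule.span (Env D.Alg)
        {(⟨D.singMap i a N n v, D.singMap_mem_eFinite hi hn hv.wt (hv.e i)⟩ :
          (KMSuper.enright (D.envE i) (D.envF i) a).obj N)})) (Env.ι (D.algE i))
        (mem_untwist.mpr ⟨n, _, Submodule.mem_span_singleton_self _, D.singMap_odd h n v⟩)
      rw [D.algE_algF_smul h hv.wt (hv.e i)] at h1
      have hc : 2 * ν (D.evenCoroot i) ≠ 0 := mul_ne_zero two_ne_zero fun h2 => ha (-n) (by
        push_cast
        exact eq_neg_of_add_eq_zero_left (hn.symm.trans h2))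
      have h2 := Submodule.smul_mem _ (algebraMap ℂ (Env D.Alg) (2 * ν (D.evenCoroot i))⁻¹) h1
      rwa [algebraMap_smul, smul_smul, inv_mul_cancel₀ hc, one_smul] at h2
end

end CartanDatum


/-! ### The Enright functor preserves `𝒪^fin` -/

open LieSuperalgebra
open scoped ModuleCat

namespace CartanDatum

variable {ℓ : ℕ} {H : Type u} [AddCommGroup H] [Module ℂ H] (D : CartanDatum ℓ H) {i : Fin ℓ}
  {a b : ℂ}

/-- The conditions on the size of a module in the category `𝒪`. -/
def IsSmall (N : D.Mod) : Prop :=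
  D.IsBounded N ∧ ∀ ν, FiniteDimensional ℂ (D.weightSpace N ν)

/-- A finite family of weight vectors generating `N`, whose span is stable under the `e_j`. -/
structure IsTriangularFamily (N : D.Mod) {κ : Type u} (s : Finset κ) (v : κ → N)
    (w : κ → Module.Dual ℂ H) (q : κ → ZMod 2) : Prop where
  wt : ∀ k ∈ s, v k ∈ D.weightSpace N (w k)
  par : ∀ k ∈ s, (Env.σ : Env D.Alg) • v k = sgn (q k) • v k
  e : ∀ k ∈ s, ∀ j, Env.ι (D.algE j) • v k ∈
    Submodule.span ℂ (v '' {l | l ∈ s ∧ w l = w k + D.root j})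
  span : Submodule.span (Env D.Alg) (v '' s) = ⊤

variable {D} in
/-- The image of a family in the quotient by the submodule generated by one of its members. -/
lemma IsTriangularFamily.quotient {N : D.Mod} {κ : Type u} [DecidableEq κ] {s : Finset κ}
    {v : κ → N} {w : κ → Module.Dual ℂ H} {q : κ → ZMod 2} (h : D.IsTriangularFamily N s v w q)
    (k : κ) : D.IsTriangularFamily
      (ModuleCat.of (Env D.Alg) (N ⧸ Submodule.span (Env D.Alg) {v k})) (s.erase k)
      (fun l => (Submodule.span (Env D.Alg) {v k}).mkQ (v l)) w q := by
  set P := Submodule.span (Env D.Alg) {v k} with hP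
  have h0 : P.mkQ (v k) = 0 :=
    (Submodule.Quotient.mk_eq_zero P).mpr (Submodule.mem_span_singleton_self _)
  let g : N →ₗ[Env D.Alg] (ModuleCat.of (Env D.Alg) (N ⧸ P) : D.Mod) := P.mkQ
  refine ⟨fun l hl => D.map_mem_weightSpace g (h.wt l (Finset.mem_of_mem_erase hl)),
    fun l hl => ?_, fun l hl j => ?_, ?_⟩
  · have h1 := congrArg g (h.par l (Finset.mem_of_mem_erase hl))
    exact ((map_smul g _ _).symm.trans h1).trans ((g.restrictScalars ℂ).map_smul _ _)
  · have h1 := h.e l (Finset.mem_of_mem_erase hl) j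
    have h2 : Submodule.span ℂ (v '' {m | m ∈ s ∧ w m = w l + D.root j}) ≤
        (Submodule.span ℂ ((fun l => g (v l)) '' {m | m ∈ s.erase k ∧ w m = w l + D.root j})).comap
          (g.restrictScalars ℂ) := by
      refine Submodule.span_le.mpr ?_
      rintro _ ⟨m, ⟨hm, hm'⟩, rfl⟩
      rcases eq_or_ne m k with rfl | hmk
      · refine (congrArg (· ∈ Submodule.span ℂ _) (show g (v m) = 0 from h0)).mpr
          (Submodule.zero_mem _)
      · exact Submodule.subset_span ⟨m, ⟨Finset.mem_erase.mpr ⟨hmk, hm⟩, hm'⟩, rfl⟩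
    exact (congrArg (· ∈ Submodule.span ℂ _) (map_smul g _ _)).mp (h2 h1)
  · refine eq_top_iff.mpr fun y _ => ?_
    obtain ⟨x, rfl⟩ := P.mkQ_surjective y
    have hx : x ∈ Submodule.span (Env D.Alg) (v '' s) := by rw [h.span]; trivial
    have h2 : Submodule.span (Env D.Alg) (v '' s) ≤
        (Submodule.span (Env D.Alg) ((fun l => g (v l)) '' (s.erase k : Finset κ))).comap g := by
      refine Submodule.span_le.mpr ?_
      rintro _ ⟨m, hm, rfl⟩
      rcases eq_or_ne m k with rfl | hmk
      · refine (congrArg (· ∈ Submodule.span (Env D.Alg) _) (show g (v m) = 0 from h0)).mpr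
          (Submodule.zero_mem _)
      · exact Submodule.subset_span ⟨m, Finset.mem_coe.mpr (Finset.mem_erase.mpr ⟨hmk, hm⟩), rfl⟩
    exact h2 hx

section

variable [AdLocNilp (D.envE i)] [AdLocNilp (D.envF i)]

/-- The modules `N` such that the weight spaces of `C_a(N)` satisfy the size conditions of `𝒪` are
closed under extensions. -/
lemma isSmall_enright_of_quotient (hi : D.A i i = 2) (ha : ∀ n : ℤ, a ≠ n) (hab : a + b = 0)
    {N : D.Mod} (hN : IsWeightNilp (D.envE i) (D.envH i) a N) (P : Submodule (Env D.Alg) N)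
    (hP : D.IsSmall ((enright (D.envE i) (D.envF i) a).obj (ModuleCat.of (Env D.Alg) P)))
    (hQ : D.IsSmall ((enright (D.envE i) (D.envF i) a).obj (ModuleCat.of (Env D.Alg) (N ⧸ P)))) :
    D.IsSmall ((enright (D.envE i) (D.envF i) a).obj N) := by
  classical
  let C := enright (D.envE i) (D.envF i) a
  let π := (C.map (ModuleCat.ofHom P.mkQ)).hom
  let κ := (C.map (ModuleCat.ofHom P.subtype)).hom
  have hinj : Function.Injective κ := by
    refine (injective_iff_map_eq_zero κ).mpr fun y hy => ?_
    obtain ⟨k, p, hp⟩ := exists_twistedVec y.1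
    have h1 : (κ y).1 = 0 := congrArg Subtype.val hy
    have h2 : (κ y).1 = twistedVec a (-k) p.1 := by
      rw [enright_map_val, hp, twistedLoc_map_twistedVec]; rfl
    rw [h1, ← twistedVec_zero (-k)] at h2
    have h3 : p = 0 := Subtype.ext
      (twistedVec_injective (f := D.envF i) (a := a) (D.isSl2 hi) ha hN (-k) h2).symm
    refine Subtype.ext ?_
    rw [hp, h3, twistedVec_zero]; rfl
  have hker : ∀ ν, ∀ z ∈ D.weightSpace (C.obj N) ν, π z = 0 →
      ∃ y ∈ D.weightSpace (C.obj (ModuleCat.of (Env D.Alg) P)) ν, κ y = z := by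
    intro ν z hz hz0
    obtain ⟨y, hy⟩ := exists_enright_map_eq (D.isSl2 hi) ha hab hN P z hz0
    refine ⟨y, D.mem_weightSpace.mpr fun x => hinj ?_, hy⟩
    rw [map_smul]
    have h1 := D.mem_weightSpace.mp hz x
    rw [← hy] at h1
    exact h1.trans ((κ.restrictScalars ℂ).map_smul _ _).symm
  refine ⟨?_, fun ν => ?_⟩
  · obtain ⟨Λ, hΛ⟩ := hP.1
    obtain ⟨Λ', hΛ'⟩ := hQ.1
    refine ⟨Λ ∪ Λ', fun ν hν => ?_⟩
    obtain ⟨z, hz, hz0⟩ := (Submodule.ne_bot_iff _).mp hν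
    by_cases h0 : π z = 0
    · obtain ⟨y, hy, rfl⟩ := hker ν z hz h0
      obtain ⟨l, hl, n, h⟩ := hΛ ν ((Submodule.ne_bot_iff _).mpr
        ⟨y, hy, fun h => hz0 (by rw [h, map_zero])⟩)
      exact ⟨l, Finset.mem_union_left _ hl, n, h⟩
    · obtain ⟨l, hl, n, h⟩ := hΛ' ν ((Submodule.ne_bot_iff _).mpr
        ⟨π z, D.map_mem_weightSpace π hz, h0⟩)
      exact ⟨l, Finset.mem_union_right _ hl, n, h⟩
  · have h1 := hP.2 ν
    have h2 := hQ.2 ν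
    let πν : D.weightSpace (C.obj N) ν →ₗ[ℂ]
        D.weightSpace (C.obj (ModuleCat.of (Env D.Alg) (N ⧸ P))) ν :=
      (π.restrictScalars ℂ).restrict fun z hz => D.map_mem_weightSpace π hz
    let κν : D.weightSpace (C.obj (ModuleCat.of (Env D.Alg) P)) ν →ₗ[ℂ]
        D.weightSpace (C.obj N) ν :=
      (κ.restrictScalars ℂ).restrict fun z hz => D.map_mem_weightSpace κ hz
    have h3 : FiniteDimensional ℂ (LinearMap.ker πν) := by
      refine Submodule.finiteDimensional_of_le (S₂ := LinearMap.range κν) fun z hz => ?_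
      obtain ⟨y, hy, hyz⟩ := hker ν z.1 z.2 (congrArg Subtype.val hz)
      exact ⟨⟨y, hy⟩, Subtype.ext hyz⟩
    have h4 : FiniteDimensional ℂ (D.weightSpace (C.obj N) ν ⧸ LinearMap.ker πν) :=
      Module.Finite.equiv πν.quotKerEquivRange.symm
    exact Module.Finite.of_submodule_quotient (LinearMap.ker πν)

/-- If `N` is a highest weight module then so is `C_a(N)`, generated by the vector given by
`IsSingular.enright`. -/
lemma isSmall_enright_of_isSingular (hi : D.A i i = 2) (ha : ∀ n : ℤ, a ≠ n) (hab : a + b = 0)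
    {N : D.Mod} (hN : IsWeightNilp (D.envE i) (D.envH i) a N) {ν : Module.Dual ℂ H} {q : ZMod 2}
    {v : N} (hv : D.IsSingular N ν q v) (hv0 : v ≠ 0)
    (hspan : Submodule.span (Env D.Alg) {v} = ⊤) :
    D.IsSmall ((enright (D.envE i) (D.envF i) a).obj N) := by
  obtain ⟨z, hz, -, hz'⟩ := hv.enright hi ha hab hN
    (D.weight_evenCoroot hN ((Submodule.ne_bot_iff _).mpr ⟨v, hv.wt, hv0⟩))
  exact ⟨hz.isBounded (hz' hspan), hz.finiteDimensional_weightSpace (hz' hspan)⟩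

lemma isSmall_enright_of_subsingleton {N : D.Mod} (hN : Subsingleton N) :
    D.IsSmall ((enright (D.envE i) (D.envF i) a).obj N) := by
  have h0 : Subsingleton ((enright (D.envE i) (D.envF i) a).obj N) := by
    refine ⟨fun z z' => ?_⟩
    have h1 : ∀ z : (enright (D.envE i) (D.envF i) a).obj N, z.1 = 0 := fun z => by
      obtain ⟨k, v, hv⟩ := exists_twistedVec z.1
      rw [hv, Subsingleton.elim v 0, twistedVec_zero]
    exact Subtype.ext ((h1 z).trans (h1 z').symm)
  exact ⟨⟨∅, fun ν hν => absurd (Subsingleton.elim _ _) hν⟩, fun ν => inferInstance⟩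

/-- The member of maximal height of a triangular family is singular; the quotient by the highest
weight module which it generates has a smaller triangular family. -/
lemma isSmall_enright_of_family (hi : D.A i i = 2) (ha : ∀ n : ℤ, a ≠ n) (hab : a + b = 0)
    {κ : Type u} (w : κ → Module.Dual ℂ H) (q : κ → ZMod 2) (n : ℕ) :
    ∀ (N : D.Mod) (s : Finset κ) (v : κ → N), s.card = n →
      IsWeightNilp (D.envE i) (D.envH i) a N → D.IsTriangularFamily N s v w q →
      D.IsSmall ((enright (D.envE i) (D.envF i) a).obj N) := by
  classical
  induction n with
  | zero =>
    intro N s v hs hN h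
    refine D.isSmall_enright_of_subsingleton ?_
    have h1 := h.span
    rw [Finset.card_eq_zero.mp hs, Finset.coe_empty, Set.image_empty, Submodule.span_empty] at h1
    exact (Submodule.subsingleton_iff (Env D.Alg)).mp (subsingleton_of_bot_eq_top h1)
  | succ n ih =>
    intro N s v hs hN h
    obtain ⟨k, hk, hmax⟩ := s.exists_max_image (fun k => D.height (w k))
      (Finset.card_pos.mp (by omega))
    refine D.isSmall_enright_of_quotient hi ha hab hN (Submodule.span (Env D.Alg) {v k}) ?_
      (ih _ (s.erase k) _ (by rw [Finset.card_erase_of_mem hk, hs]; rfl) (hN.quotient _)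
        (h.quotient k))
    have hP : IsWeightNilp (D.envE i) (D.envH i) a
        (ModuleCat.of (Env D.Alg) (Submodule.span (Env D.Alg) {v k})) := hN.submodule _
    by_cases hv0 : v k = 0
    · refine D.isSmall_enright_of_subsingleton ?_
      rw [hv0, Submodule.span_singleton_eq_bot.mpr rfl]
      exact inferInstanceAs (Subsingleton (⊥ : Submodule (Env D.Alg) N))
    have he : ∀ j, Env.ι (D.algE j) • v k = 0 := by
      intro j
      have h1 := h.e k hk j
      have h2 : {l | l ∈ s ∧ w l = w k + D.root j} = ∅ := by
        refine Set.eq_empty_iff_forall_notMem.mpr ?_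
        rintro l ⟨hl, hl'⟩
        have := hmax l hl
        rw [hl', height_add, height_root] at this
        linarith
      rwa [h2, Set.image_empty, Submodule.span_empty, Submodule.mem_bot] at h1
    let v' : Submodule.span (Env D.Alg) {v k} := ⟨v k, Submodule.mem_span_singleton_self _⟩
    have hv' : D.IsSingular (ModuleCat.of (Env D.Alg) (Submodule.span (Env D.Alg) {v k})) (w k)
        (q k) v' :=
      ⟨fun j => Subtype.ext (he j),
        D.mem_weightSpace.mpr fun x => Subtype.ext (D.mem_weightSpace.mp (h.wt k hk) x),
        Subtype.ext (h.par k hk)⟩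
    refine D.isSmall_enright_of_isSingular hi ha hab hP hv' (fun h0 => hv0 (congrArg Subtype.val h0))
      (eq_top_iff.mpr ?_)
    rintro ⟨y, hy⟩ -
    obtain ⟨u, rfl⟩ := Submodule.mem_span_singleton.mp hy
    exact Submodule.mem_span_singleton.mpr ⟨u, Subtype.ext rfl⟩

end

/-- A finite-dimensional weight space is spanned by finitely many homogeneous vectors. -/
lemma exists_homogeneous_span (N : D.Mod) (ν : Module.Dual ℂ H)
    [FiniteDimensional ℂ (D.weightSpace N ν)] :
    ∃ t : Finset (N × ZMod 2), (∀ y ∈ t, y.1 ∈ D.weightSpace N ν) ∧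
      (∀ y ∈ t, (Env.σ : Env D.Alg) • y.1 = sgn y.2 • y.1) ∧
      D.weightSpace N ν ≤ Submodule.span ℂ (Prod.fst '' (t : Set (N × ZMod 2))) := by
  classical
  obtain ⟨G, hG⟩ := IsNoetherian.noetherian (⊤ : Submodule ℂ (D.weightSpace N ν))
  let part : ZMod 2 → D.weightSpace N ν → N := fun q x =>
    x.1 + sgn q • (Env.σ : Env D.Alg) • x.1
  have hσσ : ∀ x : N, (Env.σ : Env D.Alg) • (Env.σ : Env D.Alg) • x = x := fun x => by
    rw [← mul_smul, Env.σ_mul_σ, one_smul]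
  refine ⟨G.image (fun x => (part 0 x, 0)) ∪ G.image (fun x => (part 1 x, 1)), ?_, ?_, ?_⟩
  · intro y hy
    have hm : ∀ q (x : D.weightSpace N ν), part q x ∈ D.weightSpace N ν := fun q x =>
      Submodule.add_mem _ x.2 (Submodule.smul_mem _ _ (D.σ_smul_mem x.2))
    rcases Finset.mem_union.mp hy with hy | hy <;>
      obtain ⟨x, -, rfl⟩ := Finset.mem_image.mp hy <;> exact hm _ x
  · intro y hy
    have hm : ∀ q (x : D.weightSpace N ν),
        (Env.σ : Env D.Alg) • part q x = sgn q • part q x := fun q x => by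
      simp only [part]
      rw [smul_add, smul_comm (Env.σ : Env D.Alg) (sgn q), hσσ, smul_add, smul_smul, sgn_sq,
        one_smul, add_comm]
    rcases Finset.mem_union.mp hy with hy | hy <;>
      obtain ⟨x, -, rfl⟩ := Finset.mem_image.mp hy <;> exact hm _ x
  · set S := Submodule.span ℂ (Prod.fst '' ((G.image (fun x => (part 0 x, (0 : ZMod 2))) ∪
      G.image (fun x => (part 1 x, 1)) : Finset (N × ZMod 2)) : Set (N × ZMod 2))) with hS
    have h1 : ∀ x ∈ G, x.1 ∈ S := by
      intro x hx
      have h0 : part 0 x ∈ S := Submodule.subset_span ⟨(part 0 x, 0), by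
        rw [Finset.mem_coe]
        exact Finset.mem_union_left _ (Finset.mem_image_of_mem _ hx), rfl⟩
      have h1 : part 1 x ∈ S := Submodule.subset_span ⟨(part 1 x, 1), by
        rw [Finset.mem_coe]
        exact Finset.mem_union_right _ (Finset.mem_image_of_mem _ hx), rfl⟩
      have h2 : x.1 = (2 : ℂ)⁻¹ • (part 0 x + part 1 x) := by
        simp only [part, sgn_zero, sgn_one]
        generalize (Env.σ : Env D.Alg) • (x : N) = y
        module
      rw [h2]
      exact S.smul_mem _ (S.add_mem h0 h1)
    have h2 : (⊤ : Submodule ℂ (D.weightSpace N ν)) ≤ S.comap (D.weightSpace N ν).subtype := by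
      rw [← hG]
      exact Submodule.span_le.mpr h1
    exact fun x hx => h2 (x := ⟨x, hx⟩) trivial

/-- The weights above a given weight of a module with bounded weights are finite in number. -/
lemma finite_weights_above {N : D.Mod} (hN : D.IsBounded N) (ν : Module.Dual ℂ H) :
    {μ | D.weightSpace N μ ≠ ⊥ ∧ ∃ n, μ = ν + D.weight n}.Finite := by
  obtain ⟨Λ, hΛ⟩ := hN
  have h1 : ∀ l : Module.Dual ℂ H,
      {μ | ∃ n m, μ = ν + D.weight n ∧ μ = l - D.weight m}.Finite := by
    intro l
    by_cases h : ∃ k, l = ν + D.weight k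
    · obtain ⟨k, rfl⟩ := h
      refine ((Set.finite_Iic k).image fun n => ν + D.weight n).subset ?_
      rintro μ ⟨n, m, rfl, hm⟩
      refine ⟨n, ?_, rfl⟩
      have h2 : D.weight (n + m) = D.weight k := by
        rw [weight_add]
        linear_combination (norm := module) hm
      exact Set.mem_Iic.mpr (D.weight_injective h2 ▸ le_self_add)
    · refine Set.finite_empty.subset ?_
      rintro μ ⟨n, m, rfl, hm⟩
      exact h ⟨n + m, by rw [weight_add, ← add_assoc, hm, sub_add_cancel]⟩
  refine (Λ.finite_toSet.biUnion fun l _ => h1 l).subset ?_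
  rintro μ ⟨hμ, n, hn⟩
  obtain ⟨l, hl, m, hm⟩ := hΛ μ hμ
  exact Set.mem_biUnion hl ⟨n, m, hn, hm⟩

/-- Finitely generated modules in `𝒪` are generated by triangular families. -/
lemma exists_isTriangularFamily {N : D.Mod} (hN : D.catO N) (hfin : Module.Finite (Env D.Alg) N) :
    ∃ s : Finset (Module.Dual ℂ H × N × ZMod 2),
      D.IsTriangularFamily N s (fun k => k.2.1) (fun k => k.1) (fun k => k.2.2) := by
  classical
  obtain ⟨hdiag, hfd, hbd⟩ := hN
  obtain ⟨G, hG⟩ := hfin.fg_top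
  have h1 : ∀ x : N, ∃ (s : Finset (Module.Dual ℂ H)) (w : Module.Dual ℂ H → N),
      (∀ ν ∈ s, w ν ∈ D.weightSpace N ν) ∧ x = ∑ ν ∈ s, w ν := fun x =>
    D.exists_sum_of_mem_iSup (by rw [hdiag]; trivial)
  choose S w hw hsum using h1
  let W : Set (Module.Dual ℂ H) := ⋃ ν ∈ G.biUnion S,
    {μ | D.weightSpace N μ ≠ ⊥ ∧ ∃ n, μ = ν + D.weight n}
  have hW : W.Finite := (G.biUnion S).finite_toSet.biUnion fun ν _ => D.finite_weights_above hbd ν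
  choose t ht1 ht2 ht3 using fun ν => D.exists_homogeneous_span N ν
  refine ⟨hW.toFinset.biUnion fun ν => (t ν).image fun y => (ν, y), ⟨?_, ?_, ?_, ?_⟩⟩
  · intro k hk
    obtain ⟨ν, -, hk⟩ := Finset.mem_biUnion.mp hk
    obtain ⟨y, hy, rfl⟩ := Finset.mem_image.mp hk
    exact ht1 ν y hy
  · intro k hk
    obtain ⟨ν, -, hk⟩ := Finset.mem_biUnion.mp hk
    obtain ⟨y, hy, rfl⟩ := Finset.mem_image.mp hk
    exact ht2 ν y hy
  · intro k hk j
    obtain ⟨ν, hν, hk⟩ := Finset.mem_biUnion.mp hk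
    obtain ⟨y, hy, rfl⟩ := Finset.mem_image.mp hk
    have h2 := D.algE_smul_mem j (ht1 ν y hy)
    by_cases h0 : Env.ι (D.algE j) • y.1 = 0
    · exact (congrArg (· ∈ Submodule.span ℂ _) h0).mpr (Submodule.zero_mem _)
    · have hνj : ν + D.root j ∈ W := by
        obtain ⟨ν', hν', h3, n, rfl⟩ := Set.mem_iUnion₂.mp (hW.mem_toFinset.mp hν)
        refine Set.mem_iUnion₂.mpr ⟨ν', hν', (Submodule.ne_bot_iff _).mpr ⟨_, h2, h0⟩,
          n + Finsupp.single j 1, ?_⟩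
        rw [weight_add, weight_single, add_assoc]
      refine Submodule.span_mono ?_ (ht3 _ h2)
      rintro _ ⟨y', hy', rfl⟩
      refine ⟨(ν + D.root j, y'), ⟨Finset.mem_biUnion.mpr ⟨_, hW.mem_toFinset.mpr hνj,
        Finset.mem_image_of_mem _ hy'⟩, rfl⟩, rfl⟩
  · rw [eq_top_iff, ← hG, Submodule.span_le]
    intro x hx
    rw [hsum x]
    refine Submodule.sum_mem _ fun ν hν => ?_
    by_cases h0 : w x ν = 0
    · rw [h0]; exact Submodule.zero_mem _
    have hνW : ν ∈ W := Set.mem_iUnion₂.mpr ⟨ν, Finset.mem_biUnion.mpr ⟨x, hx, hν⟩,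
      (Submodule.ne_bot_iff _).mpr ⟨_, hw x ν hν, h0⟩, 0, by rw [weight_zero, add_zero]⟩
    have h2 := ht3 ν (hw x ν hν)
    have h3 : Submodule.span ℂ (Prod.fst '' (t ν : Set (N × ZMod 2))) ≤
        (Submodule.span (Env D.Alg) ((fun k : Module.Dual ℂ H × N × ZMod 2 => k.2.1) ''
          (hW.toFinset.biUnion fun ν => (t ν).image fun y => (ν, y) :
            Finset (Module.Dual ℂ H × N × ZMod 2)))).restrictScalars ℂ := by
      refine Submodule.span_le.mpr ?_
      rintro _ ⟨y, hy, rfl⟩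
      exact Submodule.subset_span ⟨(ν, y), Finset.mem_coe.mpr (Finset.mem_biUnion.mpr
        ⟨ν, hW.mem_toFinset.mpr hνW, Finset.mem_image_of_mem _ hy⟩), rfl⟩
    exact h3 h2

lemma isWeightNilp_of_catO {N : D.Mod} (hN : D.catO N) (hM : D.catM i a N) :
    IsWeightNilp (D.envE i) (D.envH i) a N := D.isWeightNilp hN.1 hN.2.2 hM

/-- `C_a` maps `𝒪^fin(a)` to `𝒪^fin(-a)`. -/
lemma catOFin_enright [AdLocNilp (D.envE i)] [AdLocNilp (D.envF i)] (hi : D.A i i = 2)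
    (ha : ∀ n : ℤ, a ≠ n) (hab : a + b = 0) {N : D.Mod} (hN : D.catOFin i a N) :
    D.catOFin i b ((enright (D.envE i) (D.envF i) a).obj N) := by
  obtain ⟨hO, hfin, hM⟩ := hN
  have hE := D.isWeightNilp_of_catO hO hM
  obtain ⟨s, hs⟩ := D.exists_isTriangularFamily hO hfin
  obtain ⟨hbd, hfd⟩ := D.isSmall_enright_of_family hi ha hab _ _ _ N s _ rfl hE hs
  exact ⟨⟨D.iSup_weightSpace_enright hO.1, hfd, hbd⟩, finite_enright (D.isSl2 hi) ha hab hE hfin,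
    D.catM_of_isWeightNilp (isWeightNilp_enright (D.isSl2 hi) hab hE)⟩

end CartanDatum


/-! ### Simple highest weight modules -/

open LieSuperalgebra
open scoped ModuleCat

namespace CartanDatum

variable {ℓ : ℕ} {H : Type u} [AddCommGroup H] [Module ℂ H] (D : CartanDatum ℓ H) {i : Fin ℓ}
  {a b : ℂ}

lemma root_evenCoroot_smul_evenRoot (hi : D.A i i = 2) :
    D.root i (D.evenCoroot i) • D.evenRoot i = (2 : ℂ) • D.root i := by
  rcases D.parity_cases i with h | h
  · rw [D.evenCoroot_even h, D.evenRoot_even h, D.root_coroot_self hi]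
  · rw [D.root_evenCoroot_odd hi h, D.evenRoot_odd h, one_smul]

lemma refl_refl (hi : D.A i i = 2) (μ : Module.Dual ℂ H) : D.refl i (D.refl i μ) = μ := by
  simp only [refl, LinearMap.sub_apply, LinearMap.smul_apply, smul_eq_mul,
    D.evenRoot_evenCoroot hi]
  module

lemma refl_add (μ ν : Module.Dual ℂ H) : D.refl i (μ + ν) = D.refl i μ + D.refl i ν := by
  simp only [refl, LinearMap.add_apply]
  module

lemma refl_sub (μ ν : Module.Dual ℂ H) : D.refl i (μ - ν) = D.refl i μ - D.refl i ν := by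
  simp only [refl, LinearMap.sub_apply]
  module

lemma refl_root_self (hi : D.A i i = 2) : D.refl i (D.root i) = -D.root i := by
  rw [refl, D.root_evenCoroot_smul_evenRoot hi]
  module

lemma refl_sub_root_refl_sub_root (hi : D.A i i = 2) (μ : Module.Dual ℂ H) :
    D.refl i (D.refl i μ - D.root i) - D.root i = μ := by
  rw [refl_sub, D.refl_refl hi, D.refl_root_self hi, sub_neg_eq_add, add_sub_cancel_right]

lemma exists_refl_sub_root_evenCoroot (hi : D.A i i = 2) (hab : a + b = 0)
    {μ : Module.Dual ℂ H} (hμ : ∃ n : ℤ, μ (D.evenCoroot i) = a + n) :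
    ∃ n : ℤ, (D.refl i μ - D.root i) (D.evenCoroot i) = b + n := by
  obtain ⟨n, hn⟩ := hμ
  obtain ⟨m, hm⟩ := D.exists_root_evenCoroot hi i
  refine ⟨-n - m, ?_⟩
  simp only [refl, LinearMap.sub_apply, LinearMap.smul_apply, smul_eq_mul,
    D.evenRoot_evenCoroot hi, hn, hm]
  push_cast
  linear_combination -hab

section Verma

variable (μ : Module.Dual ℂ H) (q : ZMod 2)

/-- The highest weight vector of the Verma module. -/
def vermaVec : (ModuleCat.of (Env D.Alg) (D.verma μ q) : D.Mod) := (D.vermaIdeal μ q).mkQ 1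

lemma span_vermaVec : Submodule.span (Env D.Alg) {D.vermaVec μ q} = ⊤ := by
  refine eq_top_iff.mpr fun y _ => ?_
  obtain ⟨u, rfl⟩ := (D.vermaIdeal μ q).mkQ_surjective y
  refine Submodule.mem_span_singleton.mpr ⟨u, ?_⟩
  refine ((D.vermaIdeal μ q).mkQ.map_smul u 1).symm.trans ?_
  rw [smul_eq_mul, mul_one]

lemma smul_vermaVec (u : Env D.Alg) :
    u • D.vermaVec μ q = (D.vermaIdeal μ q).mkQ u := by
  refine ((D.vermaIdeal μ q).mkQ.map_smul u 1).symm.trans ?_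
  rw [smul_eq_mul, mul_one]

lemma isSingular_vermaVec : D.IsSingular _ μ q (D.vermaVec μ q) where
  e j := by
    rw [smul_vermaVec]
    exact (Submodule.Quotient.mk_eq_zero _).mpr
      (Submodule.subset_span (Or.inl (Or.inl ⟨_, D.algE_mem_nPlus j, rfl⟩)))
  wt := by
    rw [mem_weightSpace]
    intro x
    refine Eq.trans ?_ (algebraMap_smul (Env D.Alg) (μ x) (D.vermaVec μ q))
    rw [smul_vermaVec, smul_vermaVec]
    exact (Submodule.Quotient.eq _).mpr (Submodule.subset_span (Or.inl (Or.inr ⟨x, rfl⟩)))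
  par := by
    refine Eq.trans ?_ (algebraMap_smul (Env D.Alg) (sgn q) (D.vermaVec μ q))
    rw [smul_vermaVec, smul_vermaVec]
    exact (Submodule.Quotient.eq _).mpr (Submodule.subset_span (Or.inr rfl))

/-- A proper submodule of a highest weight module has no component in the highest weight space. -/
lemma IsSingular.le_of_ne_top {D : CartanDatum ℓ H} {N : D.Mod} {μ : Module.Dual ℂ H} {q : ZMod 2}
    {v : N} (hv : D.IsSingular N μ q v) (hspan : Submodule.span (Env D.Alg) {v} = ⊤)
    {P : Submodule (Env D.Alg) N} (hP : P ≠ ⊤) :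
    P.restrictScalars ℂ ≤ ⨆ β, ⨆ (_ : β ≠ μ), D.weightSpace N β := by
  intro p hp
  obtain ⟨s, w, hw, rfl⟩ := D.exists_sum_of_mem_iSup (v := p)
    (by rw [hv.iSup_weightSpace hspan]; trivial)
  have hwP := D.comp_mem_of_sum_mem_submodule P s w hw hp
  refine Submodule.sum_mem _ fun β hβ => ?_
  rcases eq_or_ne β μ with rfl | hne
  · have h1 := hw β hβ
    rw [hv.weightSpace_self hspan] at h1
    obtain ⟨c, hc⟩ := Submodule.mem_span_singleton.mp h1
    have h2 := hwP β hβ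
    rw [← hc] at h2 ⊢
    rcases eq_or_ne c 0 with rfl | hc0
    · rw [zero_smul]; exact Submodule.zero_mem _
    · refine absurd (eq_top_iff.mpr ?_) hP
      rw [← hspan, Submodule.span_singleton_le_iff_mem]
      have h3 := P.smul_mem (algebraMap ℂ (Env D.Alg) c⁻¹) h2
      rwa [algebraMap_smul, smul_smul, inv_mul_cancel₀ hc0, one_smul] at h3
  · exact Submodule.mem_iSup_of_mem β (Submodule.mem_iSup_of_mem hne (hw β hβ))

lemma isCoatom_sSup (h0 : D.vermaVec μ q ≠ 0) :
    IsCoatom (sSup {P : Submodule (Env D.Alg) (D.verma μ q) | P ≠ ⊤}) := by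
  have hv := D.isSingular_vermaVec μ q
  have hs := D.span_vermaVec μ q
  refine ⟨fun htop => h0 ?_, fun P hP => ?_⟩
  · have h1 : D.vermaVec μ q ∈
        ⨆ P : {P : Submodule (Env D.Alg) (D.verma μ q) | P ≠ ⊤}, P.1 := by
      rw [← sSup_eq_iSup', htop]; trivial
    have h2 : D.vermaVec μ q ∈ ⨆ β, ⨆ (_ : β ≠ μ), D.weightSpace _ β :=
      Submodule.iSup_induction _ (motive := fun x => x ∈ ⨆ β, ⨆ (_ : β ≠ μ),
        D.weightSpace (ModuleCat.of (Env D.Alg) (D.verma μ q)) β) h1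
        (fun P x hx => hv.le_of_ne_top hs P.2 hx) (Submodule.zero_mem _)
        (fun _ _ => Submodule.add_mem _)
    exact Submodule.disjoint_def.mp (D.iSupIndep_weightSpace _ μ) _ hv.wt h2
  · by_contra hne
    exact hP.not_ge (le_sSup hne)

/-- The highest weight vector of the simple module. -/
def simpleVec : D.simpleModule μ q :=
  (sSup {P : Submodule (Env D.Alg) (D.verma μ q) | P ≠ ⊤}).mkQ (D.vermaVec μ q)

lemma isSingular_simpleVec : D.IsSingular _ μ q (D.simpleVec μ q) :=
  (D.isSingular_vermaVec μ q).map (N' := D.simpleModule μ q)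
    (sSup {P : Submodule (Env D.Alg) (D.verma μ q) | P ≠ ⊤}).mkQ

lemma span_simpleVec : Submodule.span (Env D.Alg) {D.simpleVec μ q} = ⊤ := by
  refine eq_top_iff.mpr fun y _ => ?_
  obtain ⟨x, rfl⟩ := (sSup {P : Submodule (Env D.Alg) (D.verma μ q) | P ≠ ⊤}).mkQ_surjective y
  obtain ⟨u, rfl⟩ := Submodule.mem_span_singleton.mp
    (show x ∈ Submodule.span (Env D.Alg) {D.vermaVec μ q} by rw [D.span_vermaVec]; trivial)
  exact Submodule.mem_span_singleton.mpr ⟨u, ((sSup {P : Submodule (Env D.Alg) (D.verma μ q) |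
    P ≠ ⊤}).mkQ.map_smul u (D.vermaVec μ q)).symm⟩

lemma simpleVec_ne_zero [Nontrivial (D.simpleModule μ q)] : D.simpleVec μ q ≠ 0 := by
  intro h0
  have h1 := D.span_simpleVec μ q
  rw [h0, Submodule.span_singleton_eq_bot.mpr rfl] at h1
  exact bot_ne_top h1

lemma isSimpleModule_simpleModule [Nontrivial (D.simpleModule μ q)] :
    IsSimpleModule (Env D.Alg) (D.simpleModule μ q) := by
  refine isSimpleModule_iff_isCoatom.mpr (D.isCoatom_sSup μ q fun h0 => ?_)
  exact D.simpleVec_ne_zero μ q (by rw [simpleVec, h0, map_zero]; rfl)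

end Verma

/-- A simple module with a nonzero singular vector is the corresponding simple highest weight
module. -/
lemma IsSingular.nonempty_iso {D : CartanDatum ℓ H} {N : D.Mod} {μ : Module.Dual ℂ H} {q : ZMod 2}
    {v : N} (hv : D.IsSingular N μ q v) (hv0 : v ≠ 0) [hN : IsSimpleModule (Env D.Alg) N] :
    Nonempty (N ≅ D.simpleModule μ q) := by
  have hle : D.vermaIdeal μ q ≤ LinearMap.ker (LinearMap.toSpanSingleton (Env D.Alg) N v) := by
    refine Submodule.span_le.mpr ?_
    rintro u ((⟨x, hx, rfl⟩ | ⟨x, rfl⟩) | rfl) <;>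
      rw [SetLike.mem_coe, LinearMap.mem_ker, LinearMap.toSpanSingleton_apply]
    · exact Env.posPart_smul_eq_zero D.algGens hv.e (D.nPlus_le hx)
    · rw [sub_smul, algebraMap_smul, D.mem_weightSpace.mp hv.wt, sub_self]
    · rw [sub_smul, algebraMap_smul, hv.par, sub_self]
  let g : D.verma μ q →ₗ[Env D.Alg] N := (D.vermaIdeal μ q).liftQ _ hle
  have hgv : g (D.vermaVec μ q) = v :=
    ((D.vermaIdeal μ q).liftQ_apply _ 1).trans (one_smul _ v)
  have hsurj : Function.Surjective g := by
    refine LinearMap.range_eq_top.mp ((eq_bot_or_eq_top (LinearMap.range g)).resolve_left fun h => ?_)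
    exact hv0 ((Submodule.mem_bot (Env D.Alg)).mp (h ▸ ⟨_, hgv⟩))
  have hco : IsCoatom (LinearMap.ker g) :=
    isSimpleModule_iff_isCoatom.mp (IsSimpleModule.congr (g.quotKerEquivOfSurjective hsurj))
  have hco' := D.isCoatom_sSup μ q fun h0 => hv0 (by rw [← hgv, h0, map_zero])
  have heq : LinearMap.ker g = sSup {P : Submodule (Env D.Alg) (D.verma μ q) | P ≠ ⊤} := by
    by_contra hne
    exact hco'.1 (hco.2 _ (lt_of_le_of_ne (le_sSup hco.1) hne))
  exact ⟨((g.quotKerEquivOfSurjective hsurj).symm.trans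
    (Submodule.quotEquivOfEq _ _ heq)).toModuleIso⟩

section

variable [AdLocNilp (D.envE i)] [AdLocNilp (D.envF i)]

lemma nonempty_enright_iso_of_nontrivial (hi : D.A i i = 2) (ha : ∀ n : ℤ, a ≠ n)
    (hab : a + b = 0) {μ : Module.Dual ℂ H} {q : ZMod 2}
    (hμ : ∃ n : ℤ, μ (D.evenCoroot i) = a + n) [Nontrivial (D.simpleModule μ q)] :
    IsSimpleModule (Env D.Alg)
      ((enright (D.envE i) (D.envF i) a).obj (D.simpleModule μ q)) ∧
    Nonempty ((enright (D.envE i) (D.envF i) a).obj (D.simpleModule μ q) ≅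
      D.simpleModule (D.refl i μ - D.root i) (q + D.p i)) := by
  have hv := D.isSingular_simpleVec μ q
  have hs := D.span_simpleVec μ q
  have hN : IsWeightNilp (D.envE i) (D.envH i) a (D.simpleModule μ q) :=
    D.isWeightNilp (hv.iSup_weightSpace hs) (hv.isBounded hs) (hv.catM hs hi hμ)
  have hsimple := D.isSimpleModule_simpleModule μ q
  have hsimple' := isSimpleModule_enright (f := D.envF i) (D.isSl2 hi) ha hab hN
  obtain ⟨z, hz, hz0, -⟩ := hv.enright hi ha hab hN hμ
  exact ⟨hsimple', hz.nonempty_iso (hz0 (D.simpleVec_ne_zero μ q))⟩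

/-- The Enright functor takes `L(μ)` to `L(r_α.μ)`. That both modules vanish simultaneously (in
fact neither does) follows by applying `C_{-a}`. -/
lemma nonempty_enright_iso (hi : D.A i i = 2) (ha : ∀ n : ℤ, a ≠ n)
    (hab : a + b = 0) {μ : Module.Dual ℂ H} {q : ZMod 2}
    (hμ : ∃ n : ℤ, μ (D.evenCoroot i) = a + n) :
    Nonempty ((enright (D.envE i) (D.envF i) a).obj (D.simpleModule μ q) ≅
      D.simpleModule (D.refl i μ - D.root i) (q + D.p i)) := by
  have hb : ∀ n : ℤ, b ≠ n := fun n hn => ha (-n) (by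
    push_cast; rw [← hn]; exact eq_neg_of_add_eq_zero_left hab)
  rcases subsingleton_or_nontrivial (D.simpleModule μ q) with h | h
  · have h1 : Subsingleton ((enright (D.envE i) (D.envF i) a).obj (D.simpleModule μ q)) := by
      have h2 : ∀ z : (enright (D.envE i) (D.envF i) a).obj (D.simpleModule μ q), z.1 = 0 :=
        fun z => by
          obtain ⟨k, v, hv⟩ := exists_twistedVec z.1
          rw [hv, Subsingleton.elim v 0, twistedVec_zero]
      exact ⟨fun z z' => Subtype.ext ((h2 z).trans (h2 z').symm)⟩
    have h3 : Subsingleton (D.simpleModule (D.refl i μ - D.root i) (q + D.p i)) := by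
      by_contra hne
      rw [not_subsingleton_iff_nontrivial] at hne
      obtain ⟨hs, ⟨φ⟩⟩ := D.nonempty_enright_iso_of_nontrivial (q := q + D.p i) hi hb
        ((add_comm b a).trans hab) (D.exists_refl_sub_root_evenCoroot hi hab hμ)
      have hq : ∀ q k : ZMod 2, q + k + k = q := by decide
      rw [D.refl_sub_root_refl_sub_root hi, hq] at φ
      have h4 := φ.toLinearEquiv.toEquiv.subsingleton
      have h5 := hs.nontrivial
      exact not_subsingleton _ h4
    exact ⟨(ModuleCat.isZero_of_subsingleton _).iso (ModuleCat.isZero_of_subsingleton _)⟩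
  · exact (D.nonempty_enright_iso_of_nontrivial hi ha hab hμ).2

end

end CartanDatum


/-! ### Root multiplicities -/

open LieSuperalgebra
open scoped ModuleCat

namespace CartanDatum

variable {ℓ : ℕ} {H : Type u} [AddCommGroup H] [Module ℂ H] (D : CartanDatum ℓ H) {i : Fin ℓ}

/-- The adjoint action of `𝔰𝔩₂(α)`. -/
lemma isSl2_br (hi : D.A i i = 2) :
    IsSl2 (br (D.sl2E i)) (br (D.sl2F i)) (br (D.algH (D.evenCoroot i))) := by
  have h1 : ∀ x y : D.Alg, θ x = x → br x * br y - br y * br x = br (br x y) := by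
    intro x y hx
    refine LinearMap.ext fun z => ?_
    rw [LinearMap.sub_apply, Module.End.mul_apply, Module.End.mul_apply,
      ChevalleyGens.even_jac x hx, add_sub_cancel_right]
  refine ⟨?_, ?_, ?_⟩
  · rw [h1 _ _ (D.θ_sl2E i), D.br_sl2E_sl2F hi]
  · rw [h1 (D.algH _) _ (D.algGens.t_par _), D.br_algH_sl2E, D.evenRoot_evenCoroot hi, map_smul, two_smul,
      two_mul]
  · rw [h1 (D.algH _) _ (D.algGens.t_par _), D.br_algH_sl2F, D.evenRoot_evenCoroot hi, map_neg, map_smul,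
      two_smul, two_mul]

lemma br_mem_rootSpace {β γ : Module.Dual ℂ H} {x y : D.Alg} (hx : x ∈ D.rootSpace β)
    (hy : y ∈ D.rootSpace γ) : br x y ∈ D.rootSpace (γ + β) := by
  rw [mem_rootSpace] at *
  intro h
  refine (D.algGens.t_jac h x y).trans ?_
  have h1 : br (D.algGens.t h) x = β h • x := hx h
  have h2 : br (D.algGens.t h) y = γ h • y := hy h
  rw [h1, h2, map_smul, map_smul, LinearMap.smul_apply, LinearMap.add_apply]
  module

lemma br_pow_mem_rootSpace {β γ : Module.Dual ℂ H} {x y : D.Alg} (hx : x ∈ D.rootSpace β)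
    (hy : y ∈ D.rootSpace γ) (n : ℕ) : (br x ^ n) y ∈ D.rootSpace (γ + n • β) := by
  induction n with
  | zero => simpa using hy
  | succ n ih =>
    rw [pow_succ', Module.End.mul_apply, succ_nsmul, ← add_assoc]
    exact D.br_mem_rootSpace hx ih

lemma sl2E_mem_rootSpace : D.sl2E i ∈ D.rootSpace (D.evenRoot i) :=
  D.mem_rootSpace.mpr fun x => D.br_algH_sl2E x

lemma sl2F_mem_rootSpace : D.sl2F i ∈ D.rootSpace (-D.evenRoot i) :=
  D.mem_rootSpace.mpr fun x => (D.br_algH_sl2F x).trans (by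
    rw [LinearMap.neg_apply, neg_smul])

lemma exists_weight_evenCoroot (hi : D.A i i = 2) (n : Fin ℓ →₀ ℕ) :
    ∃ k : ℤ, D.weight n (D.evenCoroot i) = k := by
  choose m hm using D.exists_root_evenCoroot hi
  refine ⟨∑ j, n j * m j, ?_⟩
  rw [weight_apply]
  push_cast
  simp only [hm]

/-- The powers of the nilpotent operators `ad e` and `ad f` embed `𝔤_β` into `𝔤_{r_α β}`. -/
lemma rank_rootSpace_le (hi : D.A i i = 2) (β : Module.Dual ℂ H) :
    Module.rank ℂ (D.rootSpace β) ≤ Module.rank ℂ (D.rootSpace (D.refl i β)) := by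
  by_cases h0 : D.rootSpace β = ⊥
  · rw [h0, rank_bot]; exact zero_le
  obtain ⟨m, hm⟩ : ∃ m : ℤ, β (D.evenCoroot i) = m := by
    obtain ⟨n, rfl | rfl⟩ := D.exists_of_rootSpace_ne_bot h0
    · exact D.exists_weight_evenCoroot hi n
    · obtain ⟨k, hk⟩ := D.exists_weight_evenCoroot hi n
      exact ⟨-k, by rw [LinearMap.neg_apply, hk]; push_cast; rfl⟩
  have S := D.isSl2_br hi
  have inj : ∀ (g : Module.End ℂ D.Alg), (∀ x ∈ D.rootSpace β, g x ∈ D.rootSpace (D.refl i β)) →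
      (∀ x ∈ D.rootSpace β, g x = 0 → x = 0) →
      Module.rank ℂ (D.rootSpace β) ≤ Module.rank ℂ (D.rootSpace (D.refl i β)) := by
    intro g h1 h2
    refine LinearMap.rank_le_of_injective (g.restrict h1) ((injective_iff_map_eq_zero _).mpr ?_)
    rintro ⟨x, hx⟩ h
    exact Subtype.ext (h2 x hx (congrArg Subtype.val h))
  obtain ⟨k, rfl | rfl⟩ := Int.eq_nat_or_neg m
  · refine inj (br (D.sl2F i) ^ k) (fun x hx => ?_) (fun x hx h => ?_)
    · convert D.br_pow_mem_rootSpace (D.sl2F_mem_rootSpace (i := i)) hx k using 2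
      rw [refl, hm, smul_neg, ← sub_eq_add_neg, Int.cast_natCast, Nat.cast_smul_eq_nsmul]
    · obtain ⟨n, hn⟩ := D.adLocNilp_e i hi (4 : ℂ)⁻¹ x
      refine S.eq_zero_of_f_pow_smul n k x ?_ hn h
      have := D.mem_rootSpace.mp hx (D.evenCoroot i)
      rwa [hm, Int.cast_natCast] at this
  · refine inj (br (D.sl2E i) ^ k) (fun x hx => ?_) (fun x hx h => ?_)
    · convert D.br_pow_mem_rootSpace (D.sl2E_mem_rootSpace (i := i)) hx k using 2
      rw [refl, hm, Int.cast_neg, Int.cast_natCast, neg_smul, sub_neg_eq_add,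
        Nat.cast_smul_eq_nsmul]
    · obtain ⟨n, hn⟩ := D.adLocNilp_f i hi (-(4 : ℂ)⁻¹) x
      refine S.symm.eq_zero_of_f_pow_smul n k x ?_ hn h
      have := D.mem_rootSpace.mp hx (D.evenCoroot i)
      rw [hm, Int.cast_neg, Int.cast_natCast, neg_smul] at this
      rw [neg_smul]
      exact neg_eq_iff_eq_neg.mpr this

/-- Root multiplicities are invariant under `r_α`. -/
lemma finrank_rootSpace_refl (hi : D.A i i = 2) (β : Module.Dual ℂ H) :
    Module.finrank ℂ (D.rootSpace (D.refl i β)) = Module.finrank ℂ (D.rootSpace β) := by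
  have h1 := D.rank_rootSpace_le hi (D.refl i β)
  rw [D.refl_refl hi] at h1
  exact congrArg Cardinal.toNat (le_antisymm h1 (D.rank_rootSpace_le hi β))

/-! Multiples of the simple root `α_i`. -/

lemma monDeg_apply_pos (l : List (Fin ℓ)) (k j : Fin ℓ) (hj : j ∈ l ∨ j = k) :
    0 < ChevalleyGens.monDeg l k j := by
  induction l with
  | nil =>
    obtain rfl := hj.resolve_left (List.not_mem_nil)
    simp [ChevalleyGens.monDeg_nil]
  | cons m l ih =>
    rw [ChevalleyGens.monDeg_cons, Finsupp.add_apply]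
    rcases hj with hj | hj
    · rcases List.mem_cons.mp hj with rfl | hj
      · simp
      · exact Nat.add_pos_right _ (ih (Or.inl hj))
    · exact Nat.add_pos_right _ (ih (Or.inr hj))

lemma degree_monDeg (l : List (Fin ℓ)) (k : Fin ℓ) :
    (ChevalleyGens.monDeg l k).degree = l.length + 1 := by
  induction l with
  | nil => simp [ChevalleyGens.monDeg_nil]
  | cons m l ih =>
    rw [ChevalleyGens.monDeg_cons, map_add, ih, Finsupp.degree_single, List.length_cons, add_comm]

lemma monDeg_eq_single {l : List (Fin ℓ)} {k : Fin ℓ} {c : ℕ} :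
    ChevalleyGens.monDeg l k = Finsupp.single i (c + 1) ↔ l = List.replicate c i ∧ k = i := by
  constructor
  · intro h
    have h1 : ∀ j, j ∈ l ∨ j = k → j = i := by
      intro j hj
      have h2 := monDeg_apply_pos l k j hj
      rw [h] at h2
      by_contra hne
      rw [Finsupp.single_eq_of_ne hne] at h2
      exact lt_irrefl _ h2
    have h3 := degree_monDeg l k
    rw [h, Finsupp.degree_single] at h3
    exact ⟨List.eq_replicate_iff.mpr ⟨by omega, fun j hj => h1 j (Or.inl hj)⟩, h1 k (Or.inr rfl)⟩
  · rintro ⟨rfl, rfl⟩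
    induction c with
    | zero => rfl
    | succ c ih =>
      rw [List.replicate_succ, ChevalleyGens.monDeg_cons, ih, ← Finsupp.single_add, add_comm 1]

lemma rootSpace_single (c : ℕ) : D.rootSpace (D.weight (Finsupp.single i (c + 1))) =
    Submodule.span ℂ {(br (D.algE i) ^ c) (D.algE i)} := by
  rw [D.rootSpace_weight (by simp)]
  congr 1
  have h1 : {q : List (Fin ℓ) × Fin ℓ | ChevalleyGens.monDeg q.1 q.2 = Finsupp.single i (c + 1)} =
      {(List.replicate c i, i)} := by
    ext ⟨l, k⟩
    simp only [Set.mem_ofPred_eq, monDeg_eq_single, Set.mem_singleton_iff, Prod.mk.injEq]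
  rw [h1, Set.image_singleton]
  congr 1
  induction c with
  | zero => rfl
  | succ c ih =>
    rw [pow_succ', Module.End.mul_apply, ← ih (by
      ext ⟨l, k⟩
      simp only [Set.mem_ofPred_eq, monDeg_eq_single, Set.mem_singleton_iff, Prod.mk.injEq])]
    rfl

variable (hi : D.A i i = 2) (h0 : D.algH (D.evenCoroot i) ≠ 0)

include hi h0

lemma sl2E_ne_zero : D.sl2E i ≠ 0 := fun h => h0 (by
  rw [← D.br_sl2E_sl2F hi, h, map_zero, LinearMap.zero_apply])

lemma algE_ne_zero : D.algE i ≠ 0 := fun h => D.sl2E_ne_zero hi h0 (by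
  rcases D.parity_cases i with hp | hp
  · rw [D.sl2E_even hp, h]
  · rw [D.sl2E_odd hp, h, map_zero, smul_zero])

lemma finrank_rootSpace_one :
    Module.finrank ℂ (D.rootSpace (D.weight (Finsupp.single i 1))) = 1 := by
  rw [show (1 : ℕ) = 0 + 1 from rfl, rootSpace_single]
  exact finrank_span_singleton (D.algE_ne_zero hi h0)

omit hi h0 in
lemma finrank_rootSpace_even (hp : D.p i = 0) (c : ℕ) :
    Module.finrank ℂ (D.rootSpace (D.weight (Finsupp.single i (c + 2)))) = 0 := by
  have h1 : br (D.algE i) (D.algE i) = 0 := by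
    have := skew _ _ _ _ (D.θ_algE i) (D.θ_algE i)
    rw [hp, mul_zero, sgn_zero, one_smul] at this
    exact (smul_eq_zero.mp (show (2 : ℂ) • br (D.algE i) (D.algE i) = 0 by
      linear_combination (norm := module) this)).resolve_left two_ne_zero
  rw [rootSpace_single, pow_succ, Module.End.mul_apply, h1, map_zero,
    Submodule.span_singleton_eq_bot.mpr rfl, finrank_bot]

lemma finrank_rootSpace_odd_two (hp : D.p i = 1) :
    Module.finrank ℂ (D.rootSpace (D.weight (Finsupp.single i 2))) = 1 := by
  rw [show (2 : ℕ) = 1 + 1 from rfl, rootSpace_single, pow_one]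
  refine finrank_span_singleton fun h => D.sl2E_ne_zero hi h0 ?_
  rw [D.sl2E_odd hp, h, smul_zero]

omit hi h0 in
lemma finrank_rootSpace_odd (c : ℕ) :
    Module.finrank ℂ (D.rootSpace (D.weight (Finsupp.single i (c + 3)))) = 0 := by
  rw [rootSpace_single, pow_add, Module.End.mul_apply, pow_two, Module.End.mul_apply,
    ChevalleyGens.br_self _ _ (D.θ_algE i), map_zero, Submodule.span_singleton_eq_bot.mpr rfl,
    finrank_bot]

end CartanDatum


/-! ### Kernels of `e_i` on weight spaces -/

open LieSuperalgebra
open scoped ModuleCat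

namespace CartanDatum

variable {ℓ : ℕ} {H : Type u} [AddCommGroup H] [Module ℂ H] (D : CartanDatum ℓ H) {i : Fin ℓ}
  {a b : ℂ}

/-- The space of vectors of weight `ν` killed by `e_i`. -/
def kerSpace (i : Fin ℓ) (N : D.Mod) (ν : Module.Dual ℂ H) : Submodule ℂ N :=
  D.weightSpace N ν ⊓ LinearMap.ker (Algebra.lsmul ℂ ℂ N (Env.ι (D.algE i)) : Module.End ℂ N)

/-- On a module with non-integral `h`-weights `e_i` is surjective: already `e f` is injective on the
finite-dimensional weight spaces. -/
lemma exists_algE_smul_eq (hi : D.A i i = 2) (ha : ∀ n : ℤ, a ≠ n) {N : D.Mod}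
    (hN : IsWeightNilp (D.envE i) (D.envH i) a N) {μ : Module.Dual ℂ H}
    [FiniteDimensional ℂ (D.weightSpace N μ)] {y : N} (hy : y ∈ D.weightSpace N μ) :
    ∃ x ∈ D.weightSpace N (μ - D.root i), Env.ι (D.algE i) • x = y := by
  have hm : ∀ x ∈ D.weightSpace N μ, D.envE i • D.envF i • x ∈ D.weightSpace N μ := fun x hx => by
    have := D.envE_smul_mem (i := i) (D.envF_smul_mem (i := i) hx)
    rwa [sub_add_cancel] at this
  let T : D.weightSpace N μ →ₗ[ℂ] D.weightSpace N μ :=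
    (Algebra.lsmul ℂ ℂ N (D.envE i) ∘ₗ Algebra.lsmul ℂ ℂ N (D.envF i)).restrict hm
  have hT : Function.Injective T := by
    refine (injective_iff_map_eq_zero T).mpr ?_
    rintro ⟨x, hx⟩ h
    by_contra hne
    have hx0 : x ≠ 0 := fun h0 => hne (Subtype.ext h0)
    obtain ⟨n, hn⟩ := D.weight_evenCoroot hN ((Submodule.ne_bot_iff _).mpr ⟨x, hx, hx0⟩)
    obtain ⟨k, hk⟩ := hN.nilp x
    refine hx0 ((D.isSl2 hi).eq_zero_of_e_smul_f_smul (c := a + n) (fun m hm => ha (m - n) ?_) ?_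
      (congrArg Subtype.val h) k hk)
    · push_cast; rw [← hm]; ring
    · rw [← hn]; exact D.mem_weightSpace.mp hx _
  obtain ⟨⟨x, hx⟩, hxy⟩ := LinearMap.injective_iff_surjective.mp hT ⟨y, hy⟩
  have hxy' : D.envE i • D.envF i • x = y := congrArg Subtype.val hxy
  have hfx := D.envF_smul_mem (i := i) hx
  rcases D.parity_cases i with h | h
  · rw [D.evenRoot_even h] at hfx
    rw [envE, D.sl2E_even h] at hxy'
    exact ⟨_, hfx, hxy'⟩
  · have h1 := D.algE_smul_mem i hfx
    rw [D.evenRoot_odd h, show μ - (2 : ℂ) • D.root i + D.root i = μ - D.root i by module] at h1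
    refine ⟨(2 : ℂ)⁻¹ • Env.ι (D.algE i) • D.envF i • x, Submodule.smul_mem _ _ h1, ?_⟩
    rw [smul_comm (Env.ι (D.algE i)) (2 : ℂ)⁻¹, ← hxy', D.envE_odd h, smul_assoc, mul_smul]

/-- The coefficients of `ch N`, multiplied by `1 - e^{-α_i}` and shifted, count the vectors killed
by `e_i`. -/
lemma finrank_kerSpace (hi : D.A i i = 2) (ha : ∀ n : ℤ, a ≠ n) {N : D.Mod}
    (hN : IsWeightNilp (D.envE i) (D.envH i) a N)
    (hfd : ∀ ν, FiniteDimensional ℂ (D.weightSpace N ν)) (ν : Module.Dual ℂ H) :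
    (Module.finrank ℂ (D.kerSpace i N ν) : ℚ) = D.ch N ν - D.ch N (ν + D.root i) := by
  let T : D.weightSpace N ν →ₗ[ℂ] D.weightSpace N (ν + D.root i) :=
    (Algebra.lsmul ℂ ℂ N (Env.ι (D.algE i)) : Module.End ℂ N).restrict
      fun x hx => D.algE_smul_mem i hx
  have h1 : LinearMap.range T = ⊤ := by
    refine LinearMap.range_eq_top.mpr ?_
    rintro ⟨y, hy⟩
    obtain ⟨x, hx, hxy⟩ := D.exists_algE_smul_eq hi ha hN hy
    rw [add_sub_cancel_right] at hx
    exact ⟨⟨x, hx⟩, Subtype.ext hxy⟩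
  have h2 := LinearMap.finrank_range_add_finrank_ker T
  rw [h1, finrank_top] at h2
  let κ : LinearMap.ker T ≃ₗ[ℂ] D.kerSpace i N ν :=
    { toFun := fun x => ⟨x.1.1, x.1.2, congrArg Subtype.val x.2⟩
      map_add' := fun _ _ => rfl
      map_smul' := fun _ _ => rfl
      invFun := fun y => ⟨⟨y.1, y.2.1⟩, Subtype.ext y.2.2⟩
      left_inv := fun _ => rfl
      right_inv := fun _ => rfl }
  rw [κ.finrank_eq] at h2
  rw [ch, ch, ← h2]
  push_cast
  ring

lemma rank_kerSpace_congr {N N' : D.Mod} (φ : N ≃ₗ[Env D.Alg] N') (ν : Module.Dual ℂ H) :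
    Module.rank ℂ (D.kerSpace i N ν) ≤ Module.rank ℂ (D.kerSpace i N' ν) := by
  let g : D.kerSpace i N ν →ₗ[ℂ] D.kerSpace i N' ν :=
    (φ.toLinearMap.restrictScalars ℂ).restrict fun v hv =>
      ⟨D.map_mem_weightSpace φ.toLinearMap hv.1, (φ.map_smul _ v).symm.trans
        ((congrArg φ hv.2).trans φ.map_zero)⟩
  refine LinearMap.rank_le_of_injective g ((injective_iff_map_eq_zero g).mpr fun v hv => ?_)
  exact Subtype.ext (φ.map_eq_zero_iff.mp (congrArg Subtype.val hv))

section

variable [AdLocNilp (D.envE i)] [AdLocNilp (D.envF i)]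

/-- `singMap` embeds the kernel of `e_i` on `N_ν` into that on the weight space of `C_a(N)` of the
reflected weight. -/
lemma rank_kerSpace_le (hi : D.A i i = 2) (ha : ∀ n : ℤ, a ≠ n) {N : D.Mod}
    (hN : IsWeightNilp (D.envE i) (D.envH i) a N) (ν : Module.Dual ℂ H) :
    Module.rank ℂ (D.kerSpace i N ν) ≤ Module.rank ℂ (D.kerSpace i
      ((enright (D.envE i) (D.envF i) a).obj N) (D.refl i ν - D.root i)) := by
  by_cases h0 : D.weightSpace N ν = ⊥
  · rw [kerSpace, h0, bot_inf_eq, rank_bot]; exact zero_le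
  obtain ⟨n, hn⟩ := D.weight_evenCoroot hN h0
  let g : D.kerSpace i N ν →ₗ[ℂ] D.kerSpace i ((enright (D.envE i) (D.envF i) a).obj N)
      (D.refl i ν - D.root i) :=
    { toFun := fun v => ⟨⟨D.singMap i a N n v.1, D.singMap_mem_eFinite hi hn v.2.1 v.2.2⟩,
        D.mem_weightSpace_enright.mpr (D.singMap_mem_weightSpace hn v.2.1),
        Subtype.ext (D.algE_smul_singMap hi hn v.2.1 v.2.2)⟩
      map_add' := fun v w => Subtype.ext (Subtype.ext (map_add (D.singMap i a N n) v.1 w.1))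
      map_smul' := fun c v => Subtype.ext (Subtype.ext ((D.singMap i a N n).map_smul c v.1)) }
  refine LinearMap.rank_le_of_injective g ((injective_iff_map_eq_zero g).mpr fun v hv => ?_)
  exact Subtype.ext (D.eq_zero_of_singMap hi ha hN hn v.2.1 v.2.2
    (congrArg (fun x => x.1.1) hv))

/-- Equality of dimensions follows by applying `rank_kerSpace_le` also to `C_{-a}(C_a N) ≅ N`. -/
lemma finrank_kerSpace_enright (hi : D.A i i = 2) (ha : ∀ n : ℤ, a ≠ n) (hab : a + b = 0)
    {N : D.Mod} (hN : IsWeightNilp (D.envE i) (D.envH i) a N) (ν : Module.Dual ℂ H) :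
    Module.finrank ℂ (D.kerSpace i ((enright (D.envE i) (D.envF i) a).obj N)
      (D.refl i ν - D.root i)) = Module.finrank ℂ (D.kerSpace i N ν) := by
  have hb : ∀ n : ℤ, b ≠ n := fun n hn => ha (-n) (by
    push_cast; rw [← hn]; exact eq_neg_of_add_eq_zero_left hab)
  refine congrArg Cardinal.toNat (le_antisymm ?_ (D.rank_kerSpace_le hi ha hN ν))
  have h1 := D.rank_kerSpace_le hi hb (isWeightNilp_enright (f := D.envF i) (D.isSl2 hi) hab hN)
    (D.refl i ν - D.root i)
  rw [D.refl_sub_root_refl_sub_root hi] at h1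
  exact h1.trans (D.rank_kerSpace_congr (enrightEnrightEquiv (D.isSl2 hi) ha hab hN) ν)

end

end CartanDatum


/-! ### Products of power series in monomials -/

section MonomialProducts

open MvPowerSeries

variable {σ : Type*}

lemma nat_eq_of_smul_eq_smul {m : σ →₀ ℕ} (hm : m ≠ 0) {c d : ℕ} (h : c • m = d • m) : c = d := by
  obtain ⟨j, hj⟩ := Finsupp.ne_iff.mp hm
  exact Nat.eq_of_mul_eq_mul_right (Nat.pos_of_ne_zero hj) (DFunLike.congr_fun h j)

lemma coeff_subst_monomial {m : σ →₀ ℕ} (hm : m ≠ 0) (f : PowerSeries ℚ) (c : ℕ) :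
    coeff (c • m) (f.subst (monomial m (1 : ℚ))) = PowerSeries.coeff c f := by
  classical
  rw [PowerSeries.coeff_subst (PowerSeries.HasSubst.monomial hm 1), finsum_eq_single _ c]
  · rw [monomial_pow, one_pow, coeff_monomial_same, smul_eq_mul, mul_one]
  · intro d hd
    rw [monomial_pow, coeff_monomial_ne, smul_zero]
    exact fun h => hd (nat_eq_of_smul_eq_smul hm h).symm

lemma exists_eq_smul_of_coeff_subst_monomial {m n : σ →₀ ℕ} (hm : m ≠ 0) {f : PowerSeries ℚ}
    (h : coeff n (f.subst (monomial m (1 : ℚ))) ≠ 0) : ∃ c : ℕ, n = c • m := by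
  classical
  by_contra! hne
  refine h ?_
  rw [PowerSeries.coeff_subst (PowerSeries.HasSubst.monomial hm 1)]
  refine finsum_eq_zero_of_forall_eq_zero fun d => ?_
  rw [monomial_pow, coeff_monomial_ne (hne d), smul_zero]

/-- The family of monomials `k_m • m`. -/
def termFamily (k : (σ →₀ ℕ) →₀ ℕ) : (σ →₀ ℕ) →₀ (σ →₀ ℕ) :=
  Finsupp.onFinset k.support (fun m => k m • m) fun m hm => by
    rw [Finsupp.mem_support_iff]
    exact fun h => hm (by rw [h, zero_smul])

lemma termFamily_apply (k : (σ →₀ ℕ) →₀ ℕ) (m : σ →₀ ℕ) : termFamily k m = k m • m := rfl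

/-- The coefficient at `n` of a product of series in distinct monomials, as a sum over all ways
`k` to write `n = ∑ k_m m`. Factors which are `1` or involve a monomial not dividing `n` do not
matter. -/
lemma coeff_prod_subst_monomial (f : (σ →₀ ℕ) → PowerSeries ℚ)
    (hf : ∀ m, PowerSeries.coeff 0 (f m) = 1) (n : σ →₀ ℕ) (S : Finset (σ →₀ ℕ)) (hS : 0 ∉ S)
    (hS' : ∀ m ≤ n, m ∉ S → f m = 1) :
    coeff n (∏ m ∈ S, (f m).subst (monomial m (1 : ℚ))) =
      ∑ᶠ k : (σ →₀ ℕ) →₀ ℕ, open Classical in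
        if k.sum (fun m c => c • m) = n then k.prod (fun m c => PowerSeries.coeff c (f m))
        else 0 := by
  classical
  set F : ((σ →₀ ℕ) →₀ ℕ) → ℚ := fun k =>
    if k.sum (fun m c => c • m) = n then k.prod (fun m c => PowerSeries.coeff c (f m)) else 0
    with hF
  have hsum : ∀ k, F k ≠ 0 → k.sum (fun m c => c • m) = n := fun k hk => by
    by_contra h; exact hk (if_neg h)
  have hsub : ∀ k, F k ≠ 0 → k.support ⊆ S := by
    intro k hk m hm
    have h1 := hsum k hk
    have h2 : k.prod (fun m c => PowerSeries.coeff c (f m)) ≠ 0 := by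
      rwa [hF, show (fun k => _) k = _ from rfl, if_pos h1] at hk
    by_contra hmS
    have h3 : k m • m ≤ n := by
      rw [← h1]
      exact Finset.single_le_sum (f := fun m => k m • m) (fun _ _ => zero_le) hm
    have h4 : k m ≠ 0 := Finsupp.mem_support_iff.mp hm
    have h5 : m ≤ n := le_trans (by
      calc m = 1 • m := (one_smul ℕ m).symm
        _ ≤ k m • m := smul_le_smul_of_nonneg_right (Nat.one_le_iff_ne_zero.mpr h4) zero_le) h3
    refine Finset.prod_ne_zero_iff.mp h2 m hm ?_
    change PowerSeries.coeff (k m) (f m) = 0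
    rw [hS' m h5 hmS, PowerSeries.coeff_one, if_neg h4]
  have hmaps : ∀ k, F k ≠ 0 → termFamily k ∈ Finset.finsuppAntidiag S n := by
    intro k hk
    rw [Finset.mem_finsuppAntidiag]
    refine ⟨?_, fun m hm => hsub k hk ?_⟩
    · rw [← hsum k hk]
      exact (Finsupp.sum_of_support_subset k (hsub k hk) (fun m c => c • m)
        fun m _ => zero_smul ℕ m).symm
    · rw [Finsupp.mem_support_iff, termFamily_apply] at hm
      exact Finsupp.mem_support_iff.mpr fun h => hm (by rw [h, zero_smul])
  have hinj : Set.InjOn termFamily (Function.support F) := by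
    intro k hk k' hk' h
    ext m
    by_cases hm : m ∈ S
    · have hm0 : m ≠ 0 := fun h0 => hS (h0 ▸ hm)
      exact nat_eq_of_smul_eq_smul hm0 (DFunLike.congr_fun h m)
    · rw [Finsupp.notMem_support_iff.mp fun h1 => hm (hsub k hk h1),
        Finsupp.notMem_support_iff.mp fun h1 => hm (hsub k' hk' h1)]
  have hval : ∀ k, F k ≠ 0 → F k = ∏ m ∈ S, coeff (termFamily k m)
      ((f m).subst (monomial m (1 : ℚ))) := by
    intro k hk
    rw [hF, show (fun k => _) k = _ from rfl, if_pos (hsum k hk),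
      Finsupp.prod_of_support_subset k (hsub k hk) _ fun m _ => hf m]
    refine Finset.prod_congr rfl fun m hm => ?_
    rw [termFamily_apply, coeff_subst_monomial fun h0 => hS (h0 ▸ hm)]
  have hfin : (Function.support F).Finite :=
    Set.Finite.of_injOn (t := ↑(Finset.finsuppAntidiag S n)) (fun k hk => hmaps k hk) hinj
      (Finset.finite_toSet _)
  rw [coeff_prod, finsum_eq_sum F hfin]
  symm
  refine Finset.sum_bij_ne_zero (fun k _ _ => termFamily k) (fun k _ hk => hmaps k hk)
    (fun k _ hk k' _ hk' h => hinj hk hk' h) (fun l hl hl0 => ?_) (fun k _ hk => hval k hk)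
  obtain ⟨hl1, hl2⟩ := Finset.mem_finsuppAntidiag.mp hl
  have h1 : ∀ m, ∃ c : ℕ, (m ∈ S → l m = c • m) ∧ (m ∉ S → c = 0) := by
    intro m
    by_cases hm : m ∈ S
    · obtain ⟨c, hc⟩ := exists_eq_smul_of_coeff_subst_monomial (fun h0 => hS (h0 ▸ hm))
        (Finset.prod_ne_zero_iff.mp hl0 m hm)
      exact ⟨c, fun _ => hc, fun h => absurd hm h⟩
    · exact ⟨0, fun h => absurd h hm, fun _ => rfl⟩
  choose c hc hc' using h1
  let k : (σ →₀ ℕ) →₀ ℕ := Finsupp.onFinset S c fun m hm => by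
    by_contra h; exact hm (hc' m h)
  have hk : k.support ⊆ S := Finsupp.support_onFinset_subset
  have hkl : termFamily k = l := by
    ext1 m
    by_cases hm : m ∈ S
    · exact (hc m hm).symm
    · rw [termFamily_apply, show k m = 0 from hc' m hm, zero_smul,
        Finsupp.notMem_support_iff.mp fun h => hm (hl2 h)]
  have hFk : F k = ∏ m ∈ S, coeff (l m) ((f m).subst (monomial m (1 : ℚ))) := by
    rw [hF, show (fun k => _) k = _ from rfl, if_pos,
      Finsupp.prod_of_support_subset k hk _ fun m _ => hf m]
    · refine Finset.prod_congr rfl fun m hm => ?_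
      rw [← hkl, termFamily_apply, coeff_subst_monomial fun h0 => hS (h0 ▸ hm)]
    · rw [Finsupp.sum_of_support_subset k hk (fun m c => c • m) fun m _ => zero_smul ℕ m, ← hl1]
      exact Finset.sum_congr rfl fun m hm => (hc m hm).symm
  have hFk0 : F k ≠ 0 := by rwa [hFk]
  exact ⟨k, hfin.mem_toFinset.mpr hFk0, hFk0, hkl⟩

lemma subst_inv_one_add_X {m : σ →₀ ℕ} (hm : m ≠ 0) :
    ((1 + PowerSeries.X : PowerSeries ℚ)⁻¹).subst (monomial m (1 : ℚ)) =
      (1 + monomial m (1 : ℚ))⁻¹ := by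
  have hs := PowerSeries.HasSubst.monomial hm (1 : ℚ)
  have h1 : (1 : PowerSeries ℚ).subst (monomial m (1 : ℚ)) = 1 := by
    rw [← PowerSeries.coe_substAlgHom hs, map_one]
  rw [MvPowerSeries.eq_inv_iff_mul_eq_one]
  · have h2 : (1 + monomial m (1 : ℚ) : MvPowerSeries σ ℚ) =
        (1 + PowerSeries.X : PowerSeries ℚ).subst (monomial m (1 : ℚ)) := by
      rw [PowerSeries.subst_add hs, PowerSeries.subst_X hs, h1]
    rw [h2, ← PowerSeries.subst_mul hs, PowerSeries.inv_mul_cancel _ (by simp), h1]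
  · classical
    rw [map_add, map_one, ← coeff_zero_eq_constantCoeff_apply, coeff_monomial_ne hm.symm,
      add_zero]
    exact one_ne_zero

end MonomialProducts


/-! ### The Weyl denominator -/

open LieSuperalgebra
open scoped ModuleCat

namespace CartanDatum

variable {ℓ : ℕ} {H : Type u} [AddCommGroup H] [Module ℂ H] (D : CartanDatum ℓ H) {i : Fin ℓ}

/-- The series in one variable from which `denomFactor n` arises by substituting `e^{-γ}`. -/
def denomSeries (n : Fin ℓ →₀ ℕ) : PowerSeries ℚ :=
  if D.weightParity n = 0 then
    (1 - PowerSeries.X) ^ Module.finrank ℂ (D.rootSpace (D.weight n))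
  else (1 + PowerSeries.X)⁻¹ ^ Module.finrank ℂ (D.rootSpace (D.weight n))

lemma denomFactor_eq_subst {n : Fin ℓ →₀ ℕ} (hn : n ≠ 0) :
    D.denomFactor n = (D.denomSeries n).subst (MvPowerSeries.monomial n (1 : ℚ)) := by
  have hs := PowerSeries.HasSubst.monomial hn (1 : ℚ)
  rw [denomFactor, denomSeries]
  split_ifs
  · have h1 : (1 : PowerSeries ℚ).subst (MvPowerSeries.monomial n (1 : ℚ)) = 1 := by
      rw [← PowerSeries.coe_substAlgHom hs, map_one]
    rw [PowerSeries.subst_pow hs, PowerSeries.subst_sub hs, PowerSeries.subst_X hs, h1]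
  · rw [PowerSeries.subst_pow hs, subst_inv_one_add_X hn]

lemma coeff_zero_denomSeries (n : Fin ℓ →₀ ℕ) : PowerSeries.coeff 0 (D.denomSeries n) = 1 := by
  rw [denomSeries]
  split_ifs <;> simp

lemma denomSeries_eq_one {n : Fin ℓ →₀ ℕ}
    (h : Module.finrank ℂ (D.rootSpace (D.weight n)) = 0) : D.denomSeries n = 1 := by
  rw [denomSeries, h, pow_zero, pow_zero, ite_self]

/-- `∑ m_j α_j` is not a multiple of `α_i`. -/
def IsTransverse (i : Fin ℓ) (m : Fin ℓ →₀ ℕ) : Prop := ∃ j, j ≠ i ∧ m j ≠ 0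

/-- The series of the factor of `γ` in the product of the `denomFactor γ` over all `γ` which are
not multiples of `α_i`. -/
def transSeries (i : Fin ℓ) (m : Fin ℓ →₀ ℕ) : PowerSeries ℚ :=
  open Classical in if IsTransverse i m then D.denomSeries m else 1

/-- The coefficient of `e^{-γ}` in the product of the `denomFactor`s of all elements of `Q⁺` which
are not multiples of `α_i`, written as a sum over all ways to write `γ` as a sum of such
elements. -/
def transDenom (i : Fin ℓ) (γ : Module.Dual ℂ H) : ℚ :=
  ∑ᶠ k : (Fin ℓ →₀ ℕ) →₀ ℕ, open Classical in
    if k.sum (fun m c => c • D.weight m) = γ then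
      k.prod (fun m c => PowerSeries.coeff c (D.transSeries i m)) else 0

lemma coeff_zero_transSeries (n : Fin ℓ →₀ ℕ) :
    PowerSeries.coeff 0 (D.transSeries i n) = 1 := by
  classical
  rw [transSeries]
  split_ifs
  · exact D.coeff_zero_denomSeries n
  · simp

lemma weight_sum_smul (k : (Fin ℓ →₀ ℕ) →₀ ℕ) :
    D.weight (k.sum fun m c => c • m) = k.sum fun m c => c • D.weight m := by
  let w : (Fin ℓ →₀ ℕ) →+ Module.Dual ℂ H := ⟨⟨D.weight, D.weight_zero⟩, D.weight_add⟩
  have h := map_finsuppSum w k fun m c => c • m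
  simp only [map_nsmul] at h
  exact h

lemma exists_weight_of_transDenom_ne_zero {γ : Module.Dual ℂ H} (h : D.transDenom i γ ≠ 0) :
    ∃ n, γ = D.weight n := by
  classical
  by_contra! hne
  refine h (finsum_eq_zero_of_forall_eq_zero fun k => if_neg fun hk => ?_)
  rw [← weight_sum_smul] at hk
  exact hne _ hk.symm

open Classical in
lemma transDenom_weight {n : Fin ℓ →₀ ℕ} {S : Finset (Fin ℓ →₀ ℕ)} (hS0 : 0 ∉ S)
    (hS : ∀ m ≤ n, m ≠ 0 → m ∈ S) : D.transDenom i (D.weight n) =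
      MvPowerSeries.coeff n (∏ m ∈ S with IsTransverse i m, D.denomFactor m) := by
  have h1 : ∏ m ∈ S with IsTransverse i m, D.denomFactor m = ∏ m ∈ S with IsTransverse i m,
      (D.transSeries i m).subst (MvPowerSeries.monomial m (1 : ℚ)) := by
    refine Finset.prod_congr rfl fun m hm => ?_
    obtain ⟨hm, hm'⟩ := Finset.mem_filter.mp hm
    rw [transSeries, if_pos hm', D.denomFactor_eq_subst fun h => hS0 (h ▸ hm)]
  rw [h1, coeff_prod_subst_monomial _ D.coeff_zero_transSeries, transDenom]
  · refine finsum_congr fun k => ?_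
    rw [← weight_sum_smul]
    simp only [D.weight_injective.eq_iff]
    congr
  · exact fun h => hS0 (Finset.mem_filter.mp h).1
  · intro m hm hmS
    rw [transSeries, if_neg]
    intro ht
    refine hmS (Finset.mem_filter.mpr ⟨hS m hm ?_, ht⟩)
    rintro rfl
    obtain ⟨j, -, hj⟩ := ht
    exact hj rfl

lemma weightParity_single (c : ℕ) : D.weightParity (Finsupp.single i c) = c * D.p i := by
  rw [weightParity, Finset.sum_eq_single i (fun j _ hj => by simp [hj.symm]) (by simp),
    Finsupp.single_eq_same]

lemma eq_single_of_not_isTransverse {m : Fin ℓ →₀ ℕ} (hm : ¬ IsTransverse i m) :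
    m = Finsupp.single i (m i) := by
  ext j
  by_cases hj : j = i
  · rw [hj, Finsupp.single_eq_same]
  · rw [Finsupp.single_eq_of_ne hj]
    by_contra h
    exact hm ⟨j, hj, h⟩

lemma not_isTransverse_single (c : ℕ) : ¬ IsTransverse i (Finsupp.single i c) := by
  rintro ⟨j, hj, h⟩
  exact h (Finsupp.single_eq_of_ne hj)

open Classical in
/-- The multiples of `α_i` contribute `1 - e^{-α_i}` to the Weyl denominator: for odd `α_i` this is
`(1 - e^{-2 α_i}) / (1 + e^{-α_i})`. -/
lemma prod_denomFactor_not_isTransverse (hi : D.A i i = 2)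
    (h0 : D.algH (D.evenCoroot i) ≠ 0) {S : Finset (Fin ℓ →₀ ℕ)} (hS0 : 0 ∉ S)
    (h1 : Finsupp.single i 1 ∈ S) (h2 : Finsupp.single i 2 ∈ S) :
    ∏ m ∈ S with ¬ IsTransverse i m, D.denomFactor m =
      1 - MvPowerSeries.monomial (Finsupp.single i 1) 1 := by
  have hne : Finsupp.single i 1 ≠ Finsupp.single i 2 := fun h => by
    have := DFunLike.congr_fun h i
    simp at this
  have hone : ∀ m, Module.finrank ℂ (D.rootSpace (D.weight m)) = 0 → D.denomFactor m = 1 :=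
    fun m hm => by rw [denomFactor, hm, pow_zero, pow_zero, ite_self]
  have hsub : ({Finsupp.single i 1, Finsupp.single i 2} : Finset (Fin ℓ →₀ ℕ)) ⊆
      {m ∈ S | ¬ IsTransverse i m} := by
    intro m hm
    rw [Finset.mem_insert, Finset.mem_singleton] at hm
    rcases hm with rfl | rfl
    · exact Finset.mem_filter.mpr ⟨h1, not_isTransverse_single _⟩
    · exact Finset.mem_filter.mpr ⟨h2, not_isTransverse_single _⟩
  rw [← Finset.prod_subset hsub, Finset.prod_pair hne]
  · rcases D.parity_cases i with hp | hp
    · rw [hone _ (D.finrank_rootSpace_even hp 0), mul_one, denomFactor, weightParity_single, hp,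
        mul_zero, if_pos rfl, D.finrank_rootSpace_one hi h0, pow_one]
    · have hX : (MvPowerSeries.monomial (Finsupp.single i 2) (1 : ℚ)) =
          MvPowerSeries.monomial (Finsupp.single i 1) (1 : ℚ) ^ 2 := by
        rw [MvPowerSeries.monomial_pow, one_pow, Finsupp.smul_single, smul_eq_mul]
      rw [denomFactor, denomFactor, weightParity_single, weightParity_single, hp,
        D.finrank_rootSpace_one hi h0, D.finrank_rootSpace_odd_two hi h0 hp, pow_one, pow_one,
        if_neg (by decide), if_pos (by decide), pow_one, hX,
        show ∀ x : MvPowerSeries (Fin ℓ) ℚ, 1 - x ^ 2 = (1 + x) * (1 - x) from fun x => by ring,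
        ← mul_assoc, MvPowerSeries.inv_mul_cancel, one_mul]
      rw [map_add, map_one, ← MvPowerSeries.coeff_zero_eq_constantCoeff_apply,
        MvPowerSeries.coeff_monomial_ne (by simp [eq_comm]), add_zero]
      exact one_ne_zero
  · intro m hm hm'
    obtain ⟨hmS, ht⟩ := Finset.mem_filter.mp hm
    have hmi := eq_single_of_not_isTransverse ht
    refine hone m ?_
    rcases h : m i with _ | _ | _ | c
    · rw [h, Finsupp.single_zero] at hmi
      exact absurd (hmi ▸ hmS) hS0
    · rw [h] at hmi
      exact absurd (by simp [hmi]) hm'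
    · rw [h] at hmi
      exact absurd (by simp [hmi]) hm'
    · rw [hmi, h]
      rcases D.parity_cases i with hp | hp
      · exact D.finrank_rootSpace_even hp (c + 1)
      · exact D.finrank_rootSpace_odd c

/-- The factorization `R = (1 - e^{-α_i}) R'` in terms of coefficients. -/
lemma coeff_weylDenom (hi : D.A i i = 2) (h0 : D.algH (D.evenCoroot i) ≠ 0)
    (n : Fin ℓ →₀ ℕ) : MvPowerSeries.coeff n D.weylDenom =
      D.transDenom i (D.weight n) - D.transDenom i (D.weight n - D.root i) := by
  classical
  -- The product may be taken over any larger finite set; this one contains `α_i` and `2 α_i`.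
  set S : Finset (Fin ℓ →₀ ℕ) := (Finset.Iic (n + Finsupp.single i 2)).erase 0 with hSdef
  have hS0 : 0 ∉ S := Finset.notMem_erase _ _
  have hS : ∀ m ≤ n, m ≠ 0 → m ∈ S := fun m hm hm0 => Finset.mem_erase.mpr
    ⟨hm0, Finset.mem_Iic.mpr (hm.trans (le_add_right le_rfl))⟩
  let f : (Fin ℓ →₀ ℕ) → PowerSeries ℚ := fun m => if m = 0 then 1 else D.denomSeries m
  have hf : ∀ m, PowerSeries.coeff 0 (f m) = 1 := fun m => by
    change PowerSeries.coeff 0 (if m = 0 then 1 else D.denomSeries m) = 1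
    split_ifs
    · simp
    · exact D.coeff_zero_denomSeries m
  have hprod : ∀ T : Finset (Fin ℓ →₀ ℕ), 0 ∉ T → ∏ m ∈ T, D.denomFactor m =
      ∏ m ∈ T, (f m).subst (MvPowerSeries.monomial m (1 : ℚ)) := fun T hT =>
    Finset.prod_congr rfl fun m hm => by
      have hm0 : m ≠ 0 := fun h => hT (h ▸ hm)
      rw [show f m = D.denomSeries m from if_neg hm0, D.denomFactor_eq_subst hm0]
  have h1 : MvPowerSeries.coeff n D.weylDenom =
      MvPowerSeries.coeff n (∏ m ∈ S, D.denomFactor m) := by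
    have hI : (0 : Fin ℓ →₀ ℕ) ∉ (Finset.Iic n).erase 0 := Finset.notMem_erase _ _
    change MvPowerSeries.coeff n (∏ m ∈ (Finset.Iic n).erase 0, D.denomFactor m) = _
    rw [hprod _ hS0, hprod _ hI, coeff_prod_subst_monomial f hf n _ hS0,
      coeff_prod_subst_monomial f hf n _ hI]
    · exact fun m hm hmI => if_pos (not_not.mp fun h0 =>
        hmI (Finset.mem_erase.mpr ⟨h0, Finset.mem_Iic.mpr hm⟩))
    · exact fun m hm hmS => if_pos (not_not.mp fun h0 => hmS (hS m hm h0))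
  have hle : Finsupp.single i 1 ≤ Finsupp.single i 2 := Finsupp.single_mono (by omega)
  rw [h1, ← Finset.prod_filter_mul_prod_filter_not S (IsTransverse i),
    D.prod_denomFactor_not_isTransverse hi h0 hS0
      (Finset.mem_erase.mpr ⟨by simp, Finset.mem_Iic.mpr (hle.trans (le_add_left le_rfl))⟩)
      (Finset.mem_erase.mpr ⟨by simp, Finset.mem_Iic.mpr (le_add_left le_rfl)⟩),
    mul_sub, mul_one, map_sub, ← D.transDenom_weight hS0 hS, MvPowerSeries.coeff_mul_monomial]
  congr 1
  split_ifs with hn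
  · obtain ⟨m, rfl⟩ := exists_add_of_le hn
    rw [add_tsub_cancel_left, mul_one, weight_add, weight_single, add_sub_cancel_left,
      D.transDenom_weight hS0 fun m' hm' => hS m' (hm'.trans (le_add_left le_rfl))]
  · by_contra hne
    obtain ⟨m, hm⟩ := D.exists_weight_of_transDenom_ne_zero (Ne.symm hne)
    rw [sub_eq_iff_eq_add, ← weight_single, ← weight_add] at hm
    exact hn (D.weight_injective hm ▸ le_add_left le_rfl)

/-! ### Reflection invariance of the transverse part of the denominator -/

/-- The reflection of a positive root which is not a multiple of `α_i` is a positive root of the same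
kind and parity. -/
lemma exists_weight_eq_refl (hi : D.A i i = 2) {m : Fin ℓ →₀ ℕ} (hm : IsTransverse i m)
    (hr : Module.finrank ℂ (D.rootSpace (D.weight m)) ≠ 0) :
    ∃ m', D.weight m' = D.refl i (D.weight m) ∧ IsTransverse i m' ∧
      D.weightParity m' = D.weightParity m := by
  obtain ⟨k, hk⟩ := D.exists_weight_evenCoroot hi m
  obtain ⟨s, hs, hsp⟩ : ∃ s : ℤ, D.evenRoot i = (s : ℂ) • D.root i ∧
      (s : ZMod 2) * D.p i = 0 := by
    rcases D.parity_cases i with hp | hp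
    · exact ⟨1, by rw [D.evenRoot_even hp, Int.cast_one, one_smul], by rw [hp, mul_zero]⟩
    · exact ⟨2, by rw [D.evenRoot_odd hp]; norm_num, by rw [hp]; decide⟩
  let c : Fin ℓ → ℤ := fun j => m j - if j = i then k * s else 0
  have hc : D.refl i (D.weight m) = ∑ j, (c j : ℂ) • D.root j := by
    rw [refl, hk, hs, weight, smul_smul]
    simp only [c, Int.cast_sub, sub_smul, Finset.sum_sub_distrib]
    congr 1
    rw [Finset.sum_eq_single i (fun j _ hj => by rw [if_neg hj]; simp) (by simp), if_pos rfl]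
    push_cast
    rfl
  have hci : ∀ j, j ≠ i → c j = m j := fun j hj => by simp [c, hj]
  obtain ⟨j, hji, hj⟩ := hm
  obtain ⟨m', hm'⟩ := D.exists_of_rootSpace_ne_bot (β := D.refl i (D.weight m)) fun h => hr (by
    rw [← D.finrank_rootSpace_refl hi, h, finrank_bot])
  have hcm : D.refl i (D.weight m) = D.weight m' := by
    refine hm'.resolve_right fun h => hj ?_
    rw [hc, weight, ← Finset.sum_neg_distrib] at h
    simp only [← neg_smul] at h
    have h1 := congrFun (D.eq_of_sum_smul_root_eq _ _ h) j
    rw [hci j hji] at h1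
    have h2 : ((m j + m' j : ℕ) : ℂ) = 0 := by
      push_cast at h1 ⊢
      rw [h1, neg_add_cancel]
    have h3 := Nat.cast_eq_zero.mp h2
    omega
  have hcm' : ∀ l, c l = m' l := by
    intro l
    rw [hc, weight] at hcm
    have h1 := congrFun (D.eq_of_sum_smul_root_eq _ _ hcm) l
    exact_mod_cast h1
  refine ⟨m', hcm.symm, ⟨j, hji, ?_⟩, ?_⟩
  · have h1 := hcm' j
    rw [hci j hji] at h1
    omega
  · refine Finset.sum_congr rfl fun l _ => ?_
    by_cases hl : l = i
    · subst hl
      have h1 : ((m' l : ℤ) : ZMod 2) = (m l : ZMod 2) - k * s := by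
        rw [← hcm' l]
        simp [c]
      rw [Int.cast_natCast] at h1
      rw [h1, sub_mul, mul_assoc, hsp, mul_zero, sub_zero]
    · have h1 := hcm' l
      rw [hci l hl] at h1
      rw [Nat.cast_injective (R := ℤ) h1]

open Classical in
/-- The permutation of `Q⁺` induced by `r_α` on the positive roots which are not multiples of `α_i`,
and trivial on all other elements. -/
def reflWeight (i : Fin ℓ) (m : Fin ℓ →₀ ℕ) : Fin ℓ →₀ ℕ :=
  if h : (IsTransverse i m ∧ Module.finrank ℂ (D.rootSpace (D.weight m)) ≠ 0) ∧
    ∃ m', D.weight m' = D.refl i (D.weight m) ∧ IsTransverse i m' ∧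
      D.weightParity m' = D.weightParity m then h.2.choose else m

variable {D} in
lemma reflWeight_of_not {m : Fin ℓ →₀ ℕ} (h : ¬ (IsTransverse i m ∧
    Module.finrank ℂ (D.rootSpace (D.weight m)) ≠ 0)) : D.reflWeight i m = m :=
  dif_neg fun h' => h h'.1

lemma reflWeight_spec (hi : D.A i i = 2) {m : Fin ℓ →₀ ℕ} (hm : IsTransverse i m)
    (hr : Module.finrank ℂ (D.rootSpace (D.weight m)) ≠ 0) :
    D.weight (D.reflWeight i m) = D.refl i (D.weight m) ∧ IsTransverse i (D.reflWeight i m) ∧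
      D.weightParity (D.reflWeight i m) = D.weightParity m := by
  have h : (IsTransverse i m ∧ Module.finrank ℂ (D.rootSpace (D.weight m)) ≠ 0) ∧
    ∃ m', D.weight m' = D.refl i (D.weight m) ∧ IsTransverse i m' ∧
      D.weightParity m' = D.weightParity m := ⟨⟨hm, hr⟩, D.exists_weight_eq_refl hi hm hr⟩
  rw [reflWeight, dif_pos h]
  exact h.2.choose_spec

lemma finrank_rootSpace_reflWeight (hi : D.A i i = 2) {m : Fin ℓ →₀ ℕ} (hm : IsTransverse i m)
    (hr : Module.finrank ℂ (D.rootSpace (D.weight m)) ≠ 0) :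
    Module.finrank ℂ (D.rootSpace (D.weight (D.reflWeight i m))) =
      Module.finrank ℂ (D.rootSpace (D.weight m)) := by
  rw [(D.reflWeight_spec hi hm hr).1, D.finrank_rootSpace_refl hi]

lemma reflWeight_involutive (hi : D.A i i = 2) : Function.Involutive (D.reflWeight i) := by
  intro m
  by_cases h : IsTransverse i m ∧ Module.finrank ℂ (D.rootSpace (D.weight m)) ≠ 0
  · obtain ⟨h1, h2, -⟩ := D.reflWeight_spec hi h.1 h.2
    refine D.weight_injective ?_
    rw [(D.reflWeight_spec hi h2 (by
      rw [D.finrank_rootSpace_reflWeight hi h.1 h.2]; exact h.2)).1, h1, D.refl_refl hi]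
  · rw [reflWeight_of_not h, reflWeight_of_not h]

lemma transSeries_reflWeight (hi : D.A i i = 2) (m : Fin ℓ →₀ ℕ) :
    D.transSeries i (D.reflWeight i m) = D.transSeries i m := by
  classical
  by_cases h : IsTransverse i m ∧ Module.finrank ℂ (D.rootSpace (D.weight m)) ≠ 0
  · obtain ⟨-, h2, h3⟩ := D.reflWeight_spec hi h.1 h.2
    rw [transSeries, transSeries, if_pos h.1, if_pos h2, denomSeries, denomSeries, h3,
      D.finrank_rootSpace_reflWeight hi h.1 h.2]
  · rw [reflWeight_of_not h]

lemma refl_sum_smul (k : (Fin ℓ →₀ ℕ) →₀ ℕ) (w : (Fin ℓ →₀ ℕ) → Module.Dual ℂ H) :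
    D.refl i (k.sum fun m c => c • w m) = k.sum fun m c => c • D.refl i (w m) := by
  let r : Module.Dual ℂ H →+ Module.Dual ℂ H :=
    ⟨⟨D.refl i, by simp [refl]⟩, fun μ ν => D.refl_add μ ν⟩
  have h := map_finsuppSum r k fun m c => c • w m
  simp only [map_nsmul] at h
  exact h

/-- The transverse part of the Weyl denominator is invariant under `r_α`. -/
lemma transDenom_refl (hi : D.A i i = 2) (γ : Module.Dual ℂ H) :
    D.transDenom i (D.refl i γ) = D.transDenom i γ := by
  classical
  rw [transDenom, transDenom,
    ← finsum_comp_equiv (Finsupp.equivCongrLeft (D.reflWeight_involutive hi).toPerm)]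
  refine finsum_congr fun k => ?_
  rw [Finsupp.equivCongrLeft_apply, Finsupp.sum_equivMapDomain, Finsupp.prod_equivMapDomain]
  simp only [Function.Involutive.coe_toPerm, D.transSeries_reflWeight hi]
  by_cases h0 : k.prod (fun m c => PowerSeries.coeff c (D.transSeries i m)) = 0
  · rw [h0, ite_self, ite_self]
  -- A nonzero summand involves only roots which are not multiples of `α_i`.
  have h1 : ∀ m ∈ k.support, IsTransverse i m ∧
      Module.finrank ℂ (D.rootSpace (D.weight m)) ≠ 0 := by
    intro m hm
    by_contra h
    refine Finset.prod_ne_zero_iff.mp h0 m hm ?_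
    have h2 : D.transSeries i m = 1 := by
      rw [transSeries]
      split_ifs with ht
      · exact D.denomSeries_eq_one (not_not.mp fun hr => h ⟨ht, hr⟩)
      · rfl
    change PowerSeries.coeff (k m) (D.transSeries i m) = 0
    rw [h2, PowerSeries.coeff_one, if_neg (Finsupp.mem_support_iff.mp hm)]
  have h2 : (k.sum fun m c => c • D.weight (D.reflWeight i m)) =
      D.refl i (k.sum fun m c => c • D.weight m) := by
    rw [refl_sum_smul]
    refine Finset.sum_congr rfl fun m hm => ?_
    change k m • _ = k m • _
    rw [(D.reflWeight_spec hi (h1 m hm).1 (h1 m hm).2).1]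
  rw [h2]
  refine if_congr ?_ rfl rfl
  exact (Function.Involutive.injective (D.refl_refl hi)).eq_iff

end CartanDatum


/-! ### The character formula -/

open LieSuperalgebra
open scoped ModuleCat

namespace CartanDatum

variable {ℓ : ℕ} {H : Type u} [AddCommGroup H] [Module ℂ H] (D : CartanDatum ℓ H) {i : Fin ℓ}
  {a b : ℂ}

variable {D} in
lemma weightSpace_ne_bot_of_ch_ne_zero {N : D.Mod} {ν : Module.Dual ℂ H} (h : D.ch N ν ≠ 0) :
    D.weightSpace N ν ≠ ⊥ := fun h0 => h (by rw [ch, h0, finrank_bot, Nat.cast_zero])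

lemma finite_weight_ch_ne_zero {N : D.Mod} (hN : D.IsBounded N) (μ : Module.Dual ℂ H) :
    {γ | (∃ n, γ = D.weight n) ∧ D.ch N (μ + γ) ≠ 0}.Finite := by
  refine ((D.finite_weights_above hN μ).preimage (f := fun γ => μ + γ)
    (add_right_injective μ).injOn).subset ?_
  rintro γ ⟨⟨n, hn⟩, hγ⟩
  exact ⟨weightSpace_ne_bot_of_ch_ne_zero hγ, n, congrArg (μ + ·) hn⟩

lemma exists_weight_of_transDenom_sub_root {γ : Module.Dual ℂ H}
    (h : D.transDenom i (γ - D.root i) ≠ 0) : ∃ n, γ = D.weight n := by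
  obtain ⟨n, hn⟩ := D.exists_weight_of_transDenom_ne_zero h
  exact ⟨n + Finsupp.single i 1, by rw [weight_add, weight_single, ← hn, sub_add_cancel]⟩

/-- Moving the factor `1 - e^{-α_i}` of `R` to the character. -/
lemma denomCh_eq (hi : D.A i i = 2) (h0 : D.algH (D.evenCoroot i) ≠ 0) {N : D.Mod}
    (hN : D.IsBounded N) (ρ μ : Module.Dual ℂ H) : D.denomCh ρ N μ =
      ∑ᶠ γ, D.transDenom i γ * (D.ch N (μ - ρ + γ) - D.ch N (μ - ρ + γ + D.root i)) := by
  set ν := μ - ρ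
  set g1 : Module.Dual ℂ H → ℚ := fun γ => D.transDenom i γ * D.ch N (ν + γ) with hg1
  set g2 : Module.Dual ℂ H → ℚ := fun γ => D.transDenom i (γ - D.root i) * D.ch N (ν + γ) with hg2
  set g3 : Module.Dual ℂ H → ℚ := fun γ => D.transDenom i γ * D.ch N (ν + γ + D.root i) with hg3
  have f1 : (Function.support g1).Finite := (D.finite_weight_ch_ne_zero hN ν).subset fun γ hγ =>
    ⟨D.exists_weight_of_transDenom_ne_zero (left_ne_zero_of_mul hγ), right_ne_zero_of_mul hγ⟩
  have f2 : (Function.support g2).Finite := (D.finite_weight_ch_ne_zero hN ν).subset fun γ hγ =>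
    ⟨D.exists_weight_of_transDenom_sub_root (left_ne_zero_of_mul hγ), right_ne_zero_of_mul hγ⟩
  have f3 : (Function.support g3).Finite :=
    (D.finite_weight_ch_ne_zero hN (ν + D.root i)).subset fun γ hγ =>
      ⟨D.exists_weight_of_transDenom_ne_zero (left_ne_zero_of_mul hγ), by
        rw [add_right_comm]; exact right_ne_zero_of_mul hγ⟩
  have h23 : ∑ᶠ γ, g2 γ = ∑ᶠ γ, g3 γ := by
    rw [← finsum_comp_equiv (Equiv.addRight (D.root i))]
    refine finsum_congr fun γ => ?_
    simp only [hg2, hg3, Equiv.coe_addRight, add_sub_cancel_right, add_assoc]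
  have hsupp : ∀ γ, g1 γ - g2 γ ≠ 0 → γ ∈ Set.range D.weight := by
    intro γ hγ
    by_contra hne
    refine hγ ?_
    rw [hg1, hg2]
    dsimp only
    rw [not_not.mp fun h => hne ((D.exists_weight_of_transDenom_ne_zero (i := i) h).imp
        fun _ h => h.symm), zero_mul,
      not_not.mp fun h => hne ((D.exists_weight_of_transDenom_sub_root (i := i) h).imp
        fun _ h => h.symm), zero_mul,
      sub_zero]
  calc D.denomCh ρ N μ = ∑ᶠ n, (g1 (D.weight n) - g2 (D.weight n)) := by
        refine finsum_congr fun n => ?_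
        rw [D.coeff_weylDenom hi h0, sub_mul]
    _ = ∑ᶠ γ ∈ Set.range D.weight, (g1 γ - g2 γ) :=
        (finsum_mem_range (f := fun γ => g1 γ - g2 γ) D.weight_injective).symm
    _ = ∑ᶠ γ, (g1 γ - g2 γ) := by
        rw [← finsum_mem_univ fun γ => g1 γ - g2 γ]
        exact finsum_mem_inter_support_eq' _ _ _ fun γ hγ => ⟨fun _ => trivial, fun _ => hsupp γ hγ⟩
    _ = ∑ᶠ γ, (g1 γ - g3 γ) := by
        rw [finsum_sub_distrib f1 f2, finsum_sub_distrib f1 f3, h23]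
    _ = _ := finsum_congr fun γ => (mul_sub _ _ _).symm

lemma algH_evenCoroot_ne_zero (ha : ∀ n : ℤ, a ≠ n) {N : D.Mod}
    (hN : IsWeightNilp (D.envE i) (D.envH i) a N) {ν : Module.Dual ℂ H}
    (hν : D.weightSpace N ν ≠ ⊥) : D.algH (D.evenCoroot i) ≠ 0 := by
  intro h
  obtain ⟨n, hn⟩ := D.weight_evenCoroot hN hν
  obtain ⟨v, hv, hv0⟩ := (Submodule.ne_bot_iff _).mp hν
  have h1 := D.mem_weightSpace.mp hv (D.evenCoroot i)
  rw [h, map_zero, zero_smul, eq_comm, smul_eq_zero] at h1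
  have h2 := h1.resolve_right hv0
  rw [hn] at h2
  exact ha (-n) (by push_cast; exact eq_neg_of_add_eq_zero_left h2)

/-- If `h` vanishes in `𝔤`, then `N` has no weights at all. -/
lemma denomCh_eq_zero (ha : ∀ n : ℤ, a ≠ n) {N : D.Mod}
    (hN : IsWeightNilp (D.envE i) (D.envH i) a N) (h0 : D.algH (D.evenCoroot i) = 0)
    (ρ μ : Module.Dual ℂ H) : D.denomCh ρ N μ = 0 := by
  refine finsum_eq_zero_of_forall_eq_zero fun n => mul_eq_zero_of_right _ ?_
  by_contra h
  exact D.algH_evenCoroot_ne_zero ha hN (weightSpace_ne_bot_of_ch_ne_zero h) h0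

/-- The character formula `R e^ρ ch C_a(N) = r_α(R e^ρ ch N)`. -/
lemma denomCh_enright [AdLocNilp (D.envE i)] [AdLocNilp (D.envF i)] (hi : D.A i i = 2)
    (ha : ∀ n : ℤ, a ≠ n) {ρ : Module.Dual ℂ H} (hρ : D.IsWeylVector ρ) {N : D.Mod}
    (hN : D.catO N) (hM : D.catM i a N)
    (hC : D.catO ((enright (D.envE i) (D.envF i) a).obj N)) :
    D.denomCh ρ ((enright (D.envE i) (D.envF i) a).obj N) = D.reflSum i (D.denomCh ρ N) := by
  have hab : a + -a = 0 := add_neg_cancel a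
  have hb : ∀ n : ℤ, -a ≠ n := fun n hn => ha (-n) (by push_cast; rw [← hn, neg_neg])
  have hE := D.isWeightNilp_of_catO hN hM
  have hCE := isWeightNilp_enright (f := D.envF i) (D.isSl2 hi) hab hE
  have hinv : Function.Involutive (D.refl i) := D.refl_refl hi
  funext μ
  rw [reflSum]
  by_cases h0 : D.algH (D.evenCoroot i) = 0
  · rw [D.denomCh_eq_zero hb hCE h0, D.denomCh_eq_zero ha hE h0]
  rw [D.denomCh_eq hi h0 hC.2.2, D.denomCh_eq hi h0 hN.2.2,
    ← finsum_comp_equiv (Function.Involutive.toPerm (D.refl i) hinv)]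
  have h1 := D.dotRefl_eq hρ hi 0
  rw [dotRefl, zero_add, show D.refl i 0 = 0 by simp [refl]] at h1
  refine finsum_congr fun γ => ?_
  have h2 : μ - ρ + D.refl i γ = D.refl i (D.refl i μ - ρ + γ) - D.root i := by
    rw [refl_add, refl_sub, D.refl_refl hi]
    linear_combination (norm := module) h1
  rw [Function.Involutive.coe_toPerm, D.transDenom_refl hi,
    ← D.finrank_kerSpace hi ha hE hN.2.1, ← D.finrank_kerSpace hi hb hCE hC.2.1,
    ← D.finrank_kerSpace_enright hi ha hab hE, h2]

end CartanDatum


end KMSuper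

end

theorem mainTheorem7 {ℓ : ℕ} {H : Type*} [AddCommGroup H] [Module ℂ H]
    (D : KMSuper.CartanDatum ℓ H) (ρ : Module.Dual ℂ H) (hρ : D.IsWeylVector ρ)
    (i : Fin ℓ) (hi : D.A i i = 2) (a : ℂ) (ha : ∀ n : ℤ, a ≠ n) :
    (∃ hC : ∀ N : (D.catOFin i a).FullSubcategory,
        D.catOFin i (-a) (((D.catOFin i a).ι ⋙ D.enrightFunctor i hi a).obj N),
      ((D.catOFin i (-a)).lift ((D.catOFin i a).ι ⋙ D.enrightFunctor i hi a) hC).IsEquivalence) ∧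
    (∀ (μ : Module.Dual ℂ H) (q : ZMod 2), (∃ n : ℤ, μ (D.evenCoroot i) = a + n) →
      ∃ q' : ZMod 2, Nonempty ((D.enrightFunctor i hi a).obj (D.simpleModule μ q) ≅
        D.simpleModule (D.dotRefl ρ i μ) q')) ∧
    (∀ N : D.Mod, D.catO N → D.catM i a N → D.catO ((D.enrightFunctor i hi a).obj N) →
      D.denomCh ρ ((D.enrightFunctor i hi a).obj N) = D.reflSum i (D.denomCh ρ N)) ∧
    (∀ N : D.Mod, D.catOFin i a N →
      D.denomCh ρ ((D.enrightFunctor i hi a).obj N) = D.reflSum i (D.denomCh ρ N)) := by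
  have : KMSuper.AdLocNilp (D.envE i) :=
    KMSuper.Env.adLocNilp _ (D.θ_sl2E i) (D.adLocNilp_e i hi _)
  have : KMSuper.AdLocNilp (D.envF i) :=
    KMSuper.Env.adLocNilp _ (D.θ_sl2F i) (D.adLocNilp_f i hi _)
  have hF : D.enrightFunctor i hi a = KMSuper.enright (D.envE i) (D.envF i) a := rfl
  rw [hF]
  have hab : a + -a = 0 := add_neg_cancel a
  have hb : ∀ n : ℤ, -a ≠ n := fun n hn => ha (-n) (by push_cast; rw [← hn, neg_neg])
  refine ⟨⟨fun N => D.catOFin_enright hi ha hab N.property, ?_⟩, fun μ q hμ => ?_,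
    fun N hN hM hC => D.denomCh_enright hi ha hρ hN hM hC,
    fun N hN => D.denomCh_enright hi ha hρ hN.1 hN.2.2 (D.catOFin_enright hi ha hab hN).1⟩
  · exact KMSuper.isEquivalence_enright (D.isSl2 hi) ha hab _ _
      (fun N hN => D.isWeightNilp_of_catO hN.1 hN.2.2)
      (fun N hN => D.isWeightNilp_of_catO hN.1 hN.2.2)
      (fun N hN => D.catOFin_enright hi hb (neg_add_cancel a) hN) _
  · rw [D.dotRefl_eq hρ hi]
    exact ⟨q + D.p i, D.nonempty_enright_iso hi ha hab hμ⟩
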